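/- Let $(M,g)$ be a compact oriented surface, regarded as a Riemann surface with the complex structure determined by $g$ and the orientation, and let $S$ be a spin structure on $M$, i.e. a holomorphic line bundle with a holomorphic isomorphism $S\otimes S\cong K$, where $K$ is the canonical bundle. Equip $S$ with the Hermitian metric $|s|^2=|s\otimes s|_g$ and let $\Sigma M=S\oplus\bar S$ be the spinor bundle, with the Dirac operator $\mathcal D_g(\psi_+,\psi_-)=2(\partial_g\psi_-,-\bar\partial_g\psi_+)$; here, if $s_0$ is a local section of $S$ with $s_0\otimes s_0=dz$, then $\bar\partial_g(fs_0)=|s_0|^2(\partial_{\bar z}f)\bar s_0$ and $\partial_g(f\bar s_0)=|s_0|^2(\partial_{z}f)s_0$. Let $\nabla$ be the connection on $\Sigma M$ given by the Chern connection of $S$ and its complex conjugate, and let Clifford multiplication be the complex bilinear map with $\partial_{\bar z}\cdot(f_+s_0,f_-\bar s_0)=|s_0|^{-2}(f_-s_0,0)$ and $\partial_z\cdot(f_+s_0,f_-\bar s_0)=|s_0|^{-2}(0,-f_+\bar s_0)$. For a spinor $\psi$ let $$Q_\psi(X,Y)=\tfrac12\,\mathrm{Re}\big(\langle X\cdot\nabla_Y\psi,\psi\rangle+\langle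 Y\cdot\nabla_X\psi,\psi\rangle\big)$$ be its energy-momentum tensor. Suppose that $\psi_1,\dots,\psi_m$ are smooth sections of $\Sigma M$ with $\mathcal D_g\psi_j=\lambda\psi_j$ for a real number $\lambda\neq0$, and that $$\sum_{j=1}^m Q_{\psi_j}=\frac{\lambda}{2}\,g .$$ Then $\psi_1,\dots,\psi_m$ have no common zero, and the map $\Psi\colon M\to\mathbb{CP}^{2m-1}$ given in homogeneous coordinates by $[\psi_{1+}:\bar\psi_{1-}:\dots:\psi_{m+}:\bar\psi_{m-}]$ is smooth, harmonic (a critical point of the energy $\frac12\int_M|d\Psi|^2\,dv_g$) and weakly conformal, where $\mathbb{CP}^{2m-1}$ carries four times the Fubini-Study metric of holomorphic sectional curvature $4$. In particular it is a branched minimal immersion: an immersion except at branch points, and a critical point of the area with respect to variations compactly supported in the set where it is an immersion. -/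

import Mathlib

open scoped Manifold ContDiff Bundle InnerProductSpace Topology LinearAlgebra.Projectivization
open Bundle MeasureTheory Asymptotics

noncomputable section

namespace SpinSurface

/-! ### Riemann surfaces and Hermitian metrics -/

section Surface

variable {M : Type*} [TopologicalSpace M] [ChartedSpace ℂ M]

/-- A Riemann surface is in particular a smooth (real analytic) real surface. -/
instance isManifold_real [IsManifold 𝓘(ℂ) ω M] : IsManifold 𝓘(ℝ, ℂ) ω M := by
  apply isManifold_of_contDiffOn
  intro e e' he he'
  have h := (contDiffGroupoid ω 𝓘(ℂ)).compatible he he'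
  rw [contDiffGroupoid, mem_groupoid_of_pregroupoid] at h
  exact ContDiffOn.restrict_scalars ℝ h.1

/-- The real tangent space of a Riemann surface. Its underlying space is `ℂ`, through the preferred
holomorphic chart at the point. -/
abbrev RealTangent (p : M) : Type := TangentSpace 𝓘(ℝ, ℂ) p

/-- The complex structure of the real tangent space. -/
def J (p : M) (X : RealTangent p) : RealTangent p :=
  show ℂ from Complex.I * (show ℂ from X)

variable [IsManifold 𝓘(ℂ) ω M]

variable (M) in
/-- A smooth Hermitian metric on a Riemann surface, given through its real part: a smooth Riemannian
metric for which the complex structure is an isometry. Equivalently, a Riemannian metric on an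
oriented surface whose associated complex structure is the given one. -/
structure HermitianMetric extends
    ContMDiffRiemannianMetric 𝓘(ℝ, ℂ) ∞ ℂ (fun p : M => RealTangent p) where
  J_invariant : ∀ (p : M) (X Y : RealTangent p), inner p (J p X) (J p Y) = inner p X Y

namespace HermitianMetric

variable (g : HermitianMetric M)

/-- A unit tangent vector; `e₁ p, e₂ p` is a positively oriented orthonormal basis at `p`. -/
def e₁ (p : M) : RealTangent p :=
  (Real.sqrt (g.inner p (1 : ℂ) (1 : ℂ)))⁻¹ • (show RealTangent p from (1 : ℂ))

/-- The unit tangent vector obtained from `e₁ p` by the complex structure. -/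
def e₂ (p : M) : RealTangent p := J p (g.e₁ p)

/-- The Riemannian area density `√(g₁₁ g₂₂ - g₁₂²)` in the preferred chart at `x`, as a function of
the coordinate `z`. -/
def areaDensity (x : M) (z : ℂ) : ℝ :=
  let φ := (chartAt ℂ x).symm
  let X₁ : RealTangent (φ z) := mfderiv 𝓘(ℝ, ℂ) 𝓘(ℝ, ℂ) φ z (1 : ℂ)
  let X₂ : RealTangent (φ z) := mfderiv 𝓘(ℝ, ℂ) 𝓘(ℝ, ℂ) φ z Complex.I
  Real.sqrt (g.inner (φ z) X₁ X₁ * g.inner (φ z) X₂ X₂ - g.inner (φ z) X₁ X₂ ^ 2)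

/-- The Riemannian area measure `dv_g`: the smallest measure which is at least
`√(g₁₁ g₂₂ - g₁₂²) dx dy` on the domain of every preferred chart. (The chart measures agree on
overlaps, so this is the measure equal to each of them on the domain of the chart.) -/
def area [MeasurableSpace M] : Measure M :=
  ⨆ x : M, ((volume.restrict (chartAt ℂ x).target).withDensity
    (fun z => ENNReal.ofReal (g.areaDensity x z))).map (chartAt ℂ x).symm

end HermitianMetric

end Surface

/-! ### The complex conjugate of a vector space -/

/-- The complex conjugate `V̄` of a complex vector space `V`: the same additive group, with scalars
acting through complex conjugation. -/
def Conj (V : Type*) : Type _ := V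

instance {V : Type*} [AddCommGroup V] : AddCommGroup (Conj V) := inferInstanceAs (AddCommGroup V)

instance {V : Type*} [AddCommGroup V] [Module ℂ V] : Module ℂ (Conj V) :=
  Module.compHom V (starRingEnd ℂ)

/-- The canonical conjugate-linear bijection `V → V̄`, `v ↦ v̄`. -/
def bar {V : Type*} (v : V) : Conj V := v

/-- The canonical conjugate-linear bijection `V̄ → V`, inverse to `v ↦ v̄`. -/
def unbar {V : Type*} (v : Conj V) : V := v

/-! ### Spin structures -/

section Spin

variable {M : Type*} [TopologicalSpace M] [ChartedSpace ℂ M] [IsManifold 𝓘(ℂ) ω M]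
  (S : M → Type*) [∀ p, AddCommGroup (S p)] [∀ p, Module ℂ (S p)] [∀ p, TopologicalSpace (S p)]
  [TopologicalSpace (TotalSpace ℂ S)] [FiberBundle ℂ S] [VectorBundle ℂ ℂ S]

/-- The nowhere vanishing holomorphic section given by the preferred trivialization of `S` around
`p`, at a point `q` of its domain. -/
def frame (p q : M) : S q := (trivializationAt ℂ S p).symmL ℂ q 1

/-- The holomorphic coordinate vector field `∂_z` of the preferred chart around `p`, at a point `q`
of its domain. -/
def coordField (p q : M) : TangentSpace 𝓘(ℂ) q :=
  (trivializationAt ℂ (TangentSpace 𝓘(ℂ) : M → Type _) p).symmL ℂ q 1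

/-- A spin structure on the holomorphic line bundle `S`: an isomorphism `S ⊗ S ≅ K` of holomorphic
line bundles, given by the corresponding bilinear map `S × S → K`. On lines, such a map is an
isomorphism if and only if `s ⊗ s` is nonzero for `s ≠ 0`; it is holomorphic if and only if
`(e ⊗ e)(∂_z)` is, for the local holomorphic frames `e` of `S`. The fibre of `K` at `p` consists of
the complex linear functionals on the complex tangent line at `p`. -/
structure SpinStructure where
  sq (p : M) : S p →ₗ[ℂ] S p →ₗ[ℂ] (TangentSpace 𝓘(ℂ) p →ₗ[ℂ] ℂ)
  sq_self_ne_zero : ∀ (p : M) (s : S p), s ≠ 0 → sq p s s ≠ 0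
  holomorphic : ∀ p : M, ContMDiffAt 𝓘(ℂ) 𝓘(ℂ) ω
    (fun q => sq q (frame S p q) (frame S p q) (coordField p q)) p

variable {S}

/-- The number `(s ⊗ t)(X)`, for `s, t ∈ S_p` and a tangent vector `X` at `p`. -/
def SpinStructure.pair (σ : SpinStructure S) {p : M} (s t : S p) (X : RealTangent p) : ℂ :=
  σ.sq p s t (show ℂ from X)

/-- The coordinate of `s ∈ S_q` in the preferred holomorphic trivialization of `S` around `p`. -/
def coord (p : M) {q : M} (s : S q) : ℂ := (trivializationAt ℂ S p ⟨q, s⟩).2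

/-- Smooth sections of `S`. -/
def IsSmoothSection (s : ∀ p, S p) : Prop :=
  ∀ p : M, ContMDiffAt 𝓘(ℝ, ℂ) 𝓘(ℝ, ℂ) ∞ (fun q => coord p (s q)) p

variable (S) in
/-- A smooth section `(ψ₊, ψ₋)` of the spinor bundle `S ⊕ S̄`. -/
structure Spinor where
  plus (p : M) : S p
  minus (p : M) : Conj (S p)
  smooth_plus : IsSmoothSection plus
  smooth_minus : IsSmoothSection (fun p => unbar (minus p))

/-- The value of a spinor at a point. -/
def Spinor.val (ψ : Spinor S) (p : M) : S p × Conj (S p) := (ψ.plus p, ψ.minus p)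

namespace SpinStructure

variable (σ : SpinStructure S) (g : HermitianMetric M)

/-- The square norm on `S`: `|s|² = |s ⊗ s|`, the norm of `s ⊗ s` as a covector. -/
def normSq {p : M} (s : S p) : ℝ := ‖σ.pair s s (g.e₁ p)‖

/-- The Hermitian inner product `⟨s, t⟩` on the line `S_p` with `⟨s, s⟩ = |s|²`; it is linear in the
first argument. -/
def herm {p : M} (s t : S p) : ℂ :=
  coord p s * starRingEnd ℂ (coord p t) * (σ.normSq g (frame S p p) : ℂ)

/-- The Hermitian inner product on `Σ_p = S_p ⊕ S̄_p`. -/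
def hermSpinor {p : M} (a b : S p × Conj (S p)) : ℂ :=
  σ.herm g a.1 b.1 + starRingEnd ℂ (σ.herm g (unbar a.2) (unbar b.2))

/-- The real differential at `p` of the coordinate of a section of `S`. -/
def dCoord (s : ∀ p, S p) (p : M) (X : RealTangent p) : ℂ :=
  mfderiv 𝓘(ℝ, ℂ) 𝓘(ℝ, ℂ) (fun q => coord p (s q)) p X

/-- The operator `∂̄` on sections of `S`, evaluated on a real tangent vector:
`∂̄(f e)(X) = (df(X) + i df(iX))/2 e` for a holomorphic frame `e`. -/
def dbar (s : ∀ p, S p) (p : M) (X : RealTangent p) : S p :=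
  ((dCoord s p X + Complex.I * dCoord s p (J p X)) / 2) • frame S p p

/-- The contraction `S ⊗ K̄ ≅ S ⊗ S̄ ⊗ S̄ → S̄` by the Hermitian metric, applied to an element
`β` of `S_p ⊗ K̄_p`, viewed as an antilinear map from the tangent space to `S_p`. With a basis `e` of
`S_p`, it sends `b e ⊗ (ē ⊗ ē)` to `b |e|² ē`. -/
def contract {p : M} (β : RealTangent p → S p) : Conj (S p) :=
  let e := frame S p p
  let b : ℂ := coord p (β (g.e₁ p)) / starRingEnd ℂ (σ.pair e e (g.e₁ p))
  (b * (σ.normSq g e : ℂ)) • bar e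

/-- The operator `∂̄_g : Γ(S) → Γ(S̄)`. -/
def dbarG (s : ∀ p, S p) (p : M) : Conj (S p) := σ.contract g (dbar s p)

/-- The operator `∂_g : Γ(S̄) → Γ(S)`, the complex conjugate of `∂̄_g`. -/
def dG (s : ∀ p, Conj (S p)) (p : M) : S p := unbar (σ.dbarG g (fun q => unbar (s q)) p)

/-- The Dirac operator `𝒟_g (ψ₊, ψ₋) = 2 (∂_g ψ₋, -∂̄_g ψ₊)`. -/
def dirac (ψ : Spinor S) (p : M) : S p × Conj (S p) :=
  (2 : ℂ) • (σ.dG g ψ.minus p, -σ.dbarG g ψ.plus p)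

/-- The connection form `∂ log |e|²` of the Chern connection of `S`, at `p`, with respect to the
preferred holomorphic frame `e` around `p`. -/
def chernForm (p : M) (X : RealTangent p) : ℂ :=
  let d : RealTangent p →L[ℝ] ℝ :=
    mfderiv 𝓘(ℝ, ℂ) 𝓘(ℝ, ℝ) (fun q => Real.log (σ.normSq g (frame S p q))) p
  ((d X : ℂ) - Complex.I * (d (J p X) : ℂ)) / 2

/-- The Chern connection of `S`: `∇_X (f e) = (df(X) + f ∂ log |e|² (X)) e`. -/
def chern (s : ∀ p, S p) (p : M) (X : RealTangent p) : S p :=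
  (dCoord s p X + coord p (s p) * σ.chernForm g p X) • frame S p p

/-- The Clifford connection `∇_X (ψ₊, ψ₋) = (∇_X ψ₊, conj (∇_X (conj ψ₋)))`, for real `X`. -/
def nabla (ψ : Spinor S) (p : M) (X : RealTangent p) : S p × Conj (S p) :=
  (σ.chern g ψ.plus p X, bar (σ.chern g (fun q => unbar (ψ.minus q)) p X))

/-- The vector `w ∈ S_p` representing the functional `t ↦ (t ⊗ s)(X)` on `S_p`, that is, with
`⟨t, w⟩ = (t ⊗ s)(X)` for all `t`. If `s₀ ⊗ s₀ = dz`, `s = f s₀` and `X = a ∂_z + ā ∂_z̄`, then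
`w = |s₀|⁻² ā f̄ s₀`. -/
def riesz {p : M} (X : RealTangent p) (s : S p) : S p :=
  let e := frame S p p
  (starRingEnd ℂ (σ.pair e s X) / (σ.normSq g e : ℂ)) • e

/-- Clifford multiplication by a real tangent vector. If `s₀ ⊗ s₀ = dz` and `X = a ∂_z + ā ∂_z̄`,
then `X · (f₊ s₀, f₋ s̄₀) = |s₀|⁻² (ā f₋ s₀, -a f₊ s̄₀)`. -/
def clifford {p : M} (X : RealTangent p) (a : S p × Conj (S p)) : S p × Conj (S p) :=
  (σ.riesz g X (unbar a.2), -bar (σ.riesz g X a.1))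

/-- The energy-momentum tensor
`Q_ψ(X, Y) = 1/2 Re (⟨X · ∇_Y ψ, ψ⟩ + ⟨Y · ∇_X ψ, ψ⟩)`. -/
def energyMomentum (ψ : Spinor S) (p : M) (X Y : RealTangent p) : ℝ :=
  (1 / 2) * (σ.hermSpinor g (σ.clifford g X (σ.nabla g ψ p Y)) (ψ.val p) +
    σ.hermSpinor g (σ.clifford g Y (σ.nabla g ψ p X)) (ψ.val p)).re

end SpinStructure

end Spin

/-! ### Maps to complex projective space -/

section Projective

variable {V : Type*} [NormedAddCommGroup V] [InnerProductSpace ℂ V]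

/-- The affine chart of projective space centred at `y = [w]`, as a local section of
`V ∖ 0 → ℙ(V)`: it sends `[x]` to the multiple of `x` whose orthogonal projection to the line `y`
is the chosen representative `w` of `y`. It is defined where `x` is not orthogonal to `w`, and takes
the value `0` elsewhere. -/
def affineLift (y x : ℙ ℂ V) : V := ((‖y.rep‖ : ℂ) ^ 2 / ⟪y.rep, x.rep⟫_ℂ) • x.rep

/-- Smoothness of a map from a real manifold to complex projective space: the local lift
to `V ∖ 0` given by the affine chart centred at the image of each point is smooth there. -/
def IsSmoothMap {E H N : Type*} [NormedAddCommGroup E] [NormedSpace ℝ E] [TopologicalSpace H]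
    (I : ModelWithCorners ℝ E H) [TopologicalSpace N] [ChartedSpace H N] (Ψ : N → ℙ ℂ V) : Prop :=
  ∀ p : N, ContMDiffAt I 𝓘(ℝ, V) ∞ (fun q => affineLift (Ψ p) (Ψ q)) p

variable {M : Type*} [TopologicalSpace M] [ChartedSpace ℂ M]

/-- The differential of `Ψ` at `p`: with `L = Ψ(p)` viewed as a line in `V`, the tangent space of
projective space at `L` is `Hom(L, L^⊥)`, and a homomorphism is given by its value at the chosen
representative of `L`. This is `π_{L^⊥} dF(X)` for any local lift `F` of `Ψ` taking that value at
`p`; the lift used here has differential in `L^⊥`. -/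
def diff (Ψ : M → ℙ ℂ V) (p : M) : RealTangent p →L[ℝ] V :=
  mfderiv 𝓘(ℝ, ℂ) 𝓘(ℝ, V) (fun q => affineLift (Ψ p) (Ψ q)) p

/-- The pullback by `Ψ` of the Riemannian metric of complex projective space: four times the
Fubini-Study metric of holomorphic sectional curvature `4`, that is,
`4 Re ⟨dΨ(X)(l), dΨ(Y)(l)⟩ / |l|²`. -/
def pullbackMetric (Ψ : M → ℙ ℂ V) (p : M) (X Y : RealTangent p) : ℝ :=
  4 * (⟪diff Ψ p X, diff Ψ p Y⟫_ℂ).re / ‖(Ψ p).rep‖ ^ 2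

/-- `Ψ` is an immersion at `p`. -/
def IsImmersionAt (Ψ : M → ℙ ℂ V) (p : M) : Prop := Function.Injective (diff Ψ p)

/-- A smooth one-parameter variation of `Ψ`. -/
structure IsVariation (Ψ : M → ℙ ℂ V) (Φ : ℝ → M → ℙ ℂ V) : Prop where
  smooth : IsSmoothMap (𝓘(ℝ, ℝ).prod 𝓘(ℝ, ℂ)) (fun x : ℝ × M => Φ x.1 x.2)
  zero : Φ 0 = Ψ

variable [IsManifold 𝓘(ℂ) ω M] (g : HermitianMetric M)

/-- The energy density `|dΨ|²` (Hilbert-Schmidt norm). -/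
def energyDensity (Ψ : M → ℙ ℂ V) (p : M) : ℝ :=
  pullbackMetric Ψ p (g.e₁ p) (g.e₁ p) + pullbackMetric Ψ p (g.e₂ p) (g.e₂ p)

/-- The Jacobian of `Ψ`: the ratio of the area densities of the pullback metric and of `g`. -/
def jacobian (Ψ : M → ℙ ℂ V) (p : M) : ℝ :=
  Real.sqrt (pullbackMetric Ψ p (g.e₁ p) (g.e₁ p) * pullbackMetric Ψ p (g.e₂ p) (g.e₂ p) -
    pullbackMetric Ψ p (g.e₁ p) (g.e₂ p) ^ 2)

variable [MeasurableSpace M]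

/-- The energy `E(Ψ) = 1/2 ∫ |dΨ|² dv_g`. -/
def energy (Ψ : M → ℙ ℂ V) : ℝ := (1 / 2) * ∫ p, energyDensity g Ψ p ∂g.area

/-- The area of `Ψ`. -/
def mapArea (Ψ : M → ℙ ℂ V) : ℝ := ∫ p, jacobian g Ψ p ∂g.area

/-- Harmonic maps from a compact Riemann surface with Hermitian metric `g` to complex projective
space: smooth critical points of the energy. -/
structure IsHarmonic (Ψ : M → ℙ ℂ V) : Prop where
  smooth : IsSmoothMap 𝓘(ℝ, ℂ) Ψ
  critical : ∀ Φ : ℝ → M → ℙ ℂ V, IsVariation Ψ Φ → HasDerivAt (fun t => energy g (Φ t)) 0 0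

/-- `Ψ` is weakly conformal: the pullback metric is a nonnegative multiple of `g` at each point. -/
def IsWeaklyConformal (Ψ : M → ℙ ℂ V) : Prop :=
  ∃ c : M → ℝ, (∀ p, 0 ≤ c p) ∧
    ∀ (p : M) (X Y : RealTangent p), pullbackMetric Ψ p X Y = c p * g.inner p X Y

/-- In suitable smooth real coordinates `w` centred at `p`, and linear coordinates of the affine
chart at `Ψ(p)`, the map `Ψ` has the form `(Re wᵏ, Im wᵏ, 0, …)` up to a remainder
which is `o(|w|ᵏ)` and has first derivatives `o(|w|ᵏ⁻¹)`. For `k = 1` this means that `Ψ` is an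
immersion at `p`, for `k ≥ 2` that `p` is a branch point of order `k - 1`. -/
def HasBranchForm (Ψ : M → ℙ ℂ V) (p : M) (k : ℕ) : Prop :=
  let z₀ : ℂ := chartAt ℂ p p
  let f : ℂ → V := fun z => affineLift (Ψ p) (Ψ ((chartAt ℂ p).symm z))
  ∃ (w : ℂ → ℂ) (a b : V),
    ContDiffAt ℝ ∞ w z₀ ∧ w z₀ = 0 ∧ Function.Injective (fderiv ℝ w z₀) ∧
    LinearIndependent ℝ ![a, b] ∧
    let R : ℂ → V := fun z => f z - f z₀ - ((w z ^ k).re • a + (w z ^ k).im • b)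
    (R =o[𝓝 z₀] fun z => ‖z - z₀‖ ^ k) ∧
    ((fun z => fderiv ℝ R z) =o[𝓝 z₀] fun z => ‖z - z₀‖ ^ (k - 1))

/-- A branched minimal immersion: a branched immersion (an immersion except at branch
points) which is minimal, i.e. a critical point of the area with respect to all smooth variations
supported in a compact subset of the open set where it is an immersion. -/
structure IsBranchedMinimalImmersion (Ψ : M → ℙ ℂ V) : Prop where
  smooth : IsSmoothMap 𝓘(ℝ, ℂ) Ψ
  branched : ∀ p : M, ∃ k : ℕ, 1 ≤ k ∧ HasBranchForm Ψ p k
  minimal : ∀ (Φ : ℝ → M → ℙ ℂ V) (K : Set M), IsVariation Ψ Φ → IsCompact K →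
    (∀ p ∈ K, IsImmersionAt Ψ p) → (∀ (t : ℝ), ∀ p ∉ K, Φ t p = Ψ p) →
    HasDerivAt (fun t => mapArea g (Φ t)) 0 0

end Projective

/-! ### The map defined by a family of spinors -/

section SpinorMap

variable {M : Type*} {S : M → Type*} [TopologicalSpace M] [ChartedSpace ℂ M]
  [∀ p, AddCommGroup (S p)] [∀ p, Module ℂ (S p)] [∀ p, TopologicalSpace (S p)]
  [TopologicalSpace (TotalSpace ℂ S)] [FiberBundle ℂ S] [VectorBundle ℂ ℂ S]

/-- The vector `(ψ₁₊, ψ̄₁₋, …, ψ_m₊, ψ̄_m₋)` at `p`, with entries in the line `S_p`, written in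
`ℂ^{2m}` by means of an isomorphism `S_p ≅ ℂ`. -/
def homCoord {m : ℕ} (ψ : Fin m → Spinor S) (p : M) (ℓ : S p ≃ₗ[ℂ] ℂ) :
    EuclideanSpace ℂ (Fin m × Fin 2) :=
  WithLp.toLp 2 fun i => ![ℓ ((ψ i.1).plus p), ℓ (unbar ((ψ i.1).minus p))] i.2

/-- `Ψ = [ψ₁₊ : ψ̄₁₋ : … : ψ_m₊ : ψ̄_m₋]`; in particular the `ψ_j` have no common zero. -/
def IsSpinorMap {m : ℕ} (ψ : Fin m → Spinor S)
    (Ψ : M → ℙ ℂ (EuclideanSpace ℂ (Fin m × Fin 2))) : Prop :=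
  ∀ (p : M) (ℓ : S p ≃ₗ[ℂ] ℂ), ∃ h : homCoord ψ p ℓ ≠ 0,
    Ψ p = Projectivization.mk ℂ (homCoord ψ p ℓ) h

end SpinorMap

end SpinSurface

end

/-! In a holomorphic frame e of S and a holomorphic coordinate z write e ⊗ e = h dz, with h
holomorphic, and let F be the ℂ^{2m}-valued function of coordinates of ψ₁₊, ψ̄₁₋, …, ψ_m₊, ψ̄_m₋.
Let G = jF, where j is the quaternionic structure (f, k) ↦ (-k̄, f̄). The Dirac equation says that
∂̄F is a multiple of G (`dzbar_localSpinor_self`), hence orthogonal to F. In the energy-momentum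
tensor the Chern forms cancel, and what remains is the real part of the symmetrization of h X Ω(Y),
with Ω = Σ (f dk - k df) the Hermitian product of dF with jF. The equation for ΣQ therefore has two
contents (`energyMomentum_consequences`). Its trace, combined with the Dirac equation, is Σ|ψ_j|² =
1, which excludes common zeros. Its trace free part is ∂F ⟂ G.

Conformality: ∂̄F is orthogonal both to F and to ∂F, which makes the pullback metric a multiple of
g. The contribution of ∂̄F alone bounds the factor below by λ². So Ψ is an immersion everywhere and
the branch form has order one at each point.

Harmonicity: the normalization eliminates the metric from the Dirac equation and leaves ∂̄F =
c|F|²G, ∂G = -c̄|F|²F with c = λh̄ antiholomorphic (operators without the factor 1/2). Embed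
projective space in the Hermitian matrices by sending a line to its orthogonal projection p; the
metric of the theorem is twice the induced one (`pullbackMetric_eq`). Tangent vectors are the
matrices that are off-diagonal for the splitting into line and complement, and Δp must be shown to
have no such part. The system gives (∂̄p)p = c G F*, and applying ∂ shows that Δp preserves the line
(`inner_laplacian_lineProj_eq_zero`, `trace_mul_eq_zero`). Green's formula
(`integral_gradPair_eq_zero`) then kills the first variation of the energy.

Area: for a variation of a conformal immersion, the energy and area densities differ by O(t²),
uniformly on the compact surface, so a stationary energy forces a stationary area
(`hasDerivAt_integral_sqrt_gramDet`). -/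

noncomputable section

namespace SpinSurface

/-! ### Coordinate changes, and differentials read in the preferred charts -/

section Charts

variable {M : Type*} [TopologicalSpace M] [ChartedSpace ℂ M] [IsManifold 𝓘(ℂ) ω M]

/-- The coordinate change between the preferred charts at `x` and `y`. -/
def transition (x y : M) (z : ℂ) : ℂ := chartAt ℂ y ((chartAt ℂ x).symm z)

theorem contDiffAt_transition {x y : M} {z : ℂ} (hz : z ∈ (chartAt ℂ x).target)
    (hy : (chartAt ℂ x).symm z ∈ (chartAt ℂ y).source) :
    ContDiffAt ℂ ω (transition x y) z := by
  have h := (contDiffGroupoid ω 𝓘(ℂ)).compatible (chart_mem_atlas ℂ x) (chart_mem_atlas ℂ y)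
  rw [contDiffGroupoid, mem_groupoid_of_pregroupoid] at h
  have h1 : ContDiffOn ℂ ω (transition x y) ((chartAt ℂ x).symm ≫ₕ chartAt ℂ y).source := by
    exact (by simpa [contDiffPregroupoid, Function.comp_def] using h.1 : ContDiffOn ℂ ω
      (fun z => chartAt ℂ y ((chartAt ℂ x).symm z)) _)
  refine h1.contDiffAt (((chartAt ℂ x).symm ≫ₕ chartAt ℂ y).open_source.mem_nhds ?_)
  simp [hz, hy]

theorem contDiffAt_transition_real {x y : M} {z : ℂ} (hz : z ∈ (chartAt ℂ x).target)
    (hy : (chartAt ℂ x).symm z ∈ (chartAt ℂ y).source) :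
    ContDiffAt ℝ ∞ (transition x y) z :=
  ((contDiffAt_transition hz hy).restrict_scalars ℝ).of_le (by simp)

/-- The complex number by which the differential at `z` of the inverse of the preferred chart at
`x` multiplies, the tangent space at the image being `ℂ` through the chart preferred there. -/
def chartFactor (x : M) (z : ℂ) : ℂ := deriv (transition x ((chartAt ℂ x).symm z)) z

theorem hasDerivAt_transition {x y : M} {z : ℂ} (hz : z ∈ (chartAt ℂ x).target)
    (hy : (chartAt ℂ x).symm z = y) :
    HasDerivAt (transition x y) (chartFactor x z) z := by
  subst hy
  exact ((contDiffAt_transition hz (mem_chart_source ℂ _)).differentiableAt (by simp)).hasDerivAt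

theorem mdifferentiableAt_chart_symm {x : M} {z : ℂ} (hz : z ∈ (chartAt ℂ x).target) :
    MDifferentiableAt 𝓘(ℝ, ℂ) 𝓘(ℝ, ℂ) (chartAt ℂ x).symm z :=
  mdifferentiableAt_atlas_symm (chart_mem_atlas ℂ x) hz

theorem mfderiv_chart_symm {x : M} {z : ℂ} (hz : z ∈ (chartAt ℂ x).target) (v : ℂ) :
    (mfderiv 𝓘(ℝ, ℂ) 𝓘(ℝ, ℂ) (chartAt ℂ x).symm z v : ℂ) = chartFactor x z * v := by
  have h := (hasDerivAt_transition hz rfl).hasFDerivAt.restrictScalars ℝ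
  have h2 : (mfderiv 𝓘(ℝ, ℂ) 𝓘(ℝ, ℂ) (chartAt ℂ x).symm z : ℂ →L[ℝ] ℂ) =
      fderiv ℝ (transition x ((chartAt ℂ x).symm z)) z := by
    refine (mdifferentiableAt_chart_symm hz).mfderiv.trans ?_
    simp only [writtenInExtChartAt, extChartAt, mfld_simps, fderivWithin_univ]
    rfl
  have h3 := congrArg (fun T : ℂ →L[ℝ] ℂ => T v) (h2.trans h.fderiv)
  refine h3.trans ?_
  simp [mul_comm]

theorem chartFactor_ne_zero {x : M} {z : ℂ} (hz : z ∈ (chartAt ℂ x).target) :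
    chartFactor x z ≠ 0 := by
  set y := (chartAt ℂ x).symm z with hy
  have h := hasDerivAt_transition hz hy.symm
  have hyx : y ∈ (chartAt ℂ x).source := (chartAt ℂ x).map_target hz
  have hw : chartAt ℂ y y ∈ (chartAt ℂ y).target := (chartAt ℂ y).map_source (mem_chart_source ℂ y)
  have hs : (chartAt ℂ y).symm (chartAt ℂ y y) = y :=
    (chartAt ℂ y).left_inv (mem_chart_source ℂ y)
  have h2 : DifferentiableAt ℂ (transition y x) (chartAt ℂ y y) :=
    (contDiffAt_transition hw (by rwa [hs])).differentiableAt (by simp)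
  have hT : transition x y z = chartAt ℂ y y := by simp [transition, ← hy]
  rw [← hT] at h2
  have h3 := h2.hasDerivAt.comp z h
  have h4 : (transition y x ∘ transition x y) =ᶠ[𝓝 z] id := by
    have hmem : (chartAt ℂ x).target ∩ (chartAt ℂ x).symm ⁻¹' (chartAt ℂ y).source ∈ 𝓝 z :=
      ((chartAt ℂ x).isOpen_inter_preimage_symm (chartAt ℂ y).open_source).mem_nhds
        ⟨hz, by simp [← hy]⟩
    filter_upwards [hmem] with w hw
    simp only [Function.comp, transition, id]
    rw [(chartAt ℂ y).left_inv hw.2, (chartAt ℂ x).right_inv hw.1]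
  have h5 := (hasDerivAt_id z).congr_of_eventuallyEq h4
  intro h0
  have := h3.unique h5
  rw [h0] at this
  simp at this

theorem chartFactor_self (x : M) : chartFactor x (chartAt ℂ x x) = 1 := by
  have hz : chartAt ℂ x x ∈ (chartAt ℂ x).target :=
    (chartAt ℂ x).map_source (mem_chart_source ℂ x)
  have h := hasDerivAt_transition hz ((chartAt ℂ x).left_inv (mem_chart_source ℂ x))
  have h4 : transition x x =ᶠ[𝓝 (chartAt ℂ x x)] id := by
    filter_upwards [(chartAt ℂ x).open_target.mem_nhds hz] with w hw
    exact (chartAt ℂ x).right_inv hw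
  exact h.unique ((hasDerivAt_id _).congr_of_eventuallyEq h4)

variable {W : Type*} [NormedAddCommGroup W] [NormedSpace ℝ W]

theorem fderiv_comp_chart_symm {x : M} {z : ℂ} (hz : z ∈ (chartAt ℂ x).target) {f : M → W}
    (hf : MDifferentiableAt 𝓘(ℝ, ℂ) 𝓘(ℝ, W) f ((chartAt ℂ x).symm z)) (v : ℂ) :
    fderiv ℝ (fun w => f ((chartAt ℂ x).symm w)) z v =
      mfderiv 𝓘(ℝ, ℂ) 𝓘(ℝ, W) f ((chartAt ℂ x).symm z) (chartFactor x z * v : ℂ) := by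
  have h := mfderiv_comp z hf (mdifferentiableAt_chart_symm hz)
  rw [mfderiv_eq_fderiv] at h
  have h2 := congrArg (fun T : ℂ →L[ℝ] W => T v) h
  refine h2.trans ?_
  rw [← mfderiv_chart_symm hz v]
  rfl

theorem differentiableAt_comp_chart_symm {x : M} {z : ℂ} (hz : z ∈ (chartAt ℂ x).target)
    {f : M → W} (hf : MDifferentiableAt 𝓘(ℝ, ℂ) 𝓘(ℝ, W) f ((chartAt ℂ x).symm z)) :
    DifferentiableAt ℝ (fun w => f ((chartAt ℂ x).symm w)) z :=
  mdifferentiableAt_iff_differentiableAt.1 (hf.comp z (mdifferentiableAt_chart_symm hz))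

omit [IsManifold 𝓘(ℂ) ω M] in
theorem mfderiv_eq_fderiv_chart {q : M} {f : M → W}
    (hf : MDifferentiableAt 𝓘(ℝ, ℂ) 𝓘(ℝ, W) f q) (v : ℂ) :
    mfderiv 𝓘(ℝ, ℂ) 𝓘(ℝ, W) f q v =
      fderiv ℝ (fun w => f ((chartAt ℂ q).symm w)) (chartAt ℂ q q) v := by
  have h := congrArg (fun T : ℂ →L[ℝ] W => T v) hf.mfderiv
  refine h.trans ?_
  simp only [writtenInExtChartAt, extChartAt, mfld_simps, fderivWithin_univ]
  rfl

theorem contMDiffOn_chart_symm_real (x : M) :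
    ContMDiffOn 𝓘(ℝ, ℂ) 𝓘(ℝ, ℂ) ∞ (chartAt ℂ x).symm (chartAt ℂ x).target :=
  (contMDiffOn_chart_symm (n := ω) (I := 𝓘(ℝ, ℂ))).of_le (by simp)

theorem contDiffOn_comp_chart_symm {f : M → W} (hf : ContMDiff 𝓘(ℝ, ℂ) 𝓘(ℝ, W) ∞ f) (x : M) :
    ContDiffOn ℝ ∞ (fun z => f ((chartAt ℂ x).symm z)) (chartAt ℂ x).target :=
  contMDiffOn_iff_contDiffOn.1 (hf.comp_contMDiffOn (contMDiffOn_chart_symm_real x))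

theorem contDiffOn_family_comp_chart_symm {f : ℝ × M → W}
    (hf : ContMDiff (𝓘(ℝ, ℝ).prod 𝓘(ℝ, ℂ)) 𝓘(ℝ, W) ∞ f) (x : M) :
    ContDiffOn ℝ ∞ (fun y : ℝ × ℂ => f (y.1, (chartAt ℂ x).symm y.2))
      (Set.univ ×ˢ (chartAt ℂ x).target) := by
  rw [← contMDiffOn_iff_contDiffOn]
  refine hf.comp_contMDiffOn (ContMDiffOn.prodMk contDiff_fst.contMDiff.contMDiffOn ?_)
  exact (contMDiffOn_chart_symm_real x).comp contDiff_snd.contMDiff.contMDiffOn (fun y hy => hy.2)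

omit [IsManifold 𝓘(ℂ) ω M] in
theorem contMDiff_slice {f : ℝ × M → W}
    (hf : ContMDiff (𝓘(ℝ, ℝ).prod 𝓘(ℝ, ℂ)) 𝓘(ℝ, W) ∞ f) (t : ℝ) :
    ContMDiff 𝓘(ℝ, ℂ) 𝓘(ℝ, W) ∞ (fun q => f (t, q)) :=
  hf.comp (contMDiff_const.prodMk contMDiff_id)

end Charts

/-! ### The metric as a conformal factor, and its area measure -/

section Metric

variable {M : Type*} [TopologicalSpace M] [ChartedSpace ℂ M] [IsManifold 𝓘(ℂ) ω M]
  (g : HermitianMetric M)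

namespace HermitianMetric

/-- The square length of the coordinate vector `1` of the tangent space. -/
def conformalFactor (q : M) : ℝ := g.inner q (1 : ℂ) (1 : ℂ)

theorem conformalFactor_pos (q : M) : 0 < g.conformalFactor q :=
  g.pos q (1 : ℂ) (one_ne_zero (α := ℂ))

/-- Invariance under J gives |i| = |1|, and ⟨1, i⟩ = ⟨i, -1⟩ together with symmetry gives ⟨1, i⟩ =
0. -/
theorem inner_eq (q : M) (X Y : ℂ) :
    g.inner q X Y = g.conformalFactor q * (X.re * Y.re + X.im * Y.im) := by
  have hJ1 : J q (1 : ℂ) = Complex.I := mul_one Complex.I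
  have hJI : J q Complex.I = (-1 : ℂ) := Complex.I_mul_I
  have h1 : g.inner q Complex.I Complex.I = g.conformalFactor q := by
    have := g.J_invariant q (1 : ℂ) (1 : ℂ)
    rwa [hJ1] at this
  have h2 : g.inner q (1 : ℂ) Complex.I = 0 := by
    have := g.J_invariant q (1 : ℂ) Complex.I
    rw [hJ1, hJI] at this
    have h3 : g.inner q Complex.I (-1 : ℂ) = - g.inner q Complex.I (1 : ℂ) :=
      (g.inner q Complex.I).map_neg (1 : ℂ)
    have h4 := g.symm q Complex.I (1 : ℂ)
    linarith
  have h3 : g.inner q Complex.I (1 : ℂ) = 0 := (g.symm q _ _).trans h2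
  have key : ∀ a b c d : ℝ, g.inner q (a • (1 : ℂ) + b • Complex.I : ℂ)
      (c • (1 : ℂ) + d • Complex.I : ℂ) = g.conformalFactor q * (a * c + b * d) := by
    intro a b c d
    let B : ℂ →L[ℝ] ℂ →L[ℝ] ℝ := g.inner q
    have e : ∀ u v w w' : ℂ, B (a • u + b • v) (c • w + d • w') =
        a * (c * B u w + d * B u w') + b * (c * B v w + d * B v w') := by
      intro u v w w'
      simp only [map_add, map_smul, add_apply, smul_apply, smul_eq_mul]
      ring
    refine (e _ _ _ _).trans ?_
    have e1 : B 1 1 = g.conformalFactor q := rfl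
    have e2 : B 1 Complex.I = 0 := h2
    have e3 : B Complex.I 1 = 0 := h3
    have e4 : B Complex.I Complex.I = g.conformalFactor q := h1
    rw [e1, e2, e3, e4]
    ring
  have := key X.re X.im Y.re Y.im
  have e : ∀ Z : ℂ, (Z.re • (1 : ℂ) + Z.im • Complex.I : ℂ) = Z := fun Z => by
    apply Complex.ext <;> simp
  rwa [e, e] at this

theorem e₁_eq (q : M) : g.e₁ q = ((Real.sqrt (g.conformalFactor q))⁻¹ : ℂ) := by
  show ((Real.sqrt (g.conformalFactor q))⁻¹ • (1 : ℂ) : ℂ) = _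
  simp

theorem e₂_eq (q : M) :
    g.e₂ q = (Complex.I * ((Real.sqrt (g.conformalFactor q))⁻¹ : ℂ) : ℂ) := by
  exact congrArg (fun X : ℂ => Complex.I * X) (g.e₁_eq q)

/-- The differential of the inverse chart is multiplication by a complex number, so the coordinate
vectors are orthogonal of equal length and the Gram determinant is a perfect square. -/
theorem areaDensity_eq {x : M} {z : ℂ} (hz : z ∈ (chartAt ℂ x).target) :
    g.areaDensity x z =
      g.conformalFactor ((chartAt ℂ x).symm z) * Complex.normSq (chartFactor x z) := by
  unfold areaDensity
  have h1 := mfderiv_chart_symm hz 1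
  have h2 := mfderiv_chart_symm hz Complex.I
  dsimp only
  rw [h1, h2, inner_eq, inner_eq, inner_eq]
  have hpos := g.conformalFactor_pos ((chartAt ℂ x).symm z)
  rw [Real.sqrt_eq_iff_mul_self_eq]
  · simp [Complex.normSq_apply]; ring
  · simp
    nlinarith [sq_nonneg (g.conformalFactor ((chartAt ℂ x).symm z) *
      ((chartFactor x z).re ^ 2 + (chartFactor x z).im ^ 2))]
  · exact mul_nonneg hpos.le (Complex.normSq_nonneg _)

theorem areaDensity_pos {x : M} {z : ℂ} (hz : z ∈ (chartAt ℂ x).target) :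
    0 < g.areaDensity x z := by
  rw [areaDensity_eq g hz]
  exact mul_pos (g.conformalFactor_pos _) (Complex.normSq_pos.2 (chartFactor_ne_zero hz))

/-- The conformal factor is measured in the chart preferred at each point and need not be
continuous. In one fixed chart the density is the square length of the coordinate field ∂_x, which
is a smooth section. -/
theorem continuousOn_areaDensity (x : M) :
    ContinuousOn (g.areaDensity x) (chartAt ℂ x).target := by
  have hsm : ContMDiffOn 𝓘(ℝ, ℂ) 𝓘(ℝ, ℂ) ∞ (chartAt ℂ x).symm (chartAt ℂ x).target :=
    contMDiffOn_chart_symm_real x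
  have ht := hsm.continuousOn_tangentMapWithin (by simp)
    (chartAt ℂ x).open_target.uniqueMDiffOn
  have hsec : Continuous (fun z : ℂ => (⟨z, (1 : ℂ)⟩ : TangentBundle 𝓘(ℝ, ℂ) ℂ)) :=
    ((contMDiff_vectorSpace_iff_contDiff (𝕜 := ℝ) (n := ∞) (V := fun _ : ℂ => (1 : ℂ))).2
      contDiff_const).continuous
  have hv := ht.comp hsec.continuousOn (s := (chartAt ℂ x).target) (fun z hz => hz)
  have hg : ContinuousOn (fun z => TotalSpace.mk' (ℂ →L[ℝ] ℂ →L[ℝ] ℝ)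
      (E := fun p : M => RealTangent p →L[ℝ] RealTangent p →L[ℝ] ℝ) ((chartAt ℂ x).symm z)
      (g.inner ((chartAt ℂ x).symm z))) (chartAt ℂ x).target :=
    g.contMDiff.continuous.comp_continuousOn (chartAt ℂ x).continuousOn_symm
  have key : ContinuousOn (fun z => g.inner ((chartAt ℂ x).symm z)
      (mfderivWithin 𝓘(ℝ, ℂ) 𝓘(ℝ, ℂ) (chartAt ℂ x).symm (chartAt ℂ x).target z (1 : ℂ))
      (mfderivWithin 𝓘(ℝ, ℂ) 𝓘(ℝ, ℂ) (chartAt ℂ x).symm (chartAt ℂ x).target z (1 : ℂ)))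
      (chartAt ℂ x).target := by
    intro z hz
    have h := ContinuousWithinAt.clm_bundle_apply₂ (F₁ := ℂ) (F₂ := ℂ) (F₃ := ℝ)
      (E₃ := Bundle.Trivial M ℝ) (hg z hz) (hv z hz) (hv z hz)
    have h2 := (FiberBundle.continuousWithinAt_totalSpace _ _).1 h
    exact h2.2
  refine key.congr fun z hz => ?_
  have hm : (mfderivWithin 𝓘(ℝ, ℂ) 𝓘(ℝ, ℂ) (chartAt ℂ x).symm (chartAt ℂ x).target z (1 : ℂ) : ℂ) =
      chartFactor x z * 1 :=
    (congrArg (fun T : ℂ →L[ℝ] ℂ => T 1)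
      (mfderivWithin_of_isOpen (chartAt ℂ x).open_target hz)).trans (mfderiv_chart_symm hz 1)
  dsimp only
  rw [areaDensity_eq g hz, hm]
  refine Eq.trans ?_ (g.inner_eq _ (chartFactor x z * 1) (chartFactor x z * 1)).symm
  simp [Complex.normSq_apply]

section Area

variable [MeasurableSpace M] [BorelSpace M]

/-- The area measure on the domain of the preferred chart at `x`. -/
def chartMeasure (x : M) : Measure M :=
  ((volume.restrict (chartAt ℂ x).target).withDensity
    (fun z => ENNReal.ofReal (g.areaDensity x z))).map (chartAt ℂ x).symm

omit [IsManifold 𝓘(ℂ) ω M] in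
theorem aemeasurable_chart_symm (x : M) (μ : Measure ℂ)
    (hμ : μ ≪ volume.restrict (chartAt ℂ x).target) : AEMeasurable (chartAt ℂ x).symm μ :=
  ((chartAt ℂ x).continuousOn_symm.aemeasurable
    (chartAt ℂ x).open_target.measurableSet).mono_ac hμ

theorem chartMeasure_apply (x : M) {A : Set M} (hA : MeasurableSet A) :
    g.chartMeasure x A = ∫⁻ z in (chartAt ℂ x).symm ⁻¹' A ∩ (chartAt ℂ x).target,
      ENNReal.ofReal (g.areaDensity x z) := by
  rw [chartMeasure, Measure.map_apply_of_aemeasurable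
    (aemeasurable_chart_symm x _ (withDensity_absolutelyContinuous _ _)) hA, withDensity_apply',
    Measure.restrict_restrict' (chartAt ℂ x).open_target.measurableSet]

theorem chartMeasure_compl_source (x : M) : g.chartMeasure x (chartAt ℂ x).sourceᶜ = 0 := by
  rw [chartMeasure_apply g x (chartAt ℂ x).open_source.measurableSet.compl]
  have : (chartAt ℂ x).symm ⁻¹' (chartAt ℂ x).sourceᶜ ∩ (chartAt ℂ x).target = ∅ := by
    ext z
    simp only [Set.mem_inter_iff, Set.mem_preimage, Set.mem_compl_iff, Set.mem_empty_iff_false,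
      iff_false, not_and]
    exact fun h1 h2 => h1 ((chartAt ℂ x).map_target h2)
  rw [this]
  simp

omit [IsManifold 𝓘(ℂ) ω M] in
theorem measurableSet_chart_image (x : M) {A : Set M} (hA : MeasurableSet A) :
    MeasurableSet ((chartAt ℂ x).symm ⁻¹' A ∩ (chartAt ℂ x).target) := by
  have h : Measurable ((chartAt ℂ x).target.domRestrict (chartAt ℂ x).symm) :=
    (continuousOn_iff_continuous_domRestrict.1 (chartAt ℂ x).continuousOn_symm).measurable
  have h2 := (chartAt ℂ x).open_target.measurableSet.subtype_image (h hA)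
  convert h2 using 1
  ext z
  simp [and_comm, Set.domRestrict]

omit [MeasurableSpace M] [BorelSpace M] in
theorem areaDensity_transition {x y : M} {z : ℂ} (hz : z ∈ (chartAt ℂ x).target)
    (hy : (chartAt ℂ x).symm z ∈ (chartAt ℂ y).source) :
    g.areaDensity x z =
      Complex.normSq (deriv (transition x y) z) * g.areaDensity y (transition x y z) := by
  have hT : transition x y z ∈ (chartAt ℂ y).target := (chartAt ℂ y).map_source hy
  have hs : (chartAt ℂ y).symm (transition x y z) = (chartAt ℂ x).symm z :=
    (chartAt ℂ y).left_inv hy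
  rw [areaDensity_eq g hz, areaDensity_eq g hT, hs]
  have h1 := ((contDiffAt_transition hz hy).differentiableAt (by simp)).hasDerivAt
  have h2 := hasDerivAt_transition hT hs
  have h3 := h2.comp z h1
  have h4 : transition y ((chartAt ℂ x).symm z) ∘ transition x y =ᶠ[𝓝 z]
      transition x ((chartAt ℂ x).symm z) := by
    filter_upwards [((chartAt ℂ x).isOpen_inter_preimage_symm (chartAt ℂ y).open_source).mem_nhds
      ⟨hz, hy⟩] with w hw
    simp only [Function.comp, transition]
    rw [(chartAt ℂ y).left_inv hw.2]
  rw [(hasDerivAt_transition hz rfl).unique (h3.congr_of_eventuallyEq h4.symm),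
    Complex.normSq_mul]
  ring

/-- Change of variables for the holomorphic coordinate change T: its real Jacobian is |T'|², which
is exactly how the densities transform. -/
theorem chartMeasure_eq_of_subset {x y : M} {A : Set M} (hA : MeasurableSet A)
    (hx : A ⊆ (chartAt ℂ x).source) (hy : A ⊆ (chartAt ℂ y).source) :
    g.chartMeasure y A = g.chartMeasure x A := by
  rw [chartMeasure_apply g y hA, chartMeasure_apply g x hA]
  set s := (chartAt ℂ x).symm ⁻¹' A ∩ (chartAt ℂ x).target
  have himg : (chartAt ℂ y).symm ⁻¹' A ∩ (chartAt ℂ y).target = transition x y '' s := by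
    ext w
    constructor
    · rintro ⟨hw1, hw2⟩
      refine ⟨chartAt ℂ x ((chartAt ℂ y).symm w), ⟨?_, (chartAt ℂ x).map_source (hx hw1)⟩, ?_⟩
      · rw [Set.mem_preimage, (chartAt ℂ x).left_inv (hx hw1)]
        exact hw1
      · rw [transition, (chartAt ℂ x).left_inv (hx hw1), (chartAt ℂ y).right_inv hw2]
    · rintro ⟨z, ⟨hz1, hz2⟩, rfl⟩
      refine ⟨?_, (chartAt ℂ y).map_source (hy hz1)⟩
      rw [Set.mem_preimage, transition, (chartAt ℂ y).left_inv (hy hz1)]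
      exact hz1
  have hinj : Set.InjOn (transition x y) s := by
    intro z hz w hw h
    have h1 := (chartAt ℂ y).injOn (hy hz.1) (hy hw.1) h
    exact (chartAt ℂ x).symm.injOn hz.2 hw.2 h1
  have hd : ∀ z ∈ s, HasFDerivWithinAt (transition x y)
      ((ContinuousLinearMap.toSpanSingleton ℂ (deriv (transition x y) z)).restrictScalars ℝ)
      s z := fun z hz =>
    ((((contDiffAt_transition hz.2 (hy hz.1)).differentiableAt
      (by simp)).hasDerivAt.hasFDerivAt).restrictScalars ℝ).hasFDerivWithinAt
  rw [himg, lintegral_image_eq_lintegral_abs_det_fderiv_mul volume (measurableSet_chart_image x hA)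
    hd hinj]
  refine setLIntegral_congr_fun (measurableSet_chart_image x hA) fun z hz => ?_
  have hdet : ((ContinuousLinearMap.toSpanSingleton ℂ
      (deriv (transition x y) z)).restrictScalars ℝ).det =
      Complex.normSq (deriv (transition x y) z) := by
    rw [ContinuousLinearMap.det, ← LinearMap.det_toMatrix Complex.basisOneI, Matrix.det_fin_two]
    simp [LinearMap.toMatrix_apply, Complex.normSq_apply]
  rw [hdet, abs_of_nonneg (Complex.normSq_nonneg _), ← ENNReal.ofReal_mul (Complex.normSq_nonneg _),
    ← areaDensity_transition g hz.2 (hy hz.1)]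

/-- The area is a supremum of chart measures. Compatibility on overlaps shows that, over the domain
of one chart, no other chart contributes anything larger; this is what allows integrals to be
computed in a chart. -/
theorem area_restrict_source (x : M) :
    g.area.restrict (chartAt ℂ x).source = g.chartMeasure x := by
  have hms : MeasurableSet (chartAt ℂ x).source := (chartAt ℂ x).open_source.measurableSet
  have hself : (g.chartMeasure x).restrict (chartAt ℂ x).source = g.chartMeasure x :=
    Measure.restrict_eq_self_of_ae_mem (by
      rw [ae_iff]; exact g.chartMeasure_compl_source x)
  have hle : ∀ y, g.chartMeasure y ≤ g.area := fun y => le_iSup g.chartMeasure y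
  apply le_antisymm
  -- Every chart measure is split along the domain of the chart at x: inside it is at most the
  -- measure of that chart, outside it is at most the area itself.
  · have hub : g.area ≤ g.chartMeasure x + g.area.restrict (chartAt ℂ x).sourceᶜ := by
      refine iSup_le fun y => ?_
      show g.chartMeasure y ≤ _
      rw [← Measure.restrict_add_restrict_compl hms (μ := g.chartMeasure y)]
      refine add_le_add ?_ (Measure.restrict_mono le_rfl (hle y))
      refine Measure.le_iff.2 fun A hA => ?_
      have hmy : MeasurableSet (chartAt ℂ y).source := (chartAt ℂ y).open_source.measurableSet
      rw [Measure.restrict_apply hA]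
      have h0 : g.chartMeasure y (A ∩ (chartAt ℂ x).source) =
          g.chartMeasure y (A ∩ (chartAt ℂ x).source ∩ (chartAt ℂ y).source) :=
        (measure_inter_conull (g.chartMeasure_compl_source y)).symm
      rw [h0, g.chartMeasure_eq_of_subset (x := x) ((hA.inter hms).inter hmy)
        (fun q hq => hq.1.2) (fun q hq => hq.2)]
      exact measure_mono fun q hq => hq.1.1
    have h := Measure.restrict_mono (le_refl (chartAt ℂ x).source) hub
    rw [Measure.restrict_add, hself, Measure.restrict_restrict hms, Set.inter_compl_self,
      Measure.restrict_empty, add_zero] at h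
    exact h
  · have h := Measure.restrict_mono (le_refl (chartAt ℂ x).source) (hle x)
    rwa [hself] at h

theorem integral_area_eq (x : M) {f : M → ℝ} (hf : Continuous f)
    (h0 : ∀ q ∉ (chartAt ℂ x).source, f q = 0) :
    ∫ q, f q ∂g.area = ∫ z in (chartAt ℂ x).target,
      f ((chartAt ℂ x).symm z) * g.areaDensity x z := by
  rw [← setIntegral_eq_integral_of_forall_compl_eq_zero h0, area_restrict_source, chartMeasure,
    integral_map (aemeasurable_chart_symm x _ (withDensity_absolutelyContinuous _ _))
      hf.aestronglyMeasurable, integral_withDensity_eq_integral_toReal_smul₀]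
  · refine setIntegral_congr_fun (chartAt ℂ x).open_target.measurableSet fun z hz => ?_
    rw [ENNReal.toReal_ofReal (g.areaDensity_pos hz).le, smul_eq_mul, mul_comm]
  · exact ((g.continuousOn_areaDensity x).aemeasurable
      (chartAt ℂ x).open_target.measurableSet).ennreal_ofReal
  · simp

/-- The density is continuous, hence bounded on a small coordinate ball. On a compact surface the
total area is then finite. -/
instance isLocallyFiniteMeasure_area : IsLocallyFiniteMeasure g.area := by
  refine ⟨fun x => ?_⟩
  set z₀ := chartAt ℂ x x
  have hz₀ : z₀ ∈ (chartAt ℂ x).target := (chartAt ℂ x).map_source (mem_chart_source ℂ x)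
  have hc : ContinuousAt (g.areaDensity x) z₀ :=
    (g.continuousOn_areaDensity x).continuousAt ((chartAt ℂ x).open_target.mem_nhds hz₀)
  have hev : ∀ᶠ z in 𝓝 z₀, g.areaDensity x z < g.areaDensity x z₀ + 1 :=
    hc.eventually_lt continuousAt_const (by linarith)
  obtain ⟨ε, hε, hball⟩ := Metric.eventually_nhds_iff_ball.1 hev
  have hN : (chartAt ℂ x).source ∩ chartAt ℂ x ⁻¹' Metric.ball z₀ ε ∈ 𝓝 x :=
    ((chartAt ℂ x).isOpen_inter_preimage Metric.isOpen_ball).mem_nhds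
      ⟨mem_chart_source ℂ x, Metric.mem_ball_self hε⟩
  have hNm : MeasurableSet ((chartAt ℂ x).source ∩ chartAt ℂ x ⁻¹' Metric.ball z₀ ε) :=
    ((chartAt ℂ x).isOpen_inter_preimage Metric.isOpen_ball).measurableSet
  refine ⟨_, hN, ?_⟩
  rw [← Measure.restrict_eq_self g.area Set.inter_subset_left, area_restrict_source,
    chartMeasure_apply g x hNm]
  have hsub : (chartAt ℂ x).symm ⁻¹' ((chartAt ℂ x).source ∩ chartAt ℂ x ⁻¹' Metric.ball z₀ ε) ∩
      (chartAt ℂ x).target ⊆ Metric.ball z₀ ε := by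
    rintro z ⟨⟨h1, h2⟩, h3⟩
    rwa [Set.mem_preimage, (chartAt ℂ x).right_inv h3] at h2
  refine (lintegral_mono_set hsub).trans_lt ?_
  refine (setLIntegral_mono (g := fun _ => ENNReal.ofReal (g.areaDensity x z₀ + 1))
    measurable_const fun z hz => ENNReal.ofReal_le_ofReal (hball z hz).le).trans_lt ?_
  rw [setLIntegral_const]
  exact ENNReal.mul_lt_top ENNReal.ofReal_lt_top measure_ball_lt_top

end Area

end HermitianMetric
end Metric

/-! ### Partial derivatives of functions of a parameter and a coordinate -/

section Partial

variable {W : Type*} [NormedAddCommGroup W] [NormedSpace ℝ W]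

theorem fderiv_slice {F : ℝ × ℂ → W} {t : ℝ} {z : ℂ} (hF : DifferentiableAt ℝ F (t, z)) (v : ℂ) :
    fderiv ℝ (fun w => F (t, w)) z v = fderiv ℝ F (t, z) (0, v) := by
  have h := hF.hasFDerivAt.comp z (hasFDerivAt_prodMk_right t z)
  have h2 := congrArg (fun T : ℂ →L[ℝ] W => T v) h.fderiv
  exact h2.trans (by simp)

theorem hasDerivAt_slice {F : ℝ × ℂ → W} {t : ℝ} {z : ℂ} (hF : DifferentiableAt ℝ F (t, z)) :
    HasDerivAt (fun s => F (s, z)) (fderiv ℝ F (t, z) (1, 0)) t :=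
  hF.hasFDerivAt.comp_hasDerivAt t ((hasDerivAt_id t).prodMk (hasDerivAt_const t z))

theorem contDiffOn_fderiv_apply {E : Type*} [NormedAddCommGroup E] [NormedSpace ℝ E] {F : E → W}
    {U : Set E} (hU : IsOpen U) (hF : ContDiffOn ℝ ∞ F U) (v : E) :
    ContDiffOn ℝ ∞ (fun y => fderiv ℝ F y v) U :=
  (hF.fderiv_of_isOpen hU (by simp)).clm_apply contDiffOn_const

end Partial

/-! ### Dirichlet and Gram expressions of differentials, for maps and families -/

section Gradient

variable {M : Type*} [TopologicalSpace M] [ChartedSpace ℂ M] [IsManifold 𝓘(ℂ) ω M]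
  (g : HermitianMetric M)
variable {W : Type*} [NormedAddCommGroup W] [InnerProductSpace ℝ W]

/-- The differential of a vector valued map, on the tangent space `ℂ`. -/
def realDiff (f : M → W) (q : M) : ℂ →L[ℝ] W := mfderiv 𝓘(ℝ, ℂ) 𝓘(ℝ, W) f q

omit [IsManifold 𝓘(ℂ) ω M] in
theorem realDiff_eq {f : M → W} {q : M} (hf : MDifferentiableAt 𝓘(ℝ, ℂ) 𝓘(ℝ, W) f q) :
    realDiff f q = fderiv ℝ (fun w => f ((chartAt ℂ q).symm w)) (chartAt ℂ q q) :=
  ContinuousLinearMap.ext fun v => mfderiv_eq_fderiv_chart hf v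

theorem realDiff_chartFactor {x : M} {z : ℂ} (hz : z ∈ (chartAt ℂ x).target) {f : M → W}
    (hf : MDifferentiableAt 𝓘(ℝ, ℂ) 𝓘(ℝ, W) f ((chartAt ℂ x).symm z)) (v : ℂ) :
    realDiff f ((chartAt ℂ x).symm z) v =
      fderiv ℝ (fun w => f ((chartAt ℂ x).symm w)) z ((chartFactor x z)⁻¹ * v) := by
  rw [fderiv_comp_chart_symm hz hf, mul_inv_cancel_left₀ (chartFactor_ne_zero hz)]
  rfl

omit [IsManifold 𝓘(ℂ) ω M] in
theorem realDiff_congr {f h : M → W} {q : M} (hfh : f =ᶠ[𝓝 q] h) : realDiff f q = realDiff h q :=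
  hfh.mfderiv_eq

/-- The inner product `⟨dX(e₁), dY(e₁)⟩ + ⟨dX(e₂), dY(e₂)⟩` of the differentials. -/
def gradPair (f h : M → W) (q : M) : ℝ :=
  ⟪realDiff f q (g.e₁ q), realDiff h q (g.e₁ q)⟫_ℝ +
    ⟪realDiff f q (g.e₂ q), realDiff h q (g.e₂ q)⟫_ℝ

/-- The Gram determinant of the differential in an orthonormal basis. -/
def gramDet (f : M → W) (q : M) : ℝ :=
  ⟪realDiff f q (g.e₁ q), realDiff f q (g.e₁ q)⟫_ℝ *
    ⟪realDiff f q (g.e₂ q), realDiff f q (g.e₂ q)⟫_ℝ -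
  ⟪realDiff f q (g.e₁ q), realDiff f q (g.e₂ q)⟫_ℝ ^ 2

theorem clm_complex_apply (A : ℂ →L[ℝ] W) (v : ℂ) : A v = v.re • A 1 + v.im • A Complex.I := by
  rw [← map_smul, ← map_smul, ← map_add]
  congr 1
  apply Complex.ext <;> simp

/-- The vector `e₁` in the chart at `x`. -/
def frameFactor (x : M) (z : ℂ) : ℂ :=
  (chartFactor x z)⁻¹ * ((Real.sqrt (g.conformalFactor ((chartAt ℂ x).symm z)))⁻¹ : ℂ)

theorem normSq_frameFactor {x : M} {z : ℂ} (hz : z ∈ (chartAt ℂ x).target) :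
    (frameFactor g x z).re ^ 2 + (frameFactor g x z).im ^ 2 = (g.areaDensity x z)⁻¹ := by
  have h : Complex.normSq (frameFactor g x z) = (g.areaDensity x z)⁻¹ := by
    rw [g.areaDensity_eq hz, frameFactor, Complex.normSq_mul, Complex.normSq_inv,
      Complex.normSq_inv, Complex.normSq_ofReal,
      Real.mul_self_sqrt (g.conformalFactor_pos _).le, mul_inv, mul_comm]
  rw [← h, Complex.normSq_apply]
  ring

theorem realDiff_e₁ {x : M} {z : ℂ} (hz : z ∈ (chartAt ℂ x).target) {f : M → W}
    (hf : MDifferentiableAt 𝓘(ℝ, ℂ) 𝓘(ℝ, W) f ((chartAt ℂ x).symm z)) :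
    realDiff f ((chartAt ℂ x).symm z) (g.e₁ ((chartAt ℂ x).symm z)) =
      (frameFactor g x z).re • fderiv ℝ (fun w => f ((chartAt ℂ x).symm w)) z 1 +
      (frameFactor g x z).im • fderiv ℝ (fun w => f ((chartAt ℂ x).symm w)) z Complex.I := by
  have h := congrArg (realDiff f ((chartAt ℂ x).symm z)) (g.e₁_eq ((chartAt ℂ x).symm z))
  refine h.trans ?_
  rw [← clm_complex_apply, realDiff_chartFactor hz hf, frameFactor]

theorem realDiff_e₂ {x : M} {z : ℂ} (hz : z ∈ (chartAt ℂ x).target) {f : M → W}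
    (hf : MDifferentiableAt 𝓘(ℝ, ℂ) 𝓘(ℝ, W) f ((chartAt ℂ x).symm z)) :
    realDiff f ((chartAt ℂ x).symm z) (g.e₂ ((chartAt ℂ x).symm z)) =
      (-(frameFactor g x z).im) • fderiv ℝ (fun w => f ((chartAt ℂ x).symm w)) z 1 +
      (frameFactor g x z).re • fderiv ℝ (fun w => f ((chartAt ℂ x).symm w)) z Complex.I := by
  have h := clm_complex_apply (fderiv ℝ (fun w => f ((chartAt ℂ x).symm w)) z)
    (Complex.I * frameFactor g x z)
  have e1 : (Complex.I * frameFactor g x z).re = -(frameFactor g x z).im := by simp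
  have e2 : (Complex.I * frameFactor g x z).im = (frameFactor g x z).re := by simp
  rw [e1, e2] at h
  have h' := congrArg (realDiff f ((chartAt ℂ x).symm z)) (g.e₂_eq ((chartAt ℂ x).symm z))
  refine h'.trans ?_
  rw [← h, realDiff_chartFactor hz hf, frameFactor]
  congr 1
  ring

/-- Conformal invariance of the Dirichlet integrand: in the chart, e₁ and e₂ are κ and iκ with |κ|²
the inverse of the area density, so the metric drops out. The frame itself need not vary
continuously, and continuity of the invariants is read off from this Euclidean form. -/
theorem gradPair_mul_areaDensity {x : M} {z : ℂ} (hz : z ∈ (chartAt ℂ x).target) {f h : M → W}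
    (hf : MDifferentiableAt 𝓘(ℝ, ℂ) 𝓘(ℝ, W) f ((chartAt ℂ x).symm z))
    (hh : MDifferentiableAt 𝓘(ℝ, ℂ) 𝓘(ℝ, W) h ((chartAt ℂ x).symm z)) :
    gradPair g f h ((chartAt ℂ x).symm z) * g.areaDensity x z =
      ⟪fderiv ℝ (fun w => f ((chartAt ℂ x).symm w)) z 1,
        fderiv ℝ (fun w => h ((chartAt ℂ x).symm w)) z 1⟫_ℝ +
      ⟪fderiv ℝ (fun w => f ((chartAt ℂ x).symm w)) z Complex.I,
        fderiv ℝ (fun w => h ((chartAt ℂ x).symm w)) z Complex.I⟫_ℝ := by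
  have hk := normSq_frameFactor g hz
  have hd := g.areaDensity_pos hz
  have hk2 : ((frameFactor g x z).re ^ 2 + (frameFactor g x z).im ^ 2) * g.areaDensity x z = 1 := by
    rw [hk, inv_mul_cancel₀ hd.ne']
  rw [gradPair, realDiff_e₁ g hz hf, realDiff_e₂ g hz hf, realDiff_e₁ g hz hh, realDiff_e₂ g hz hh]
  simp only [inner_add_left, inner_add_right, real_inner_smul_left, real_inner_smul_right]
  linear_combination (⟪fderiv ℝ (fun w => f ((chartAt ℂ x).symm w)) z 1,
        fderiv ℝ (fun w => h ((chartAt ℂ x).symm w)) z 1⟫_ℝ +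
      ⟪fderiv ℝ (fun w => f ((chartAt ℂ x).symm w)) z Complex.I,
        fderiv ℝ (fun w => h ((chartAt ℂ x).symm w)) z Complex.I⟫_ℝ) * hk2

theorem gramDet_mul_areaDensity {x : M} {z : ℂ} (hz : z ∈ (chartAt ℂ x).target) {f : M → W}
    (hf : MDifferentiableAt 𝓘(ℝ, ℂ) 𝓘(ℝ, W) f ((chartAt ℂ x).symm z)) :
    gramDet g f ((chartAt ℂ x).symm z) * g.areaDensity x z ^ 2 =
      ⟪fderiv ℝ (fun w => f ((chartAt ℂ x).symm w)) z 1,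
        fderiv ℝ (fun w => f ((chartAt ℂ x).symm w)) z 1⟫_ℝ *
      ⟪fderiv ℝ (fun w => f ((chartAt ℂ x).symm w)) z Complex.I,
        fderiv ℝ (fun w => f ((chartAt ℂ x).symm w)) z Complex.I⟫_ℝ -
      ⟪fderiv ℝ (fun w => f ((chartAt ℂ x).symm w)) z 1,
        fderiv ℝ (fun w => f ((chartAt ℂ x).symm w)) z Complex.I⟫_ℝ ^ 2 := by
  have hk := normSq_frameFactor g hz
  have hd := g.areaDensity_pos hz
  have hk2 : ((frameFactor g x z).re ^ 2 + (frameFactor g x z).im ^ 2) * g.areaDensity x z = 1 := by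
    rw [hk, inv_mul_cancel₀ hd.ne']
  rw [gramDet, realDiff_e₁ g hz hf, realDiff_e₂ g hz hf]
  simp only [inner_add_left, inner_add_right, real_inner_smul_left, real_inner_smul_right]
  rw [real_inner_comm (fderiv ℝ (fun w => f ((chartAt ℂ x).symm w)) z 1)
    (fderiv ℝ (fun w => f ((chartAt ℂ x).symm w)) z Complex.I)]
  set a := ⟪fderiv ℝ (fun w => f ((chartAt ℂ x).symm w)) z 1,
        fderiv ℝ (fun w => f ((chartAt ℂ x).symm w)) z 1⟫_ℝ
  set b := ⟪fderiv ℝ (fun w => f ((chartAt ℂ x).symm w)) z Complex.I,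
        fderiv ℝ (fun w => f ((chartAt ℂ x).symm w)) z Complex.I⟫_ℝ
  set c := ⟪fderiv ℝ (fun w => f ((chartAt ℂ x).symm w)) z 1,
        fderiv ℝ (fun w => f ((chartAt ℂ x).symm w)) z Complex.I⟫_ℝ
  linear_combination (a * b - c ^ 2) * (((frameFactor g x z).re ^ 2 +
    (frameFactor g x z).im ^ 2) * g.areaDensity x z + 1) * hk2

omit [IsManifold 𝓘(ℂ) ω M] in
theorem mdifferentiable_slice {f : ℝ × M → W}
    (hf : ContMDiff (𝓘(ℝ, ℝ).prod 𝓘(ℝ, ℂ)) 𝓘(ℝ, W) ∞ f) (t : ℝ) (q : M) :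
    MDifferentiableAt 𝓘(ℝ, ℂ) 𝓘(ℝ, W) (fun q => f (t, q)) q :=
  (contMDiff_slice hf t).mdifferentiable (by simp) q

omit [IsManifold 𝓘(ℂ) ω M] in
theorem isOpen_univ_prod_target (x : M) :
    IsOpen ((Set.univ : Set ℝ) ×ˢ (chartAt ℂ x).target) :=
  isOpen_univ.prod (chartAt ℂ x).open_target

omit [IsManifold 𝓘(ℂ) ω M] in
theorem contDiffAt_of_chart {F : ℝ × ℂ → W} {x : M}
    (hF : ContDiffOn ℝ ∞ F (Set.univ ×ˢ (chartAt ℂ x).target)) (t : ℝ) {z : ℂ}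
    (hz : z ∈ (chartAt ℂ x).target) : ContDiffAt ℝ ∞ F (t, z) :=
  hF.contDiffAt ((isOpen_univ_prod_target x).mem_nhds ⟨Set.mem_univ t, hz⟩)

theorem continuousOn_fderiv_slice {f : ℝ × M → W}
    (hf : ContMDiff (𝓘(ℝ, ℝ).prod 𝓘(ℝ, ℂ)) 𝓘(ℝ, W) ∞ f) (x : M) (v : ℂ) :
    ContinuousOn (fun y : ℝ × ℂ => fderiv ℝ (fun w => f (y.1, (chartAt ℂ x).symm w)) y.2 v)
      (Set.univ ×ˢ (chartAt ℂ x).target) := by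
  have h := contDiffOn_family_comp_chart_symm hf x
  refine (contDiffOn_fderiv_apply (isOpen_univ_prod_target x) h (0, v)).continuousOn.congr ?_
  intro y hy
  exact fderiv_slice (F := fun y : ℝ × ℂ => f (y.1, (chartAt ℂ x).symm y.2))
    ((h.contDiffAt ((isOpen_univ_prod_target x).mem_nhds hy)).differentiableAt (by simp)) v

omit [IsManifold 𝓘(ℂ) ω M] in
theorem continuous_of_local {k : ℝ × M → ℝ}
    (h : ∀ x : M, ContinuousOn (fun y : ℝ × ℂ => k (y.1, (chartAt ℂ x).symm y.2))
      (Set.univ ×ˢ (chartAt ℂ x).target)) : Continuous k := by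
  refine continuous_iff_continuousAt.2 ?_
  rintro ⟨t, x⟩
  have hx := mem_chart_source ℂ x
  have h1 : ContinuousAt (fun y : ℝ × ℂ => k (y.1, (chartAt ℂ x).symm y.2)) (t, chartAt ℂ x x) :=
    (h x).continuousAt ((isOpen_univ_prod_target x).mem_nhds
      ⟨Set.mem_univ _, (chartAt ℂ x).map_source hx⟩)
  have h2 : ContinuousAt (fun y : ℝ × M => (y.1, chartAt ℂ x y.2)) (t, x) :=
    continuousAt_fst.prodMk (((chartAt ℂ x).continuousAt hx).comp continuousAt_snd)
  have h3 := ContinuousAt.comp (f := fun y : ℝ × M => (y.1, chartAt ℂ x y.2)) h1 h2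
  refine h3.congr ?_
  have : (Set.univ : Set ℝ) ×ˢ (chartAt ℂ x).source ∈ 𝓝 (t, x) :=
    (isOpen_univ.prod (chartAt ℂ x).open_source).mem_nhds ⟨Set.mem_univ _, hx⟩
  filter_upwards [this] with y hy
  simp [(chartAt ℂ x).left_inv hy.2]

theorem continuous_gradPair_family {f h : ℝ × M → W}
    (hf : ContMDiff (𝓘(ℝ, ℝ).prod 𝓘(ℝ, ℂ)) 𝓘(ℝ, W) ∞ f)
    (hh : ContMDiff (𝓘(ℝ, ℝ).prod 𝓘(ℝ, ℂ)) 𝓘(ℝ, W) ∞ h) :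
    Continuous (fun y : ℝ × M =>
      gradPair g (fun q => f (y.1, q)) (fun q => h (y.1, q)) y.2) := by
  refine continuous_of_local fun x => ?_
  have hd : ContinuousOn (fun y : ℝ × ℂ => g.areaDensity x y.2)
      (Set.univ ×ˢ (chartAt ℂ x).target) :=
    (g.continuousOn_areaDensity x).comp continuousOn_snd fun y hy => hy.2
  have h1 := ((continuousOn_fderiv_slice hf x 1).inner (𝕜 := ℝ) (continuousOn_fderiv_slice hh x 1)).add
    ((continuousOn_fderiv_slice hf x Complex.I).inner (𝕜 := ℝ)
      (continuousOn_fderiv_slice hh x Complex.I))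
  refine (h1.div hd fun y hy => (g.areaDensity_pos hy.2).ne').congr fun y hy => ?_
  exact eq_div_of_mul_eq (g.areaDensity_pos hy.2).ne' (gradPair_mul_areaDensity g hy.2
    (mdifferentiable_slice hf _ _) (mdifferentiable_slice hh _ _))

theorem continuous_gramDet_family {f : ℝ × M → W}
    (hf : ContMDiff (𝓘(ℝ, ℝ).prod 𝓘(ℝ, ℂ)) 𝓘(ℝ, W) ∞ f) :
    Continuous (fun y : ℝ × M => gramDet g (fun q => f (y.1, q)) y.2) := by
  refine continuous_of_local fun x => ?_
  have hd : ContinuousOn (fun y : ℝ × ℂ => g.areaDensity x y.2 ^ 2)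
      (Set.univ ×ˢ (chartAt ℂ x).target) :=
    ((g.continuousOn_areaDensity x).comp continuousOn_snd fun y hy => hy.2).pow 2
  have c1 := continuousOn_fderiv_slice hf x 1
  have c2 := continuousOn_fderiv_slice hf x Complex.I
  have h1 := ((c1.inner (𝕜 := ℝ) c1).mul (c2.inner (𝕜 := ℝ) c2)).sub ((c1.inner (𝕜 := ℝ) c2).pow 2)
  refine (h1.div hd fun y hy => (pow_pos (g.areaDensity_pos hy.2) 2).ne').congr fun y hy => ?_
  exact eq_div_of_mul_eq (pow_pos (g.areaDensity_pos hy.2) 2).ne'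
    (gramDet_mul_areaDensity g hy.2 (mdifferentiable_slice hf _ _))

omit [IsManifold 𝓘(ℂ) ω M] in
theorem contMDiff_const_family {f : M → W} (hf : ContMDiff 𝓘(ℝ, ℂ) 𝓘(ℝ, W) ∞ f) :
    ContMDiff (𝓘(ℝ, ℝ).prod 𝓘(ℝ, ℂ)) 𝓘(ℝ, W) ∞ (fun y : ℝ × M => f y.2) :=
  hf.comp contMDiff_snd

theorem continuous_gradPair {f h : M → W} (hf : ContMDiff 𝓘(ℝ, ℂ) 𝓘(ℝ, W) ∞ f)
    (hh : ContMDiff 𝓘(ℝ, ℂ) 𝓘(ℝ, W) ∞ h) : Continuous (gradPair g f h) :=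
  (continuous_gradPair_family g (contMDiff_const_family hf) (contMDiff_const_family hh)).comp
    (continuous_const.prodMk continuous_id : Continuous fun q : M => ((0 : ℝ), q))

/-- The derivative of a family of maps with respect to the parameter. -/
def velocity (f : ℝ × M → W) (y : ℝ × M) : W := deriv (fun s => f (s, y.2)) y.1

theorem velocity_comp_chart_symm {f : ℝ × M → W}
    (hf : ContMDiff (𝓘(ℝ, ℝ).prod 𝓘(ℝ, ℂ)) 𝓘(ℝ, W) ∞ f) (x : M) {y : ℝ × ℂ}
    (hy : y.2 ∈ (chartAt ℂ x).target) :
    velocity f (y.1, (chartAt ℂ x).symm y.2) =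
      fderiv ℝ (fun y : ℝ × ℂ => f (y.1, (chartAt ℂ x).symm y.2)) y (1, 0) := by
  have h := contDiffAt_of_chart (contDiffOn_family_comp_chart_symm hf x) y.1 hy
  exact (hasDerivAt_slice (h.differentiableAt (by simp))).deriv

theorem hasDerivAt_velocity {f : ℝ × M → W}
    (hf : ContMDiff (𝓘(ℝ, ℝ).prod 𝓘(ℝ, ℂ)) 𝓘(ℝ, W) ∞ f) (t : ℝ) (q : M) :
    HasDerivAt (fun s => f (s, q)) (velocity f (t, q)) t := by
  have hq := mem_chart_source ℂ q
  have h := contDiffAt_of_chart (contDiffOn_family_comp_chart_symm hf q) t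
    ((chartAt ℂ q).map_source hq)
  have h2 := hasDerivAt_slice (h.differentiableAt (by simp))
  simp only [(chartAt ℂ q).left_inv hq] at h2
  exact h2.differentiableAt.hasDerivAt

theorem contMDiff_velocity {f : ℝ × M → W}
    (hf : ContMDiff (𝓘(ℝ, ℝ).prod 𝓘(ℝ, ℂ)) 𝓘(ℝ, W) ∞ f) :
    ContMDiff (𝓘(ℝ, ℝ).prod 𝓘(ℝ, ℂ)) 𝓘(ℝ, W) ∞ (velocity f) := by
  rintro ⟨t, x⟩
  have hx := mem_chart_source ℂ x
  have h := contDiffOn_fderiv_apply (isOpen_univ_prod_target x)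
    (contDiffOn_family_comp_chart_symm hf x) (1, 0)
  have h1 := (contDiffAt_of_chart h t ((chartAt ℂ x).map_source hx)).contMDiffAt
  have h2 : ContMDiffAt (𝓘(ℝ, ℝ).prod 𝓘(ℝ, ℂ)) 𝓘(ℝ, ℝ × ℂ) ∞
      (fun y : ℝ × M => (y.1, chartAt ℂ x y.2)) (t, x) := by
    refine ContMDiffAt.prodMk_space contMDiffAt_fst ?_
    have : ContMDiffAt 𝓘(ℝ, ℂ) 𝓘(ℝ, ℂ) ∞ (chartAt ℂ x) x :=
      ((contMDiffOn_chart (n := ω) (I := 𝓘(ℝ, ℂ))).of_le (by simp)).contMDiffAt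
        ((chartAt ℂ x).open_source.mem_nhds hx)
    exact ContMDiffAt.comp (t, x) this contMDiffAt_snd
  have h3 := ContMDiffAt.comp (f := fun y : ℝ × M => (y.1, chartAt ℂ x y.2)) (t, x) h1 h2
  refine h3.congr_of_eventuallyEq ?_
  have : (Set.univ : Set ℝ) ×ˢ (chartAt ℂ x).source ∈ 𝓝 (t, x) :=
    (isOpen_univ.prod (chartAt ℂ x).open_source).mem_nhds ⟨Set.mem_univ _, hx⟩
  filter_upwards [this] with y hy
  have := velocity_comp_chart_symm hf x (y := (y.1, chartAt ℂ x y.2))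
    ((chartAt ℂ x).map_source hy.2)
  simp only [(chartAt ℂ x).left_inv hy.2] at this
  exact this

/-- Symmetry of the second derivative of the family in the chart at q: differentiation in the
parameter commutes with differentiation along X. -/
theorem hasDerivAt_realDiff {f : ℝ × M → W}
    (hf : ContMDiff (𝓘(ℝ, ℝ).prod 𝓘(ℝ, ℂ)) 𝓘(ℝ, W) ∞ f) (t : ℝ) (q : M) (X : ℂ) :
    HasDerivAt (fun s => realDiff (fun p => f (s, p)) q X)
      (realDiff (fun p => velocity f (t, p)) q X) t := by
  have hz : chartAt ℂ q q ∈ (chartAt ℂ q).target :=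
    (chartAt ℂ q).map_source (mem_chart_source ℂ q)
  set z := chartAt ℂ q q with hzdef
  set F : ℝ × ℂ → W := fun y => f (y.1, (chartAt ℂ q).symm y.2) with hF
  have hFs : ContDiffOn ℝ ∞ F (Set.univ ×ˢ (chartAt ℂ q).target) :=
    contDiffOn_family_comp_chart_symm hf q
  have hat : ∀ s, ContDiffAt ℝ ∞ F (s, z) := fun s =>
    contDiffAt_of_chart hFs s hz
  have hd : ∀ v, ContDiffAt ℝ ∞ (fun y => fderiv ℝ F y v) (t, z) := fun v =>
    contDiffAt_of_chart (contDiffOn_fderiv_apply (isOpen_univ_prod_target q) hFs v) t hz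
  have e1 : ∀ s, realDiff (fun p => f (s, p)) q X = fderiv ℝ F (s, z) (0, X) := fun s => by
    rw [realDiff_eq (mdifferentiable_slice hf s q), ← fderiv_slice ((hat s).differentiableAt
      (by simp))]
  have e2 : realDiff (fun p => velocity f (t, p)) q X =
      fderiv ℝ (fun y => fderiv ℝ F y (1, 0)) (t, z) (0, X) := by
    rw [realDiff_eq (mdifferentiable_slice (contMDiff_velocity hf) t q),
      ← fderiv_slice ((hd _).differentiableAt (by simp))]
    refine congrArg (fun T : ℂ →L[ℝ] W => T X) (Filter.EventuallyEq.fderiv_eq ?_)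
    filter_upwards [(chartAt ℂ q).open_target.mem_nhds hz] with w hw
    exact velocity_comp_chart_symm hf q (y := (t, w)) hw
  have hdd : DifferentiableAt ℝ (fderiv ℝ F) (t, z) :=
    ((hat t).fderiv_right (m := 1) (by norm_cast)).differentiableAt (by simp)
  have hsymm : IsSymmSndFDerivAt ℝ F (t, z) := (hat t).isSymmSndFDerivAt (by
    simpa using (WithTop.coe_le_coe.2 le_top : ((2 : ℕ∞) : WithTop ℕ∞) ≤ ∞))
  have e3 : ∀ u v, fderiv ℝ (fun y => fderiv ℝ F y u) (t, z) v =
      fderiv ℝ (fderiv ℝ F) (t, z) v u := fun u v => by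
    have := hdd.hasFDerivAt.clm_apply (hasFDerivAt_const u (t, z))
    rw [this.fderiv]
    simp
  simp only [e1]
  rw [e2, e3, hsymm.eq, ← e3]
  exact hasDerivAt_slice ((hd (0, X)).differentiableAt (by simp))

end Gradient

/-! ### First variation of energy and area -/

section Variation

variable {M : Type*} [TopologicalSpace M] [ChartedSpace ℂ M] [IsManifold 𝓘(ℂ) ω M]
  (g : HermitianMetric M)
variable {W : Type*} [NormedAddCommGroup W] [InnerProductSpace ℝ W]

omit [IsManifold 𝓘(ℂ) ω M] in
-- Cauchy-Schwarz and the arithmetic-geometric mean inequality. Single entries in the frame e₁, e₂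
-- may jump from point to point, so compactness bounds them only through the continuous traces on
-- the right.
theorem abs_inner_le_gradPair_e₁ (f h : M → W) (q : M) [IsManifold 𝓘(ℂ) ω M]
    (g : HermitianMetric M) {X Y : ℂ} (hX : X = g.e₁ q ∨ X = g.e₂ q)
    (hY : Y = g.e₁ q ∨ Y = g.e₂ q) :
    |⟪realDiff f q X, realDiff h q Y⟫_ℝ| ≤ (gradPair g f f q + gradPair g h h q) / 2 := by
  have key : ∀ (k : M → W) (Z : ℂ), (Z = g.e₁ q ∨ Z = g.e₂ q) →
      ‖realDiff k q Z‖ ^ 2 ≤ gradPair g k k q := by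
    intro k Z hZ
    rw [gradPair, real_inner_self_eq_norm_sq, real_inner_self_eq_norm_sq]
    rcases hZ with rfl | rfl
    · linarith [sq_nonneg ‖realDiff k q (g.e₂ q)‖]
    · linarith [sq_nonneg ‖realDiff k q (g.e₁ q)‖]
  have h1 := abs_real_inner_le_norm (realDiff f q X) (realDiff h q Y)
  nlinarith [key f X hX, key h Y hY, sq_nonneg (‖realDiff f q X‖ - ‖realDiff h q Y‖)]

theorem hasDerivAt_inner_realDiff {f : ℝ × M → W}
    (hf : ContMDiff (𝓘(ℝ, ℝ).prod 𝓘(ℝ, ℂ)) 𝓘(ℝ, W) ∞ f) (t : ℝ) (q : M) (X Y : ℂ) :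
    HasDerivAt (fun s => ⟪realDiff (fun p => f (s, p)) q X, realDiff (fun p => f (s, p)) q Y⟫_ℝ)
      (⟪realDiff (fun p => f (t, p)) q X, realDiff (fun p => velocity f (t, p)) q Y⟫_ℝ +
        ⟪realDiff (fun p => velocity f (t, p)) q X, realDiff (fun p => f (t, p)) q Y⟫_ℝ) t :=
  (hasDerivAt_realDiff hf t q X).inner ℝ (hasDerivAt_realDiff hf t q Y)

theorem hasDerivAt_gradPair {f : ℝ × M → W}
    (hf : ContMDiff (𝓘(ℝ, ℝ).prod 𝓘(ℝ, ℂ)) 𝓘(ℝ, W) ∞ f) (t : ℝ) (q : M) :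
    HasDerivAt (fun s => gradPair g (fun p => f (s, p)) (fun p => f (s, p)) q)
      (2 * gradPair g (fun p => f (t, p)) (fun p => velocity f (t, p)) q) t := by
  have h := (hasDerivAt_inner_realDiff hf t q (g.e₁ q) (g.e₁ q)).add
    (hasDerivAt_inner_realDiff hf t q (g.e₂ q) (g.e₂ q))
  refine h.congr_deriv ?_
  rw [gradPair, real_inner_comm (realDiff (fun p => f (t, p)) q (g.e₁ q)),
    real_inner_comm (realDiff (fun p => f (t, p)) q (g.e₂ q))]
  ring

variable [CompactSpace M]

omit [ChartedSpace ℂ M] [IsManifold 𝓘(ℂ) ω M] in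
theorem exists_bound_of_continuous {k : ℝ × M → ℝ} (hk : Continuous k) :
    ∃ C : ℝ, 0 ≤ C ∧ ∀ t ∈ Set.Icc (-1 : ℝ) 1, ∀ q, |k (t, q)| ≤ C := by
  obtain ⟨C, hC⟩ := (isCompact_Icc.prod (isCompact_univ (X := M))).exists_bound_of_continuousOn
    (f := k) (s := Set.Icc (-1 : ℝ) 1 ×ˢ Set.univ) hk.continuousOn
  exact ⟨max C 0, le_max_right _ _, fun t ht q =>
    (hC (t, q) ⟨ht, Set.mem_univ q⟩).trans (le_max_left _ _)⟩

variable [MeasurableSpace M] [BorelSpace M]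

theorem integrable_area {f : M → ℝ} (hf : Continuous f) : Integrable f g.area := by
  have : IsFiniteMeasure g.area := CompactSpace.isFiniteMeasure
  obtain ⟨C, hC⟩ := isCompact_univ.exists_bound_of_continuousOn (f := f) hf.continuousOn
  exact Integrable.of_bound hf.aestronglyMeasurable C
    (Filter.Eventually.of_forall fun q => hC q (Set.mem_univ q))

theorem hasDerivAt_integral_gradPair {f : ℝ × M → W}
    (hf : ContMDiff (𝓘(ℝ, ℝ).prod 𝓘(ℝ, ℂ)) 𝓘(ℝ, W) ∞ f) :
    HasDerivAt (fun t => ∫ q, gradPair g (fun p => f (t, p)) (fun p => f (t, p)) q ∂g.area)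
      (∫ q, 2 * gradPair g (fun p => f (0, p)) (fun p => velocity f (0, p)) q ∂g.area) 0 := by
  have hc := (continuous_gradPair_family g hf (contMDiff_velocity hf)).const_mul 2
  obtain ⟨C, -, hC⟩ := exists_bound_of_continuous hc
  have hcont : ∀ t, Continuous (gradPair g (fun p => f (t, p)) (fun p => f (t, p))) := fun t =>
    continuous_gradPair g (contMDiff_slice hf t) (contMDiff_slice hf t)
  refine (hasDerivAt_integral_of_dominated_loc_of_deriv_le (bound := fun _ => C)
    (F' := fun t q => 2 * gradPair g (fun p => f (t, p)) (fun p => velocity f (t, p)) q)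
    (Icc_mem_nhds (by norm_num : (-1 : ℝ) < 0) (by norm_num : (0 : ℝ) < 1))
    (Filter.Eventually.of_forall fun t => (hcont t).aestronglyMeasurable)
    (integrable_area g (hcont 0)) ?_ ?_ (integrable_area g continuous_const) ?_).2
  · exact ((continuous_gradPair g (contMDiff_slice hf 0)
      (contMDiff_slice (contMDiff_velocity hf) 0)).const_mul 2).aestronglyMeasurable
  · exact Filter.Eventually.of_forall fun q t ht => hC t ht q
  · exact Filter.Eventually.of_forall fun q t _ => hasDerivAt_gradPair g hf t q

theorem abs_sub_le_mul_of_hasDerivAt {k k' : ℝ → ℝ} {C : ℝ}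
    (hk : ∀ t, HasDerivAt k (k' t) t) (hC : ∀ t ∈ Set.Icc (-1 : ℝ) 1, |k' t| ≤ C)
    {t : ℝ} (ht : t ∈ Set.Icc (-1 : ℝ) 1) : |k t - k 0| ≤ C * |t| := by
  have := (convex_Icc (-1 : ℝ) 1).norm_image_sub_le_of_norm_hasDerivWithin_le
    (f := k) (f' := k') (fun s _ => (hk s).hasDerivWithinAt) hC
    (x := 0) (y := t) (by simp) ht
  simpa using this

omit [BorelSpace M] in
-- With s = e² - d one has e - √d = s / (e + √d), and the denominator is at least c.
theorem sub_sqrt_le {e d s c : ℝ} (hd : 0 ≤ d) (hs : d = e ^ 2 - s) (hs0 : 0 ≤ s)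
    (hc : 0 < c) (he : c ≤ e) : |Real.sqrt d - e| ≤ s / c := by
  have h1 : Real.sqrt d ≤ e := Real.sqrt_le_iff.2 ⟨by linarith, by linarith⟩
  have h2 := Real.sq_sqrt hd
  have h3 := Real.sqrt_nonneg d
  rw [abs_of_nonpos (by linarith), le_div_iff₀ hc]
  nlinarith

/-- If a family of maps is conformal for the parameter `0`, with differentials bounded below, and
its energy is stationary there, then so is its area. -/
theorem hasDerivAt_integral_sqrt_gramDet {f : ℝ × M → W}
    (hf : ContMDiff (𝓘(ℝ, ℝ).prod 𝓘(ℝ, ℂ)) 𝓘(ℝ, W) ∞ f) {c : ℝ} (hc : 0 < c)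
    (h11 : ∀ q, c ≤ ⟪realDiff (fun p => f (0, p)) q (g.e₁ q),
      realDiff (fun p => f (0, p)) q (g.e₁ q)⟫_ℝ)
    (h22 : ∀ q, ⟪realDiff (fun p => f (0, p)) q (g.e₁ q),
      realDiff (fun p => f (0, p)) q (g.e₁ q)⟫_ℝ =
      ⟪realDiff (fun p => f (0, p)) q (g.e₂ q), realDiff (fun p => f (0, p)) q (g.e₂ q)⟫_ℝ)
    (h12 : ∀ q, ⟪realDiff (fun p => f (0, p)) q (g.e₁ q),
      realDiff (fun p => f (0, p)) q (g.e₂ q)⟫_ℝ = 0)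
    (hE : HasDerivAt
      (fun t => ∫ q, gradPair g (fun p => f (t, p)) (fun p => f (t, p)) q ∂g.area) 0 0) :
    HasDerivAt (fun t => ∫ q, Real.sqrt (gramDet g (fun p => f (t, p)) q) ∂g.area) 0 0 := by
  have hfin : IsFiniteMeasure g.area := CompactSpace.isFiniteMeasure
  obtain ⟨C₁, hC₁0, hC₁⟩ := exists_bound_of_continuous (continuous_gradPair_family g hf hf)
  obtain ⟨C₂, hC₂0, hC₂⟩ := exists_bound_of_continuous
    (continuous_gradPair_family g (contMDiff_velocity hf) (contMDiff_velocity hf))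
  set C := C₁ + C₂ with hCdef
  -- Each entry of the Gram matrix is Lipschitz in the parameter, with one constant for all points.
  have hlip : ∀ (q : M) (X Y : ℂ), (X = g.e₁ q ∨ X = g.e₂ q) → (Y = g.e₁ q ∨ Y = g.e₂ q) →
      ∀ t ∈ Set.Icc (-1 : ℝ) 1, |⟪realDiff (fun p => f (t, p)) q X,
        realDiff (fun p => f (t, p)) q Y⟫_ℝ - ⟪realDiff (fun p => f (0, p)) q X,
        realDiff (fun p => f (0, p)) q Y⟫_ℝ| ≤ C * |t| := by
    intro q X Y hX hY t ht
    refine abs_sub_le_mul_of_hasDerivAt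
      (k := fun t => ⟪realDiff (fun p => f (t, p)) q X, realDiff (fun p => f (t, p)) q Y⟫_ℝ)
      (fun s => hasDerivAt_inner_realDiff hf s q X Y) (fun s hs => ?_) ht
    have a1 := abs_inner_le_gradPair_e₁ (fun p => f (s, p)) (fun p => velocity f (s, p)) q g hX hY
    have a2 := abs_inner_le_gradPair_e₁ (fun p => velocity f (s, p)) (fun p => f (s, p)) q g hX hY
    have a3 := le_of_abs_le (hC₁ s hs q)
    have a4 := le_of_abs_le (hC₂ s hs q)
    refine (abs_add_le _ _).trans ?_
    dsimp only at a3 a4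
    linarith
  set A : ℝ → ℝ := fun t => ∫ q, Real.sqrt (gramDet g (fun p => f (t, p)) q) ∂g.area
  set E : ℝ → ℝ := fun t => ∫ q, gradPair g (fun p => f (t, p)) (fun p => f (t, p)) q ∂g.area
  have hIA : ∀ t, Integrable (fun q => Real.sqrt (gramDet g (fun p => f (t, p)) q)) g.area :=
    fun t => integrable_area g (((continuous_gramDet_family g hf).comp
      (continuous_const.prodMk continuous_id : Continuous fun q : M => (t, q))).sqrt)
  have hIE : ∀ t, Integrable (gradPair g (fun p => f (t, p)) (fun p => f (t, p))) g.area :=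
    fun t => integrable_area g (continuous_gradPair g (contMDiff_slice hf t) (contMDiff_slice hf t))
  -- With diagonal entries a, b and off-diagonal entry w, ((a + b)/2)² - (ab - w²) = ((a - b)/2)² +
  -- w². Both squares vanish at parameter 0 by conformality, so each is at most (C|t|)²; and (a +
  -- b)/2 stays above c/2 as long as C|t| ≤ c/2.
  have hpt : ∀ t ∈ Set.Icc (-1 : ℝ) 1, C * |t| ≤ c / 2 → ∀ q,
      |Real.sqrt (gramDet g (fun p => f (t, p)) q) -
        gradPair g (fun p => f (t, p)) (fun p => f (t, p)) q / 2| ≤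
        (2 * (C * |t|) ^ 2) / (c / 2) := by
    intro t ht htc q
    have b11 := hlip q _ _ (Or.inl rfl) (Or.inl rfl) t ht
    have b22 := hlip q _ _ (Or.inr rfl) (Or.inr rfl) t ht
    have b12 := hlip q _ _ (Or.inl rfl) (Or.inr rfl) t ht
    rw [h12 q, sub_zero] at b12
    rw [← h22 q] at b22
    have hcs := real_inner_mul_inner_self_le (realDiff (fun p => f (t, p)) q (g.e₁ q))
      (realDiff (fun p => f (t, p)) q (g.e₂ q))
    have hlow := h11 q
    have hdet : 0 ≤ gramDet g (fun p => f (t, p)) q := by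
      rw [gramDet]
      nlinarith
    rw [gramDet] at hdet ⊢
    rw [gradPair]
    set a := ⟪realDiff (fun p => f (t, p)) q (g.e₁ q), realDiff (fun p => f (t, p)) q (g.e₁ q)⟫_ℝ
    set b := ⟪realDiff (fun p => f (t, p)) q (g.e₂ q), realDiff (fun p => f (t, p)) q (g.e₂ q)⟫_ℝ
    set w := ⟪realDiff (fun p => f (t, p)) q (g.e₁ q), realDiff (fun p => f (t, p)) q (g.e₂ q)⟫_ℝ
    set r := ⟪realDiff (fun p => f (0, p)) q (g.e₁ q), realDiff (fun p => f (0, p)) q (g.e₁ q)⟫_ℝ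
    rw [abs_le] at b11 b22
    have e1 : ((a - b) / 2) ^ 2 ≤ (C * |t|) ^ 2 := sq_le_sq' (by linarith) (by linarith)
    have e2 : w ^ 2 ≤ (C * |t|) ^ 2 := sq_le_sq' (by linarith [neg_le_of_abs_le b12])
      (le_of_abs_le b12)
    refine (sub_sqrt_le (s := ((a - b) / 2) ^ 2 + w ^ 2) hdet (by ring) (by positivity)
      (half_pos hc) (by linarith)).trans ?_
    exact div_le_div_of_nonneg_right (by linarith) (half_pos hc).le
  have hD : ∀ t ∈ Set.Icc (-1 : ℝ) 1, C * |t| ≤ c / 2 →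
      |A t - E t / 2| ≤ (2 * C ^ 2 / (c / 2) * g.area.real Set.univ) * ‖t - 0‖ ^ 2 := by
    intro t ht htc
    have : A t - E t / 2 = ∫ q, (Real.sqrt (gramDet g (fun p => f (t, p)) q) -
        gradPair g (fun p => f (t, p)) (fun p => f (t, p)) q / 2) ∂g.area := by
      rw [integral_sub (hIA t) ((hIE t).div_const 2), integral_div]
    rw [this, ← Real.norm_eq_abs]
    refine (norm_integral_le_of_norm_le_const (C := 2 * (C * |t|) ^ 2 / (c / 2))
      (Filter.Eventually.of_forall fun q => hpt t ht htc q)).trans_eq ?_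
    rw [sub_zero, Real.norm_eq_abs]
    ring
  -- Integrated over a surface of finite area, the pointwise estimate makes the area minus half the
  -- Dirichlet integral O(t²), so this difference has derivative zero at 0.
  have hbig : (fun t => A t - E t / 2) =O[𝓝 0] fun t => ‖t - 0‖ ^ 2 := by
    refine IsBigO.of_bound (2 * C ^ 2 / (c / 2) * g.area.real Set.univ) ?_
    have h1 : ∀ᶠ t : ℝ in 𝓝 0, t ∈ Set.Icc (-1 : ℝ) 1 :=
      Icc_mem_nhds (by norm_num) (by norm_num)
    have h2 : ∀ᶠ t : ℝ in 𝓝 0, C * |t| < c / 2 := by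
      have : ContinuousAt (fun t : ℝ => C * |t|) 0 := by fun_prop
      exact this.eventually_lt continuousAt_const (by simpa using half_pos hc)
    filter_upwards [h1, h2] with t ht htc
    rw [norm_pow, norm_norm]
    exact hD t ht htc.le
  have hder : HasDerivAt (fun t => A t - E t / 2) 0 0 := by
    have := (hbig.hasFDerivAt (by norm_num)).hasDerivAt
    simpa using this
  refine ((hder.add (hE.div_const 2)).congr_deriv (by simp)).congr_of_eventuallyEq
    (Filter.Eventually.of_forall fun t => ?_)
  simp [A, E]

end Variation

/-! ### Green's formula on the compact surface -/

section Divergence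

variable {M : Type*} [TopologicalSpace M] [ChartedSpace ℂ M] [IsManifold 𝓘(ℂ) ω M]
  (g : HermitianMetric M)
variable {W : Type*} [NormedAddCommGroup W] [InnerProductSpace ℝ W]

theorem integral_fderiv_eq_zero {k : ℂ → ℝ} (hk : ContDiff ℝ 1 k) (hc : HasCompactSupport k)
    (v : ℂ) : ∫ z, fderiv ℝ k z v = 0 := by
  have h := integral_mul_fderiv_eq_neg_fderiv_mul_of_integrable (μ := (volume : Measure ℂ))
    (f := fun _ => (1 : ℝ)) (g := k) (v := v) (by simp)
    (by simpa using ((hk.continuous_fderiv (by simp)).clm_apply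
      continuous_const).integrable_of_hasCompactSupport (hc.fderiv_apply ℝ v))
    (by simpa using hk.continuous.integrable_of_hasCompactSupport hc)
    (by fun_prop) (fun z _ => hk.differentiable (by simp) z)
  simpa using h

/-- The Laplacian, in the coordinate of the preferred chart at `x`. -/
def chartLaplacian (f : M → W) (x : M) (z : ℂ) : W :=
  fderiv ℝ (fun w => fderiv ℝ (fun w => f ((chartAt ℂ x).symm w)) w 1) z 1 +
  fderiv ℝ (fun w => fderiv ℝ (fun w => f ((chartAt ℂ x).symm w)) w Complex.I) z Complex.I

omit [IsManifold 𝓘(ℂ) ω M] in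
theorem realDiff_eq_zero_of_notMem_tsupport {f : M → W} {q : M} (hq : q ∉ tsupport f) :
    realDiff f q = 0 := by
  have h : f =ᶠ[𝓝 q] fun _ => 0 := notMem_tsupport_iff_eventuallyEq.1 hq
  rw [realDiff_congr h]
  exact mfderiv_const

variable [T2Space M] [CompactSpace M] [MeasurableSpace M] [BorelSpace M]

omit [T2Space M] in
-- In the chart the integrand is Euclidean, ⟨∇F, ∇H⟩ = div⟨∇F, H⟩ - ⟨ΔF, H⟩. The last term vanishes
-- by hypothesis and the divergence of a compactly supported field integrates to zero.
theorem integral_gradPair_eq_zero_of_tsupport {f h : M → W}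
    (hf : ContMDiff 𝓘(ℝ, ℂ) 𝓘(ℝ, W) ∞ f) (hh : ContMDiff 𝓘(ℝ, ℂ) 𝓘(ℝ, W) ∞ h) {x : M}
    (hsupp : tsupport h ⊆ (chartAt ℂ x).source)
    (hlap : ∀ z ∈ (chartAt ℂ x).target,
      ⟪chartLaplacian f x z, h ((chartAt ℂ x).symm z)⟫_ℝ = 0) :
    ∫ q, gradPair g f h q ∂g.area = 0 := by
  set φ := chartAt ℂ x
  set F : ℂ → W := fun w => f (φ.symm w) with hF
  set H : ℂ → W := fun w => h (φ.symm w) with hH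
  have hFs : ContDiffOn ℝ ∞ F φ.target := contDiffOn_comp_chart_symm hf x
  have hHs : ContDiffOn ℝ ∞ H φ.target := contDiffOn_comp_chart_symm hh x
  set K : Set ℂ := φ '' tsupport h
  have hKc : IsCompact K :=
    (isClosed_tsupport h).isCompact.image_of_continuousOn (φ.continuousOn.mono hsupp)
  have hKt : K ⊆ φ.target := by
    rintro _ ⟨q, hq, rfl⟩
    exact φ.map_source (hsupp hq)
  have hH0 : ∀ z ∈ φ.target, z ∉ K → H z = 0 := by
    intro z hz hzK
    by_contra hne
    exact hzK ⟨φ.symm z, subset_tsupport h hne, φ.right_inv hz⟩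
  have hzero : ∀ q ∉ φ.source, gradPair g f h q = 0 := by
    intro q hq
    have h0 : ∀ X : ℂ, realDiff h q X = 0 := fun X => by
      rw [realDiff_eq_zero_of_notMem_tsupport (fun hq' => hq (hsupp hq') : q ∉ tsupport h)]
      rfl
    rw [gradPair, h0 (g.e₁ q), h0 (g.e₂ q), inner_zero_right, inner_zero_right, add_zero]
  rw [g.integral_area_eq x (continuous_gradPair g hf hh) hzero]
  -- The components of the field ⟨∇F, H⟩, extended by zero outside the chart. The extension is C¹ on
  -- all of ℂ because H vanishes off the compact set K inside the chart.
  let k : ℂ → ℂ → ℝ := fun v => φ.target.indicator fun z => ⟪fderiv ℝ F z v, H z⟫_ℝ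
  have hk0 : ∀ v, ∀ z ∉ K, k v z = 0 := by
    intro v z hz
    by_cases hzt : z ∈ φ.target
    · simp [k, Set.indicator_of_mem hzt, hH0 z hzt hz]
    · exact Set.indicator_of_notMem hzt _
  have hev : ∀ v, ∀ z ∈ φ.target, k v =ᶠ[𝓝 z] fun z => ⟪fderiv ℝ F z v, H z⟫_ℝ := by
    intro v z hz
    filter_upwards [φ.open_target.mem_nhds hz] with w hw
    exact Set.indicator_of_mem hw _
  have hkev0 : ∀ v, ∀ z ∉ K, k v =ᶠ[𝓝 z] fun _ => 0 := by
    intro v z hz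
    filter_upwards [hKc.isClosed.isOpen_compl.mem_nhds hz] with w hw
    exact hk0 v w hw
  have hFv : ∀ v, ∀ z ∈ φ.target, ContDiffAt ℝ ∞ (fun z => fderiv ℝ F z v) z := fun v z hz =>
    (contDiffOn_fderiv_apply φ.open_target hFs v).contDiffAt (φ.open_target.mem_nhds hz)
  have hHz : ∀ z ∈ φ.target, ContDiffAt ℝ ∞ H z := fun z hz =>
    hHs.contDiffAt (φ.open_target.mem_nhds hz)
  have hks : ∀ v, ContDiff ℝ 1 (k v) := by
    intro v
    refine contDiff_iff_contDiffAt.2 fun z => ?_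
    by_cases hz : z ∈ K
    · exact (((hFv v z (hKt hz)).inner ℝ (hHz z (hKt hz))).of_le (by simp)).congr_of_eventuallyEq
        (hev v z (hKt hz))
    · exact contDiffAt_const.congr_of_eventuallyEq (hkev0 v z hz)
  have hkc : ∀ v, HasCompactSupport (k v) := fun v =>
    HasCompactSupport.intro hKc fun z hz => hk0 v z hz
  have hkd : ∀ v, ∀ z ∈ φ.target, fderiv ℝ (k v) z v =
      ⟪fderiv ℝ F z v, fderiv ℝ H z v⟫_ℝ + ⟪fderiv ℝ (fun w => fderiv ℝ F w v) z v, H z⟫_ℝ := by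
    intro v z hz
    rw [(hev v z hz).fderiv_eq, fderiv_inner_apply ℝ ((hFv v z hz).differentiableAt (by simp))
      ((hHz z hz).differentiableAt (by simp))]
  have hint : ∀ v, Integrable (fun z => fderiv ℝ (k v) z v) := fun v =>
    (((hks v).continuous_fderiv (by simp)).clm_apply
      continuous_const).integrable_of_hasCompactSupport ((hkc v).fderiv_apply ℝ v)
  have hpt : ∀ z ∈ φ.target, gradPair g f h (φ.symm z) * g.areaDensity x z =
      fderiv ℝ (k 1) z 1 + fderiv ℝ (k Complex.I) z Complex.I := by
    intro z hz
    rw [gradPair_mul_areaDensity g hz (hf.mdifferentiable (by simp) _)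
      (hh.mdifferentiable (by simp) _), hkd 1 z hz, hkd Complex.I z hz]
    have h0 := hlap z hz
    rw [chartLaplacian, inner_add_left] at h0
    linarith
  rw [setIntegral_congr_fun φ.open_target.measurableSet hpt,
    setIntegral_eq_integral_of_forall_compl_eq_zero, integral_add (hint 1) (hint Complex.I),
    integral_fderiv_eq_zero (hks 1) (hkc 1), integral_fderiv_eq_zero (hks _) (hkc _), add_zero]
  intro z hz
  have hzK : z ∉ K := fun h => hz (hKt h)
  rw [(hkev0 1 z hzK).fderiv_eq, (hkev0 Complex.I z hzK).fderiv_eq]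
  simp

/-- Green's formula, for functions whose Laplacians are orthogonal near each point. -/
theorem integral_gradPair_eq_zero {f h : M → W}
    (hf : ContMDiff 𝓘(ℝ, ℂ) 𝓘(ℝ, W) ∞ f) (hh : ContMDiff 𝓘(ℝ, ℂ) 𝓘(ℝ, W) ∞ h)
    (hlap : ∀ x : M, ∃ N : Set M, IsOpen N ∧ x ∈ N ∧ N ⊆ (chartAt ℂ x).source ∧
      ∀ q ∈ N, ⟪chartLaplacian f x (chartAt ℂ x q), h q⟫_ℝ = 0) :
    ∫ q, gradPair g f h q ∂g.area = 0 := by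
  choose N hNo hxN hNs hN using hlap
  -- Only h is localized. The Laplacian falls on f alone, so orthogonality to h at a point passes to
  -- orthogonality to χ h.
  obtain ⟨χ, hχ⟩ := SmoothPartitionOfUnity.exists_isSubordinate (M := M) 𝓘(ℝ, ℂ)
    (isClosed_univ (X := M)) N hNo (fun x _ => Set.mem_iUnion.2 ⟨x, hxN x⟩)
  have hfin := χ.locallyFinite.finite_nonempty_of_compact
  set s := hfin.toFinset
  have hsum : ∀ q, ∑ i ∈ s, χ i q = 1 := by
    intro q
    rw [← χ.sum_eq_one (Set.mem_univ q), finsum_eq_sum_of_support_subset]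
    intro i hi
    exact hfin.mem_toFinset.2 ⟨q, hi⟩
  have hsm : ∀ i, ContMDiff 𝓘(ℝ, ℂ) 𝓘(ℝ, W) ∞ (fun q => χ i q • h q) := fun i =>
    (χ i).contMDiff.smul hh
  have hdiff : ∀ q, realDiff h q = ∑ i ∈ s, realDiff (fun p => χ i p • h p) q := by
    intro q
    have hd : ∀ i ∈ s, DifferentiableAt ℝ
        (fun w => χ i ((chartAt ℂ q).symm w) • h ((chartAt ℂ q).symm w)) (chartAt ℂ q q) :=
      fun i _ => by
        refine differentiableAt_comp_chart_symm (f := fun p => χ i p • h p)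
          ((chartAt ℂ q).map_source (mem_chart_source ℂ q)) ?_
        exact (hsm i).mdifferentiable (by simp) _
    rw [realDiff_eq (hh.mdifferentiable (by simp) q)]
    rw [Finset.sum_congr rfl fun i _ => realDiff_eq ((hsm i).mdifferentiable (by simp) q),
      ← fderiv_fun_sum hd]
    congr 1
    funext w
    rw [← Finset.sum_smul, hsum, one_smul]
  have hgp : ∀ q, gradPair g f h q = ∑ i ∈ s, gradPair g f (fun p => χ i p • h p) q := by
    intro q
    have hX : ∀ X : ℂ, realDiff h q X = ∑ i ∈ s, realDiff (fun p => χ i p • h p) q X :=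
      fun X => by rw [hdiff q, sum_apply]
    rw [gradPair, hX (g.e₁ q), hX (g.e₂ q)]
    simp only [inner_sum, gradPair, Finset.sum_add_distrib]
  simp only [hgp]
  rw [integral_finsetSum _ fun i _ => integrable_area g (continuous_gradPair g hf (hsm i))]
  refine Finset.sum_eq_zero fun i _ => ?_
  have hts : tsupport (fun p => χ i p • h p) ⊆ N i := (tsupport_smul_subset_left _ _).trans (hχ i)
  refine integral_gradPair_eq_zero_of_tsupport g hf (hsm i) (x := i) (hts.trans (hNs i)) ?_
  intro z hz
  by_cases hq : (chartAt ℂ i).symm z ∈ N i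
  · have := hN i _ hq
    rw [(chartAt ℂ i).right_inv hz] at this
    rw [real_inner_smul_right, this, mul_zero]
  · rw [image_eq_zero_of_notMem_tsupport (f := fun p => χ i p • h p) fun h => hq (hts h),
      inner_zero_right]

end Divergence

/-! ### Wirtinger operators, without the factor 1/2 -/

section Wirtinger

/-- The operator `∂_x - i ∂_y`. -/
def dz (f : ℂ → ℂ) (z : ℂ) : ℂ := fderiv ℝ f z 1 - Complex.I * fderiv ℝ f z Complex.I

/-- The operator `∂_x + i ∂_y`. -/
def dzbar (f : ℂ → ℂ) (z : ℂ) : ℂ := fderiv ℝ f z 1 + Complex.I * fderiv ℝ f z Complex.I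

theorem dz_mul {f h : ℂ → ℂ} {z : ℂ} (hf : DifferentiableAt ℝ f z) (hh : DifferentiableAt ℝ h z) :
    dz (fun w => f w * h w) z = dz f z * h z + f z * dz h z := by
  simp only [dz, fderiv_fun_mul hf hh, add_apply, smul_apply, smul_eq_mul]
  ring

theorem dzbar_mul {f h : ℂ → ℂ} {z : ℂ} (hf : DifferentiableAt ℝ f z)
    (hh : DifferentiableAt ℝ h z) :
    dzbar (fun w => f w * h w) z = dzbar f z * h z + f z * dzbar h z := by
  simp only [dzbar, fderiv_fun_mul hf hh, add_apply, smul_apply, smul_eq_mul]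
  ring

theorem fderiv_conj {E : Type*} [NormedAddCommGroup E] [NormedSpace ℝ E] {f : E → ℂ} {z : E}
    (hf : DifferentiableAt ℝ f z) (v : E) :
    fderiv ℝ (fun w => starRingEnd ℂ (f w)) z v = starRingEnd ℂ (fderiv ℝ f z v) := by
  have h := (Complex.conjCLE.toContinuousLinearMap.hasFDerivAt.comp z hf.hasFDerivAt).fderiv
  exact congrArg (fun T : E →L[ℝ] ℂ => T v) h

theorem dz_conj {f : ℂ → ℂ} {z : ℂ} (hf : DifferentiableAt ℝ f z) :
    dz (fun w => starRingEnd ℂ (f w)) z = starRingEnd ℂ (dzbar f z) := by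
  simp [dz, dzbar, fderiv_conj hf, sub_eq_add_neg]

theorem dzbar_sum {ι : Type*} [Fintype ι] {f : ι → ℂ → ℂ} {z : ℂ}
    (hf : ∀ i, DifferentiableAt ℝ (f i) z) :
    dzbar (fun w => ∑ i, f i w) z = ∑ i, dzbar (f i) z := by
  simp only [dzbar, fderiv_fun_sum fun i _ => hf i, sum_apply, Finset.mul_sum,
    Finset.sum_add_distrib]

theorem dz_sum {ι : Type*} [Fintype ι] {f : ι → ℂ → ℂ} {z : ℂ}
    (hf : ∀ i, DifferentiableAt ℝ (f i) z) :
    dz (fun w => ∑ i, f i w) z = ∑ i, dz (f i) z := by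
  simp only [dz, fderiv_fun_sum fun i _ => hf i, sum_apply, Finset.mul_sum,
    Finset.sum_sub_distrib]

theorem dzbar_congr {f h : ℂ → ℂ} {z : ℂ} (hfh : f =ᶠ[𝓝 z] h) : dzbar f z = dzbar h z := by
  rw [dzbar, dzbar, hfh.fderiv_eq]

theorem dz_congr {f h : ℂ → ℂ} {z : ℂ} (hfh : f =ᶠ[𝓝 z] h) : dz f z = dz h z := by
  rw [dz, dz, hfh.fderiv_eq]

theorem differentiableAt_dzbar {f : ℂ → ℂ} {z : ℂ} (hf : ContDiffAt ℝ ∞ f z) :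
    DifferentiableAt ℝ (dzbar f) z := by
  have hd : DifferentiableAt ℝ (fderiv ℝ f) z :=
    (hf.fderiv_right (m := 1) (by norm_cast)).differentiableAt (by simp)
  exact (hd.clm_apply (differentiableAt_const 1)).add
    ((hd.clm_apply (differentiableAt_const Complex.I)).const_mul Complex.I)

/-- The mixed second derivatives cancel by symmetry. Without the usual factors 1/2 the composition
is the Euclidean Laplacian itself. -/
theorem dz_dzbar {f : ℂ → ℂ} {z : ℂ} (hf : ContDiffAt ℝ ∞ f z) :
    dz (dzbar f) z = fderiv ℝ (fun w => fderiv ℝ f w 1) z 1 +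
      fderiv ℝ (fun w => fderiv ℝ f w Complex.I) z Complex.I := by
  have hd : DifferentiableAt ℝ (fderiv ℝ f) z :=
    (hf.fderiv_right (m := 1) (by norm_cast)).differentiableAt (by simp)
  have hsymm : IsSymmSndFDerivAt ℝ f z := hf.isSymmSndFDerivAt (by
    simpa using (WithTop.coe_le_coe.2 le_top : ((2 : ℕ∞) : WithTop ℕ∞) ≤ ∞))
  have hv : ∀ v, DifferentiableAt ℝ (fun w => fderiv ℝ f w v) z := fun v =>
    hd.clm_apply (differentiableAt_const v)
  have e : ∀ u v, fderiv ℝ (fun w => fderiv ℝ f w u) z v = fderiv ℝ (fderiv ℝ f) z v u :=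
    fun u v => by
      rw [(hd.hasFDerivAt.clm_apply (hasFDerivAt_const u z)).fderiv]
      simp
  have e2 : ∀ v, fderiv ℝ (dzbar f) z v = fderiv ℝ (fun w => fderiv ℝ f w 1) z v +
      Complex.I * fderiv ℝ (fun w => fderiv ℝ f w Complex.I) z v := fun v => by
    have h := (hv 1).hasFDerivAt.add ((hv Complex.I).hasFDerivAt.const_mul Complex.I)
    exact congrArg (fun T : ℂ →L[ℝ] ℂ => T v) h.fderiv
  rw [dz, e2, e2, e Complex.I 1, e 1 Complex.I, hsymm.eq]
  linear_combination (-fderiv ℝ (fun w => fderiv ℝ f w Complex.I) z Complex.I) * Complex.I_sq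

end Wirtinger

/-! ### Complex matrices as a real Euclidean space with the Frobenius product -/

section RealCoords

variable {ι : Type*} [Fintype ι]

/-- The real coordinates of a complex matrix. -/
def realCoords (A : Matrix ι ι ℂ) : EuclideanSpace ℝ (ι × ι × Fin 2) :=
  WithLp.toLp 2 fun i => ![(A i.1 i.2.1).re, (A i.1 i.2.1).im] i.2.2

omit [Fintype ι] in
theorem realCoords_add (A B : Matrix ι ι ℂ) :
    realCoords (A + B) = realCoords A + realCoords B := by
  ext ⟨a, b, k⟩
  fin_cases k <;> simp [realCoords]

theorem inner_realCoords (A B : Matrix ι ι ℂ) :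
    ⟪realCoords A, realCoords B⟫_ℝ = (Matrix.trace (A.conjTranspose * B)).re := by
  rw [PiLp.inner_apply, Fintype.sum_prod_type]
  simp only [Fintype.sum_prod_type, Fin.sum_univ_two, Matrix.trace, Matrix.diag, Matrix.mul_apply,
    Matrix.conjTranspose_apply, Complex.re_sum]
  rw [Finset.sum_comm]
  refine Finset.sum_congr rfl fun a _ => Finset.sum_congr rfl fun b _ => ?_
  simp [realCoords]
  ring

variable {E : Type*} [NormedAddCommGroup E] [NormedSpace ℝ E]

theorem contDiffAt_realCoords {f : E → Matrix ι ι ℂ} {z : E} {n : WithTop ℕ∞}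
    (hf : ∀ a b, ContDiffAt ℝ n (fun w => f w a b) z) :
    ContDiffAt ℝ n (fun w => realCoords (f w)) z := by
  refine contDiffAt_euclidean.2 ?_
  rintro ⟨a, b, k⟩
  fin_cases k
  · exact Complex.reCLM.contDiff.contDiffAt.comp z (hf a b)
  · exact Complex.imCLM.contDiff.contDiffAt.comp z (hf a b)

theorem fderiv_realCoords {f : E → Matrix ι ι ℂ} {z : E}
    (hf : ∀ a b, DifferentiableAt ℝ (fun w => f w a b) z) (v : E) :
    DifferentiableAt ℝ (fun w => realCoords (f w)) z ∧
    fderiv ℝ (fun w => realCoords (f w)) z v =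
      realCoords (Matrix.of fun a b => fderiv ℝ (fun w => f w a b) z v) := by
  have hd : DifferentiableAt ℝ (fun w => realCoords (f w)) z := by
    refine differentiableAt_euclidean.2 ?_
    rintro ⟨a, b, k⟩
    fin_cases k
    · exact Complex.reCLM.differentiableAt.comp z (hf a b)
    · exact Complex.imCLM.differentiableAt.comp z (hf a b)
  refine ⟨hd, ?_⟩
  ext ⟨a, b, k⟩
  have h1 := (EuclideanSpace.proj (𝕜 := ℝ) (a, b, k)).hasFDerivAt.comp z hd.hasFDerivAt
  have h2 := congrArg (fun T : E →L[ℝ] ℝ => T v) h1.fderiv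
  refine (h2.symm : fderiv ℝ (fun w => realCoords (f w)) z v (a, b, k) = _).trans ?_
  fin_cases k
  · exact congrArg (fun T : E →L[ℝ] ℝ => T v)
      (Complex.reCLM.hasFDerivAt.comp z (hf a b).hasFDerivAt).fderiv
  · exact congrArg (fun T : E →L[ℝ] ℝ => T v)
      (Complex.imCLM.hasFDerivAt.comp z (hf a b).hasFDerivAt).fderiv

theorem laplacian_realCoords {f : ℂ → Matrix ι ι ℂ} {z : ℂ}
    (hf : ∀ a b, ContDiffAt ℝ ∞ (fun w => f w a b) z) :
    fderiv ℝ (fun w => fderiv ℝ (fun w => realCoords (f w)) w 1) z 1 +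
      fderiv ℝ (fun w => fderiv ℝ (fun w => realCoords (f w)) w Complex.I) z Complex.I =
    realCoords (Matrix.of fun a b => dz (dzbar fun w => f w a b) z) := by
  have hev : ∀ᶠ w in 𝓝 z, ∀ a b, DifferentiableAt ℝ (fun w => f w a b) w := by
    refine Filter.eventually_all.2 fun a => Filter.eventually_all.2 fun b => ?_
    have := ((hf a b).of_le (m := 1) (by simp)).eventually (by simp)
    exact this.mono fun w hw => hw.differentiableAt (by simp)
  have h1 : ∀ v, fderiv ℝ (fun w => fderiv ℝ (fun w => realCoords (f w)) w v) z v =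
      realCoords (Matrix.of fun a b => fderiv ℝ (fun w => fderiv ℝ (fun w => f w a b) w v) z v) := by
    intro v
    have e : (fun w => fderiv ℝ (fun w => realCoords (f w)) w v) =ᶠ[𝓝 z] fun w =>
        realCoords (Matrix.of fun a b => fderiv ℝ (fun w => f w a b) w v) :=
      hev.mono fun w hw => (fderiv_realCoords hw v).2
    rw [e.fderiv_eq, (fderiv_realCoords (f := fun w => Matrix.of fun a b =>
      fderiv ℝ (fun w => f w a b) w v) (fun a b => ?_) v).2]
    · rfl
    · have hd : DifferentiableAt ℝ (fderiv ℝ (fun w => f w a b)) z :=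
        ((hf a b).fderiv_right (m := 1) (by norm_cast)).differentiableAt (by simp)
      exact hd.clm_apply (differentiableAt_const v)
  rw [h1, h1, ← realCoords_add]
  congr 1
  ext a b
  exact (dz_dzbar (hf a b)).symm

end RealCoords

/-! ### Projections to lines and the tangent spaces of the space of projections -/

section Projection

variable {ι : Type*} [Fintype ι]

/-- The square norm of a complex vector. -/
def vecNormSq (v : ι → ℂ) : ℝ := ∑ a, Complex.normSq (v a)

theorem vecNormSq_pos {v : ι → ℂ} (hv : v ≠ 0) : 0 < vecNormSq v := by
  obtain ⟨a, ha⟩ := Function.ne_iff.1 hv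
  exact Finset.sum_pos' (fun b _ => Complex.normSq_nonneg _)
    ⟨a, Finset.mem_univ a, Complex.normSq_pos.2 ha⟩

theorem ofReal_vecNormSq (v : ι → ℂ) :
    (vecNormSq v : ℂ) = ∑ a, starRingEnd ℂ (v a) * v a := by
  simp [vecNormSq, Complex.normSq_eq_conj_mul_self]

/-- The orthogonal projection to the complex line spanned by a vector. -/
def lineProj (v : ι → ℂ) : Matrix ι ι ℂ :=
  Matrix.of fun a b => (vecNormSq v : ℂ)⁻¹ * (v a * starRingEnd ℂ (v b))

theorem lineProj_apply (v : ι → ℂ) (a b : ι) :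
    lineProj v a b = (vecNormSq v : ℂ)⁻¹ * (v a * starRingEnd ℂ (v b)) := rfl

theorem lineProj_smul {c : ℂ} (hc : c ≠ 0) (v : ι → ℂ) : lineProj (c • v) = lineProj v := by
  have h : (vecNormSq (c • v) : ℂ) = c * starRingEnd ℂ c * vecNormSq v := by
    rw [ofReal_vecNormSq, ofReal_vecNormSq, Finset.mul_sum]
    refine Finset.sum_congr rfl fun a _ => ?_
    simp
    ring
  have hc' : starRingEnd ℂ c ≠ 0 := by simpa using hc
  ext a b
  rw [lineProj_apply, lineProj_apply, h]
  simp only [Pi.smul_apply, smul_eq_mul, map_mul, mul_inv]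
  field_simp

theorem lineProj_conjTranspose (v : ι → ℂ) : (lineProj v).conjTranspose = lineProj v := by
  ext a b
  rw [Matrix.conjTranspose_apply, lineProj_apply, lineProj_apply]
  simp [mul_comm]

theorem sum_lineProj_mul (v u : ι → ℂ) (a : ι) :
    ∑ b, lineProj v a b * u b =
      (vecNormSq v : ℂ)⁻¹ * v a * ∑ b, starRingEnd ℂ (v b) * u b := by
  rw [Finset.mul_sum]
  exact Finset.sum_congr rfl fun b _ => by rw [lineProj_apply]; ring

theorem sum_lineProj_mul_self {v : ι → ℂ} (hv : v ≠ 0) (a : ι) :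
    ∑ b, lineProj v a b * v b = v a := by
  have h : (vecNormSq v : ℂ) ≠ 0 := by exact_mod_cast (vecNormSq_pos hv).ne'
  rw [sum_lineProj_mul, ← ofReal_vecNormSq]
  field_simp

theorem lineProj_mul_self {v : ι → ℂ} (hv : v ≠ 0) : lineProj v * lineProj v = lineProj v := by
  ext a b
  rw [Matrix.mul_apply]
  have : ∀ k, lineProj v a k * lineProj v k b =
      lineProj v a k * v k * ((vecNormSq v : ℂ)⁻¹ * starRingEnd ℂ (v b)) := fun k => by
    rw [lineProj_apply v k b]; ring
  simp only [this]
  rw [← Finset.sum_mul, sum_lineProj_mul_self hv, lineProj_apply]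
  ring

/-- A Hermitian matrix whose block from the range to the kernel of a projection vanishes is
orthogonal to the tangent vectors of the space of projections. -/
theorem trace_mul_eq_zero {p L ξ : Matrix ι ι ℂ} (hp : p.conjTranspose = p) (hpp : p * p = p)
    (hL : L.conjTranspose = L) (hLp : p * L * p = L * p) (hξ : ξ = ξ * p + p * ξ) :
    Matrix.trace (L * ξ) = 0 := by
  have hpL : p * L * p = p * L := by
    have := congrArg Matrix.conjTranspose hLp
    simpa [Matrix.conjTranspose_mul, hp, hL, Matrix.mul_assoc] using this
  -- Sandwiching ξ = ξp + pξ between two copies of p gives x = x + x for x = pξp.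
  have hpξp : p * ξ * p = 0 := by
    have h1 : p * ξ * p = p * ξ * p + p * ξ * p := by
      conv_lhs => rw [hξ]
      rw [Matrix.mul_add, Matrix.add_mul, ← Matrix.mul_assoc p p, hpp, Matrix.mul_assoc p (ξ * p) p,
        Matrix.mul_assoc ξ p p, hpp, ← Matrix.mul_assoc]
    simpa using h1
  have hkey : Matrix.trace (p * L * p * ξ) = 0 := by
    have : p * L * p * ξ = (p * L) * (p * (p * ξ)) := by
      rw [← Matrix.mul_assoc p p ξ, hpp, Matrix.mul_assoc (p * L)]
    have h2 : p * L * p * ξ = p * (L * p * (p * ξ)) := by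
      rw [← Matrix.mul_assoc (L * p), Matrix.mul_assoc L p p, hpp]
      simp only [Matrix.mul_assoc]
    rw [h2, Matrix.trace_mul_comm]
    have h3 : L * p * (p * ξ) * p = L * p * (p * ξ * p) := by simp only [Matrix.mul_assoc]
    rw [h3, hpξp, Matrix.mul_zero, Matrix.trace_zero]
  conv_lhs => rw [hξ]
  rw [Matrix.mul_add, Matrix.trace_add]
  have e1 : Matrix.trace (L * (ξ * p)) = 0 := by
    rw [← Matrix.mul_assoc, Matrix.trace_mul_comm, ← Matrix.mul_assoc, ← hpL, hkey]
  have e2 : Matrix.trace (L * (p * ξ)) = 0 := by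
    rw [← Matrix.mul_assoc, ← hLp, hkey]
  rw [e1, e2, add_zero]

end Projection

/-! ### A first-order system whose solutions span harmonic lines -/

section HarmonicSystem

variable {ι : Type*} [Fintype ι]

/-- The entrywise operator `∂_x - i ∂_y` on matrix valued functions. -/
def matDz (f : ℂ → Matrix ι ι ℂ) (z : ℂ) : Matrix ι ι ℂ := Matrix.of fun a b => dz (fun w => f w a b) z

/-- The entrywise operator `∂_x + i ∂_y` on matrix valued functions. -/
def matDzbar (f : ℂ → Matrix ι ι ℂ) (z : ℂ) : Matrix ι ι ℂ :=
  Matrix.of fun a b => dzbar (fun w => f w a b) z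

theorem matDz_mul {f h : ℂ → Matrix ι ι ℂ} {z : ℂ}
    (hf : ∀ a b, DifferentiableAt ℝ (fun w => f w a b) z)
    (hh : ∀ a b, DifferentiableAt ℝ (fun w => h w a b) z) :
    matDz (fun w => f w * h w) z = matDz f z * h z + f z * matDz h z := by
  ext a b
  rw [Matrix.add_apply, Matrix.mul_apply, Matrix.mul_apply, ← Finset.sum_add_distrib]
  simp only [matDz, Matrix.of_apply, Matrix.mul_apply]
  rw [dz_sum fun k => (hf a k).fun_mul (hh k b)]
  exact Finset.sum_congr rfl fun k _ => dz_mul (hf a k) (hh k b)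

theorem matDzbar_mul {f h : ℂ → Matrix ι ι ℂ} {z : ℂ}
    (hf : ∀ a b, DifferentiableAt ℝ (fun w => f w a b) z)
    (hh : ∀ a b, DifferentiableAt ℝ (fun w => h w a b) z) :
    matDzbar (fun w => f w * h w) z = matDzbar f z * h z + f z * matDzbar h z := by
  ext a b
  rw [Matrix.add_apply, Matrix.mul_apply, Matrix.mul_apply, ← Finset.sum_add_distrib]
  simp only [matDzbar, Matrix.of_apply, Matrix.mul_apply]
  rw [dzbar_sum fun k => (hf a k).fun_mul (hh k b)]
  exact Finset.sum_congr rfl fun k _ => dzbar_mul (hf a k) (hh k b)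

omit [Fintype ι] in
theorem matDz_congr {f h : ℂ → Matrix ι ι ℂ} {z : ℂ} (hfh : f =ᶠ[𝓝 z] h) :
    matDz f z = matDz h z := by
  ext a b
  exact dz_congr (hfh.mono fun w hw => congrFun (congrFun hw a) b)

theorem contDiffAt_lineProj {E : Type*} [NormedAddCommGroup E] [NormedSpace ℝ E]
    {F : E → ι → ℂ} {z : E} {n : WithTop ℕ∞}
    (hF : ∀ a, ContDiffAt ℝ n (fun w => F w a) z) (h0 : F z ≠ 0) (a b : ι) :
    ContDiffAt ℝ n (fun w => lineProj (F w) a b) z := by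
  have hN : ContDiffAt ℝ n (fun w => (vecNormSq (F w) : ℂ)) z := by
    simp only [ofReal_vecNormSq]
    exact ContDiffAt.sum fun a _ =>
      (Complex.conjCLE.contDiff.contDiffAt.comp z (hF a)).mul (hF a)
  refine (hN.inv ?_).mul ((hF a).mul (Complex.conjCLE.contDiff.contDiffAt.comp z (hF b)))
  exact_mod_cast (vecNormSq_pos h0).ne'

/-- If `∂̄F = c |F|² G` and `∂G = -c̄ |F|² F` with `G` orthogonal to `F` and `c` antiholomorphic,
then the line spanned by `F` is a harmonic map. -/
theorem inner_laplacian_lineProj_eq_zero {U : Set ℂ} (hU : IsOpen U) {F G : ℂ → ι → ℂ} {c : ℂ → ℂ}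
    (hF : ∀ z ∈ U, ∀ a, ContDiffAt ℝ ∞ (fun w => F w a) z)
    (hG : ∀ z ∈ U, ∀ a, ContDiffAt ℝ ∞ (fun w => G w a) z)
    (hc : ∀ z ∈ U, DifferentiableAt ℝ c z) (hF0 : ∀ z ∈ U, F z ≠ 0)
    (hFG : ∀ z ∈ U, ∑ a, starRingEnd ℂ (F z a) * G z a = 0)
    (hdF : ∀ z ∈ U, ∀ a, dzbar (fun w => F w a) z = c z * vecNormSq (F z) * G z a)
    (hdG : ∀ z ∈ U, ∀ a, dz (fun w => G w a) z =
      -(starRingEnd ℂ (c z) * vecNormSq (F z) * F z a))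
    (hdc : ∀ z ∈ U, dz c z = 0) {z : ℂ} (hz : z ∈ U) {ξ : Matrix ι ι ℂ}
    (hξ : ξ = ξ * lineProj (F z) + lineProj (F z) * ξ) :
    ⟪realCoords (Matrix.of fun a b => dz (dzbar fun w => lineProj (F w) a b) z),
      realCoords ξ⟫_ℝ = 0 := by
  set p : ℂ → Matrix ι ι ℂ := fun w => lineProj (F w) with hp
  have hps : ∀ w ∈ U, ∀ a b, ContDiffAt ℝ ∞ (fun w => p w a b) w := fun w hw a b =>
    contDiffAt_lineProj (hF w hw) (hF0 w hw) a b
  have hpd : ∀ w ∈ U, ∀ a b, DifferentiableAt ℝ (fun w => p w a b) w := fun w hw a b =>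
    (hps w hw a b).differentiableAt (by simp)
  have hFd : ∀ w ∈ U, ∀ a, DifferentiableAt ℝ (fun w => F w a) w := fun w hw a =>
    (hF w hw a).differentiableAt (by simp)
  have hGd : ∀ w ∈ U, ∀ a, DifferentiableAt ℝ (fun w => G w a) w := fun w hw a =>
    (hG w hw a).differentiableAt (by simp)
  have hpp : ∀ w ∈ U, p w * p w = p w := fun w hw => lineProj_mul_self (hF0 w hw)
  have hUz : ∀ w ∈ U, ∀ᶠ y in 𝓝 w, y ∈ U := fun w hw => hU.mem_nhds hw
  -- the `(0,1)` part of the differential on the line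
  have hB : ∀ w ∈ U, matDzbar p w * p w =
      Matrix.of fun a b => c w * (G w a * starRingEnd ℂ (F w b)) := by
    intro w hw
    -- Differentiate pF = F: the term p ∂̄F drops out because ∂̄F is a multiple of G, which is
    -- orthogonal to F.
    have h1 : ∀ a, ∑ k, dzbar (fun y => p y a k) w * F w k = c w * vecNormSq (F w) * G w a := by
      intro a
      have e : (fun y => ∑ k, p y a k * F y k) =ᶠ[𝓝 w] fun y => F y a :=
        (hUz w hw).mono fun y hy => sum_lineProj_mul_self (hF0 y hy) a
      have h2 := dzbar_congr e
      rw [dzbar_sum fun k => (hpd w hw a k).fun_mul (hFd w hw k)] at h2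
      simp only [dzbar_mul (hpd w hw a _) (hFd w hw _), Finset.sum_add_distrib, hdF w hw] at h2
      have h3 : ∑ k, p w a k * (c w * vecNormSq (F w) * G w k) = 0 := by
        have : ∀ k, p w a k * (c w * vecNormSq (F w) * G w k) =
            c w * vecNormSq (F w) * (p w a k * G w k) := fun k => by ring
        simp only [this]
        rw [← Finset.mul_sum, sum_lineProj_mul, hFG w hw]
        simp
      rwa [h3, add_zero] at h2
    ext a b
    have hN : (vecNormSq (F w) : ℂ) ≠ 0 := by exact_mod_cast (vecNormSq_pos (hF0 w hw)).ne'
    have h4 : ∀ k, matDzbar p w a k * p w k b =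
        dzbar (fun y => p y a k) w * F w k *
          ((vecNormSq (F w) : ℂ)⁻¹ * starRingEnd ℂ (F w b)) := fun k => by
      simp only [hp, lineProj_apply, matDzbar, Matrix.of_apply]
      ring
    rw [Matrix.mul_apply]
    simp only [h4]
    rw [← Finset.sum_mul, h1, Matrix.of_apply]
    field_simp
  set L : Matrix ι ι ℂ := matDz (matDzbar p) z with hLdef
  have hbar : ∀ a b, DifferentiableAt ℝ (fun w => matDzbar p w a b) z := fun a b =>
    differentiableAt_dzbar (hps z hz a b)
  -- Apply ∂ to (∂̄p)p = c G F*. Since ∂c = 0, only ∂G and ∂(F*) = (∂̄F)* contribute, giving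
  -- -|c|²|F|² FF* and |c|²|F|² GG*.
  have hLp : L * p z + matDzbar p z * matDz p z =
      Matrix.of fun a b => Complex.normSq (c z) * vecNormSq (F z) *
        (G z a * starRingEnd ℂ (G z b) - F z a * starRingEnd ℂ (F z b)) := by
    rw [← matDz_mul hbar (hpd z hz), matDz_congr ((hUz z hz).mono hB)]
    ext a b
    have hcF : DifferentiableAt ℝ (fun w => starRingEnd ℂ (F w b)) z :=
      Complex.conjCLE.differentiableAt.comp z (hFd z hz b)
    simp only [matDz, Matrix.of_apply]
    rw [dz_mul (hc z hz) ((hGd z hz a).fun_mul hcF), dz_mul (hGd z hz a) hcF, dz_conj (hFd z hz b),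
      hdc z hz, hdG z hz, hdF z hz, Complex.normSq_eq_conj_mul_self]
    simp only [map_mul, Complex.conj_ofReal]
    ring
  have hpz := hpp z hz
  have hdp : matDz p z = matDz p z * p z + p z * matDz p z := by
    rw [← matDz_mul (hpd z hz) (hpd z hz)]
    exact (matDz_congr ((hUz z hz).mono hpp)).symm
  have hdbp : matDzbar p z = matDzbar p z * p z + p z * matDzbar p z := by
    rw [← matDzbar_mul (hpd z hz) (hpd z hz)]
    ext a b
    exact (dzbar_congr ((hUz z hz).mono fun w hw => congrFun (congrFun (hpp w hw) a) b)).symm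
  -- Multiplication by p on the right kills GG* and leaves -|c|²|F|⁴ p, whose range is the line. The
  -- subtracted term ∂̄p ∂p p also has range in the line: ∂p sends the line to its complement and
  -- ∂̄p sends the complement back. So the Laplacian preserves the line.
  have hblock : p z * L * p z = L * p z := by
    have hS : L * p z = (L * p z + matDzbar p z * matDz p z) * p z -
        matDzbar p z * matDz p z * p z := by
      rw [Matrix.add_mul, Matrix.mul_assoc L, hpz]
      abel
    have h1 : (L * p z + matDzbar p z * matDz p z) * p z =
        p z * ((L * p z + matDzbar p z * matDz p z) * p z) := by
      have hN : (vecNormSq (F z) : ℂ) ≠ 0 := by exact_mod_cast (vecNormSq_pos (hF0 z hz)).ne'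
      have h2 : (L * p z + matDzbar p z * matDz p z) * p z =
          (-(Complex.normSq (c z) * vecNormSq (F z) ^ 2 : ℂ)) • p z := by
        rw [hLp]
        ext a b
        have hGF : ∑ k, starRingEnd ℂ (G z k) * F z k = 0 := by
          have := congrArg (starRingEnd ℂ) (hFG z hz)
          rw [map_sum, map_zero] at this
          rw [← this]
          exact Finset.sum_congr rfl fun k _ => by simp [mul_comm]
        rw [Matrix.mul_apply, Matrix.smul_apply]
        have h4 : ∀ k, (Matrix.of fun a b => Complex.normSq (c z) * vecNormSq (F z) *
            (G z a * starRingEnd ℂ (G z b) - F z a * starRingEnd ℂ (F z b))) a k * p z k b =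
            Complex.normSq (c z) * (starRingEnd ℂ (F z b)) *
              (G z a * (starRingEnd ℂ (G z k) * F z k) -
                F z a * (starRingEnd ℂ (F z k) * F z k)) := fun k => by
          simp only [hp, lineProj_apply, Matrix.of_apply]
          field_simp
        simp only [h4]
        rw [← Finset.mul_sum, Finset.sum_sub_distrib, ← Finset.mul_sum, ← Finset.mul_sum, hGF,
          ← ofReal_vecNormSq]
        simp only [hp, lineProj_apply, smul_eq_mul]
        field_simp
        ring
      rw [h2, Matrix.mul_smul, hpz]
    have h2 : matDzbar p z * matDz p z * p z = p z * (matDzbar p z * matDz p z * p z) := by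
      have e1 : p z * matDz p z * p z = 0 := by
        have h : p z * matDz p z * p z = p z * matDz p z * p z + p z * matDz p z * p z := by
          conv_lhs => rw [hdp]
          rw [Matrix.mul_add, Matrix.add_mul, ← Matrix.mul_assoc (p z) (p z), hpz,
            Matrix.mul_assoc (p z) (matDz p z * p z) (p z), Matrix.mul_assoc (matDz p z) (p z) (p z),
            hpz, ← Matrix.mul_assoc]
        simpa using h
      conv_lhs => rw [hdbp]
      rw [Matrix.add_mul, Matrix.add_mul]
      have e2 : matDzbar p z * p z * matDz p z * p z = 0 := by
        rw [Matrix.mul_assoc, Matrix.mul_assoc, ← Matrix.mul_assoc (p z), e1, Matrix.mul_zero]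
      rw [e2, zero_add]
      simp only [Matrix.mul_assoc]
    have h3 : p z * (L * p z) = L * p z := by
      rw [hS, Matrix.mul_sub, ← h1, ← h2]
    rw [Matrix.mul_assoc, h3]
  -- The Laplacian is a real operator and p is Hermitian at every point.
  have hherm : L.conjTranspose = L := by
    have key : ∀ a b, ∀ w ∈ U, ∀ v, fderiv ℝ (fun w => p w b a) w v =
        starRingEnd ℂ (fderiv ℝ (fun w => p w a b) w v) := by
      intro a b w hw v
      rw [← fderiv_conj (hpd w hw a b)]
      congr 2
      funext y
      have := congrFun (congrFun (lineProj_conjTranspose (F y)) b) a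
      exact this.symm
    ext a b
    rw [Matrix.conjTranspose_apply]
    simp only [hLdef, matDz, matDzbar, Matrix.of_apply]
    rw [dz_dzbar (hps z hz b a), dz_dzbar (hps z hz a b), star_add]
    have e : ∀ v, fderiv ℝ (fun w => fderiv ℝ (fun w => p w b a) w v) z v =
        starRingEnd ℂ (fderiv ℝ (fun w => fderiv ℝ (fun w => p w a b) w v) z v) := by
      intro v
      have hd : DifferentiableAt ℝ (fun w => fderiv ℝ (fun w => p w a b) w v) z :=
        (((hps z hz a b).fderiv_right (m := 1) (by norm_cast)).differentiableAt
          (by simp)).clm_apply (differentiableAt_const v)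
      have e1 : (fun w => fderiv ℝ (fun w => p w b a) w v) =ᶠ[𝓝 z] fun w =>
          starRingEnd ℂ (fderiv ℝ (fun w => p w a b) w v) :=
        (hUz z hz).mono fun w hw => key a b w hw v
      rw [e1.fderiv_eq, fderiv_conj hd]
    rw [e, e]
    simp
  rw [inner_realCoords]
  have := trace_mul_eq_zero (lineProj_conjTranspose (F z)) hpz hherm hblock hξ
  change (Matrix.trace (L.conjTranspose * ξ)).re = 0
  rw [hherm, this, Complex.zero_re]

end HarmonicSystem

/-! ### Derivative of the projection to a moving line -/

section LineProjDeriv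

variable {ι : Type*} [Fintype ι]

/-- The component of `u` orthogonal to `v`. -/
def orthPart (v u : ι → ℂ) : ι → ℂ := fun a =>
  u a - (vecNormSq v : ℂ)⁻¹ * (∑ b, starRingEnd ℂ (v b) * u b) * v a

theorem orthPart_eq_self {v u : ι → ℂ} (h : ∑ b, starRingEnd ℂ (v b) * u b = 0) :
    orthPart v u = u := by
  funext a
  simp [orthPart, h]

theorem sum_conj_mul_orthPart {v : ι → ℂ} (hv : v ≠ 0) (u : ι → ℂ) :
    ∑ a, starRingEnd ℂ (v a) * orthPart v u a = 0 := by
  have hN : (vecNormSq v : ℂ) ≠ 0 := by exact_mod_cast (vecNormSq_pos hv).ne'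
  have h : ∀ a, starRingEnd ℂ (v a) * orthPart v u a = starRingEnd ℂ (v a) * u a -
      (vecNormSq v : ℂ)⁻¹ * (∑ b, starRingEnd ℂ (v b) * u b) * (starRingEnd ℂ (v a) * v a) :=
    fun a => by rw [orthPart]; ring
  simp only [h]
  rw [Finset.sum_sub_distrib, ← Finset.mul_sum, ← ofReal_vecNormSq]
  field_simp
  ring

/-- The tangent vector of the space of projections corresponding to `u`. -/
def lineTangent (v u : ι → ℂ) : Matrix ι ι ℂ := Matrix.of fun a b =>
  (vecNormSq v : ℂ)⁻¹ * (u a * starRingEnd ℂ (v b) + v a * starRingEnd ℂ (u b))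

/-- The mixed products vanish because u and u' are orthogonal to v, and the two remaining terms are
complex conjugates of each other. The resulting factor 2/|v|², against 4/|v|² in the metric of
projective space, is the source of the factor 2 between the two metrics. -/
theorem inner_lineTangent {v u u' : ι → ℂ} (hv : v ≠ 0)
    (hu : ∑ a, starRingEnd ℂ (v a) * u a = 0) (hu' : ∑ a, starRingEnd ℂ (v a) * u' a = 0) :
    ⟪realCoords (lineTangent v u), realCoords (lineTangent v u')⟫_ℝ =
      2 / vecNormSq v * (∑ a, starRingEnd ℂ (u a) * u' a).re := by
  have hNr := (vecNormSq_pos hv).ne'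
  have hN : (vecNormSq v : ℂ) ≠ 0 := by exact_mod_cast hNr
  have hu1 : ∑ a, starRingEnd ℂ (u a) * v a = 0 := by
    have := congrArg (starRingEnd ℂ) hu
    rw [map_sum, map_zero] at this
    rw [← this]
    exact Finset.sum_congr rfl fun k _ => by simp [mul_comm]
  have hexp : ∀ a b, starRingEnd ℂ (lineTangent v u b a) * lineTangent v u' b a =
      (vecNormSq v : ℂ)⁻¹ ^ 2 * ((starRingEnd ℂ (v a) * v a) * (starRingEnd ℂ (u b) * u' b) +
        (starRingEnd ℂ (u' a) * v a) * (starRingEnd ℂ (u b) * v b) +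
        (starRingEnd ℂ (v a) * u a) * (starRingEnd ℂ (v b) * u' b) +
        (starRingEnd ℂ (u' a) * u a) * (starRingEnd ℂ (v b) * v b)) := fun a b => by
    simp only [lineTangent, Matrix.of_apply, map_mul, map_add, map_inv₀, Complex.conj_ofReal,
      Complex.conj_conj]
    ring
  have hc : ∑ a, starRingEnd ℂ (u' a) * u a = starRingEnd ℂ (∑ a, starRingEnd ℂ (u a) * u' a) := by
    rw [map_sum]
    exact Finset.sum_congr rfl fun k _ => by simp [mul_comm]
  rw [inner_realCoords]
  simp only [Matrix.trace, Matrix.diag, Matrix.mul_apply, Matrix.conjTranspose_apply,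
    RCLike.star_def, hexp, ← Finset.mul_sum, Finset.sum_add_distrib]
  simp only [← Finset.sum_mul, hu1, hu', mul_zero, add_zero, Finset.sum_const_zero,
    ← ofReal_vecNormSq, hc]
  set s := ∑ a, starRingEnd ℂ (u a) * u' a
  have e : (vecNormSq v : ℂ)⁻¹ ^ 2 * (vecNormSq v * s + starRingEnd ℂ s * vecNormSq v) =
      ((vecNormSq v)⁻¹ : ℝ) * (s + starRingEnd ℂ s) := by
    push_cast
    field_simp
  rw [e, Complex.re_ofReal_mul, Complex.add_re, Complex.conj_re]
  ring

variable {E : Type*} [NormedAddCommGroup E] [NormedSpace ℝ E]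

/-- The component of dF along F only moves the vector inside its line; the derivative of 1/|F|²
cancels exactly this component. -/
theorem fderiv_lineProj {F : E → ι → ℂ} {z : E} (hF : ∀ a, DifferentiableAt ℝ (fun w => F w a) z)
    (h0 : F z ≠ 0) (X : E) :
    (∀ a b, DifferentiableAt ℝ (fun w => lineProj (F w) a b) z) ∧
    (Matrix.of fun a b => fderiv ℝ (fun w => lineProj (F w) a b) z X) =
      lineTangent (F z) (orthPart (F z) fun a => fderiv ℝ (fun w => F w a) z X) := by
  have hNr := (vecNormSq_pos h0).ne'
  have hN0 : (vecNormSq (F z) : ℂ) ≠ 0 := by exact_mod_cast hNr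
  have hFc : ∀ a, DifferentiableAt ℝ (fun w => starRingEnd ℂ (F w a)) z := fun a =>
    Complex.conjCLE.differentiableAt.comp z (hF a)
  have hNd : DifferentiableAt ℝ (fun w => (vecNormSq (F w) : ℂ)) z := by
    simp only [ofReal_vecNormSq]
    exact DifferentiableAt.fun_sum fun a _ => (hFc a).fun_mul (hF a)
  have hN' : fderiv ℝ (fun w => (vecNormSq (F w) : ℂ)) z X =
      ∑ a, starRingEnd ℂ (F z a) * fderiv ℝ (fun w => F w a) z X +
      starRingEnd ℂ (∑ a, starRingEnd ℂ (F z a) * fderiv ℝ (fun w => F w a) z X) := by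
    simp only [ofReal_vecNormSq]
    rw [fderiv_fun_sum fun a _ => (hFc a).fun_mul (hF a), sum_apply, map_sum,
      ← Finset.sum_add_distrib]
    refine Finset.sum_congr rfl fun a _ => ?_
    rw [fderiv_fun_mul (hFc a) (hF a)]
    simp only [add_apply, smul_apply, smul_eq_mul, fderiv_conj (hF a), map_mul, Complex.conj_conj]
  refine ⟨fun a b => (hNd.inv hN0).fun_mul ((hF a).fun_mul (hFc b)), ?_⟩
  ext a b
  have hinv : fderiv ℝ (fun w => (vecNormSq (F w) : ℂ)⁻¹) z X =
      -(fderiv ℝ (fun w => (vecNormSq (F w) : ℂ)) z X) * ((vecNormSq (F z) : ℂ) ^ 2)⁻¹ := by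
    have h := ((hasDerivAt_inv hN0).comp_hasFDerivAt_of_eq z
      (hNd.hasFDerivAt) rfl).fderiv
    have := congrArg (fun T : E →L[ℝ] ℂ => T X) h
    refine this.trans ?_
    simp [mul_comm]
  simp only [Matrix.of_apply, lineProj_apply, lineTangent, orthPart]
  rw [fderiv_fun_mul (hNd.fun_inv hN0) ((hF a).fun_mul (hFc b)), fderiv_fun_mul (hF a) (hFc b)]
  simp only [add_apply, smul_apply, smul_eq_mul, fderiv_conj (hF b), hinv, hN', map_sub, map_mul,
    map_inv₀, Complex.conj_ofReal]
  field_simp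
  ring

end LineProjDeriv

/-! ### Maps to projective space through the embedding by projections -/

section ProjectiveMaps

variable {V : Type*} [NormedAddCommGroup V] [InnerProductSpace ℂ V]

theorem affineLift_self (y : ℙ ℂ V) : affineLift y y = y.rep := by
  have h : (‖y.rep‖ : ℂ) ^ 2 ≠ 0 := by
    simpa using y.rep_nonzero
  rw [affineLift, inner_self_eq_norm_sq_to_K]
  exact (congrArg (· • y.rep) (div_self h)).trans (one_smul _ _)

theorem inner_ne_zero_of_affineLift {y x : ℙ ℂ V} (h : affineLift y x ≠ 0) :
    ⟪y.rep, x.rep⟫_ℂ ≠ 0 := by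
  intro h0
  exact h (by rw [affineLift, h0, div_zero, zero_smul])

theorem inner_affineLift {y x : ℙ ℂ V} (h : affineLift y x ≠ 0) :
    ⟪y.rep, affineLift y x⟫_ℂ = (‖y.rep‖ : ℂ) ^ 2 := by
  rw [affineLift, inner_smul_right, div_mul_cancel₀ _ (inner_ne_zero_of_affineLift h)]

theorem affineLift_mk (y : ℙ ℂ V) {v : V} (hv : v ≠ 0) :
    affineLift y (Projectivization.mk ℂ v hv) = ((‖y.rep‖ : ℂ) ^ 2 / ⟪y.rep, v⟫_ℂ) • v := by
  obtain ⟨c, hc⟩ := Projectivization.exists_smul_eq_mk_rep ℂ v hv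
  have hc0 : (c : ℂ) ≠ 0 := c.ne_zero
  have hc' : (Projectivization.mk ℂ v hv).rep = (c : ℂ) • v := hc.symm
  rw [affineLift, hc', inner_smul_right, smul_smul]
  congr 1
  -- On the hyperplane orthogonal to the centre of the chart both sides are 0, since division by
  -- zero gives zero.
  by_cases h : ⟪y.rep, v⟫_ℂ = 0
  · simp [h]
  · field_simp

theorem inner_rep_ne_zero {v : V} (hv : v ≠ 0) :
    ⟪(Projectivization.mk ℂ v hv).rep, v⟫_ℂ ≠ 0 := by
  obtain ⟨c, hc⟩ := Projectivization.exists_smul_eq_mk_rep ℂ v hv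
  have hc' : (Projectivization.mk ℂ v hv).rep = (c : ℂ) • v := hc.symm
  rw [hc', inner_smul_left]
  exact mul_ne_zero (by simp) (inner_self_ne_zero.2 hv)

variable {ι : Type*} [Fintype ι] (b : OrthonormalBasis ι ℂ V)

/-- The coordinates of a vector in an orthonormal basis. -/
def basisCoords (v : V) : ι → ℂ := fun a => ⟪b a, v⟫_ℂ

theorem basisCoords_smul (c : ℂ) (v : V) : basisCoords b (c • v) = c • basisCoords b v := by
  funext a
  simp [basisCoords]

theorem sum_basisCoords (v u : V) :
    ∑ a, starRingEnd ℂ (basisCoords b v a) * basisCoords b u a = ⟪v, u⟫_ℂ := by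
  rw [← b.sum_inner_mul_inner v u]
  exact Finset.sum_congr rfl fun a _ => by rw [basisCoords, basisCoords, inner_conj_symm]

theorem vecNormSq_basisCoords (v : V) : vecNormSq (basisCoords b v) = ‖v‖ ^ 2 := by
  have h := ofReal_vecNormSq (basisCoords b v)
  rw [sum_basisCoords, inner_self_eq_norm_sq_to_K] at h
  exact Complex.ofReal_injective (h.trans (by push_cast; rfl))

theorem basisCoords_ne_zero {v : V} (hv : v ≠ 0) : basisCoords b v ≠ 0 := by
  intro h
  have := vecNormSq_basisCoords b v
  rw [h] at this
  have h0 : ‖v‖ ^ 2 = 0 := this.symm.trans (by simp [vecNormSq])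
  exact hv (norm_eq_zero.1 (pow_eq_zero_iff two_ne_zero |>.1 h0))

/-- The embedding of projective space in the space of matrices which sends a line to the orthogonal
projection to it. -/
def projEmbed (L : ℙ ℂ V) : EuclideanSpace ℝ (ι × ι × Fin 2) :=
  realCoords (lineProj (basisCoords b L.rep))

theorem projEmbed_mk {v : V} (hv : v ≠ 0) :
    projEmbed b (Projectivization.mk ℂ v hv) = realCoords (lineProj (basisCoords b v)) := by
  obtain ⟨c, hc⟩ := Projectivization.exists_smul_eq_mk_rep ℂ v hv
  have hc' : (Projectivization.mk ℂ v hv).rep = (c : ℂ) • v := hc.symm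
  rw [projEmbed, hc', basisCoords_smul, lineProj_smul c.ne_zero]

theorem projEmbed_affineLift {y x : ℙ ℂ V} (h : affineLift y x ≠ 0) :
    projEmbed b x = realCoords (lineProj (basisCoords b (affineLift y x))) := by
  have h0 : ((‖y.rep‖ : ℂ) ^ 2 / ⟪y.rep, x.rep⟫_ℂ) ≠ 0 := by
    intro h0
    exact h (by rw [affineLift, h0, zero_smul])
  rw [affineLift, basisCoords_smul, lineProj_smul h0, projEmbed]

theorem contDiff_basisCoords (a : ι) {n : WithTop ℕ∞} :
    ContDiff ℝ n (fun v => basisCoords b v a) :=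
  ((innerSL ℂ (b a)).restrictScalars ℝ).contDiff

theorem contDiffAt_projEmbed {v : V} (hv : v ≠ 0) :
    ContDiffAt ℝ ∞ (fun v => realCoords (lineProj (basisCoords b v))) v :=
  contDiffAt_realCoords fun i j => contDiffAt_lineProj (F := basisCoords b)
    (fun a => (contDiff_basisCoords b a).contDiffAt) (basisCoords_ne_zero b hv) i j

/-- Smoothness into projective space is tested in an affine chart that changes with the point. The
embedding turns it into smoothness of one globally defined map to a Euclidean space, where the
calculus of variations is done. -/
theorem contMDiff_projEmbed {E H N : Type*} [NormedAddCommGroup E] [NormedSpace ℝ E]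
    [TopologicalSpace H] {I : ModelWithCorners ℝ E H} [TopologicalSpace N] [ChartedSpace H N]
    {Ψ : N → ℙ ℂ V} (hΨ : IsSmoothMap I Ψ) :
    ContMDiff I 𝓘(ℝ, EuclideanSpace ℝ (ι × ι × Fin 2)) ∞ (fun q => projEmbed b (Ψ q)) := by
  intro p
  have hp := hΨ p
  have h0 : affineLift (Ψ p) (Ψ p) ≠ 0 := by
    rw [affineLift_self]; exact (Ψ p).rep_nonzero
  have hev : ∀ᶠ q in 𝓝 p, affineLift (Ψ p) (Ψ q) ≠ 0 := hp.continuousAt.eventually_ne h0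
  have h1 := ContMDiffAt.comp (f := fun q => affineLift (Ψ p) (Ψ q)) p
    (contDiffAt_projEmbed b h0).contMDiffAt hp
  exact h1.congr_of_eventuallyEq (hev.mono fun q hq => projEmbed_affineLift b hq)

variable {M : Type*} [TopologicalSpace M] [ChartedSpace ℂ M]

/-- The differential of the projection to a moving line, in terms of a moving vector on it. -/
theorem realDiff_projEmbed {Ψ : M → ℙ ℂ V} {p : M}
    (hdiff : MDifferentiableAt 𝓘(ℝ, ℂ) 𝓘(ℝ, EuclideanSpace ℝ (ι × ι × Fin 2))
      (fun q => projEmbed b (Ψ q)) p) {F : ℂ → ι → ℂ}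
    (hF : ∀ a, DifferentiableAt ℝ (fun w => F w a) (chartAt ℂ p p)) (h0 : F (chartAt ℂ p p) ≠ 0)
    (hFΨ : ∀ᶠ w in 𝓝 (chartAt ℂ p p), projEmbed b (Ψ ((chartAt ℂ p).symm w)) =
      realCoords (lineProj (F w))) (X : ℂ) :
    realDiff (fun q => projEmbed b (Ψ q)) p X =
      realCoords (lineTangent (F (chartAt ℂ p p)) (orthPart (F (chartAt ℂ p p))
        fun a => fderiv ℝ (fun w => F w a) (chartAt ℂ p p) X)) := by
  have h1 := fderiv_lineProj hF h0 X
  rw [realDiff_eq hdiff, Filter.EventuallyEq.fderiv_eq hFΨ, (fderiv_realCoords h1.1 X).2, h1.2]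

theorem contDiffAt_chart_of_contMDiffAt {W : Type*} [NormedAddCommGroup W] [NormedSpace ℝ W]
    [IsManifold 𝓘(ℂ) ω M] {f : M → W} {p : M} (hf : ContMDiffAt 𝓘(ℝ, ℂ) 𝓘(ℝ, W) ∞ f p) :
    ContDiffAt ℝ ∞ (fun w => f ((chartAt ℂ p).symm w)) (chartAt ℂ p p) := by
  have hz : chartAt ℂ p p ∈ (chartAt ℂ p).target :=
    (chartAt ℂ p).map_source (mem_chart_source ℂ p)
  have h1 := (contMDiffOn_chart_symm_real p).contMDiffAt ((chartAt ℂ p).open_target.mem_nhds hz)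
  have hs := (chartAt ℂ p).left_inv (mem_chart_source ℂ p)
  exact (ContMDiffAt.comp_of_eq hf h1 hs).contDiffAt

variable [IsManifold 𝓘(ℂ) ω M]

omit [IsManifold 𝓘(ℂ) ω M] in
theorem diff_eq_fderiv {Ψ : M → ℙ ℂ V} {p : M}
    (hΨ : MDifferentiableAt 𝓘(ℝ, ℂ) 𝓘(ℝ, V) (fun q => affineLift (Ψ p) (Ψ q)) p) (X : ℂ) :
    (diff Ψ p X : V) =
      fderiv ℝ (fun w => affineLift (Ψ p) (Ψ ((chartAt ℂ p).symm w))) (chartAt ℂ p p) X :=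
  mfderiv_eq_fderiv_chart hΨ X

/-- The affine lift has derivative orthogonal to the line at the centre of the chart, so no
orthogonal part has to be taken, and both sides are inner products of the derivatives of one lift.
-/
theorem pullbackMetric_eq {Ψ : M → ℙ ℂ V} {p : M}
    (hΨ : ContMDiffAt 𝓘(ℝ, ℂ) 𝓘(ℝ, V) ∞ (fun q => affineLift (Ψ p) (Ψ q)) p)
    (hdiff : MDifferentiableAt 𝓘(ℝ, ℂ) 𝓘(ℝ, EuclideanSpace ℝ (ι × ι × Fin 2))
      (fun q => projEmbed b (Ψ q)) p) (X Y : ℂ) :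
    pullbackMetric Ψ p X Y = 2 * ⟪realDiff (fun q => projEmbed b (Ψ q)) p X,
      realDiff (fun q => projEmbed b (Ψ q)) p Y⟫_ℝ := by
  set z := chartAt ℂ p p
  set A : ℂ → V := fun w => affineLift (Ψ p) (Ψ ((chartAt ℂ p).symm w)) with hA
  have hs : (chartAt ℂ p).symm z = p := (chartAt ℂ p).left_inv (mem_chart_source ℂ p)
  have hAs : ContDiffAt ℝ ∞ A z := contDiffAt_chart_of_contMDiffAt hΨ
  have hAd : DifferentiableAt ℝ A z := hAs.differentiableAt (by simp)
  have hAz : A z = (Ψ p).rep := by rw [hA]; simp only [hs, affineLift_self]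
  have h0 : A z ≠ 0 := by rw [hAz]; exact (Ψ p).rep_nonzero
  have hev : ∀ᶠ w in 𝓝 z, A w ≠ 0 := hAs.continuousAt.eventually_ne h0
  have hFd : ∀ a, DifferentiableAt ℝ (fun w => basisCoords b (A w) a) z := fun a =>
    ((contDiff_basisCoords b a (n := 1)).differentiable (by simp)).differentiableAt.comp z hAd
  have hFv : ∀ (v : ℂ), (fun a => fderiv ℝ (fun w => basisCoords b (A w) a) z v) =
      basisCoords b (fderiv ℝ A z v) := fun v => by
    funext a
    have h := (((innerSL ℂ (b a)).restrictScalars ℝ).hasFDerivAt.comp z hAd.hasFDerivAt).fderiv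
    exact congrArg (fun T : ℂ →L[ℝ] ℂ => T v) h
  -- The affine lift has constant inner product with the representative of the central line.
  have hperp : ∀ v : ℂ, ⟪A z, fderiv ℝ A z v⟫_ℂ = 0 := fun v => by
    have e : (fun w => ⟪(Ψ p).rep, A w⟫_ℂ) =ᶠ[𝓝 z] fun _ => (‖(Ψ p).rep‖ : ℂ) ^ 2 :=
      hev.mono fun w hw => inner_affineLift hw
    have h := (((innerSL ℂ (Ψ p).rep).restrictScalars ℝ).hasFDerivAt.comp z hAd.hasFDerivAt).fderiv
    have h2 := congrArg (fun T : ℂ →L[ℝ] ℂ => T v) (h.symm.trans e.fderiv_eq)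
    rw [hAz]
    simpa using h2
  have hperp' : ∀ v : ℂ, ∑ a, starRingEnd ℂ (basisCoords b (A z) a) *
      basisCoords b (fderiv ℝ A z v) a = 0 := fun v => by rw [sum_basisCoords, hperp]
  have hR : ∀ v : ℂ, realDiff (fun q => projEmbed b (Ψ q)) p v =
      realCoords (lineTangent (basisCoords b (A z)) (basisCoords b (fderiv ℝ A z v))) := fun v => by
    rw [realDiff_projEmbed b hdiff (F := fun w => basisCoords b (A w)) hFd
      (basisCoords_ne_zero b h0) (hev.mono fun w hw => projEmbed_affineLift b hw) v, hFv,
      orthPart_eq_self (hperp' v)]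
  have hd := hΨ.mdifferentiableAt (by simp)
  rw [hR, hR, inner_lineTangent (basisCoords_ne_zero b h0) (hperp' X) (hperp' Y), sum_basisCoords,
    vecNormSq_basisCoords, hAz]
  change 4 * (⟪(diff Ψ p X : V), (diff Ψ p Y : V)⟫_ℂ).re / ‖(Ψ p).rep‖ ^ 2 = _
  rw [diff_eq_fderiv hd X, diff_eq_fderiv hd Y]
  ring

omit [IsManifold 𝓘(ℂ) ω M] in
theorem isSmoothMap_slice {Φ : ℝ → M → ℙ ℂ V}
    (hΦ : IsSmoothMap (𝓘(ℝ, ℝ).prod 𝓘(ℝ, ℂ)) (fun x : ℝ × M => Φ x.1 x.2)) (t : ℝ) :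
    IsSmoothMap 𝓘(ℝ, ℂ) (Φ t) := fun p =>
  ContMDiffAt.comp (f := fun q : M => (t, q)) p (hΦ (t, p)) (contMDiffAt_const.prodMk contMDiffAt_id)

theorem pullbackMetric_eq_of_isSmoothMap {Ψ : M → ℙ ℂ V} (hΨ : IsSmoothMap 𝓘(ℝ, ℂ) Ψ) (p : M)
    (X Y : ℂ) :
    pullbackMetric Ψ p X Y = 2 * ⟪realDiff (fun q => projEmbed b (Ψ q)) p X,
      realDiff (fun q => projEmbed b (Ψ q)) p Y⟫_ℝ :=
  pullbackMetric_eq b (hΨ p) ((contMDiff_projEmbed b hΨ).mdifferentiable (by simp) p) X Y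

theorem energyDensity_eq (g : HermitianMetric M) {Ψ : M → ℙ ℂ V} (hΨ : IsSmoothMap 𝓘(ℝ, ℂ) Ψ)
    (p : M) : energyDensity g Ψ p =
      2 * gradPair g (fun q => projEmbed b (Ψ q)) (fun q => projEmbed b (Ψ q)) p := by
  rw [energyDensity, gradPair, pullbackMetric_eq_of_isSmoothMap b hΨ p (g.e₁ p) (g.e₁ p),
    pullbackMetric_eq_of_isSmoothMap b hΨ p (g.e₂ p) (g.e₂ p)]
  ring

theorem jacobian_eq (g : HermitianMetric M) {Ψ : M → ℙ ℂ V} (hΨ : IsSmoothMap 𝓘(ℝ, ℂ) Ψ)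
    (p : M) : jacobian g Ψ p = 2 * Real.sqrt (gramDet g (fun q => projEmbed b (Ψ q)) p) := by
  rw [jacobian, gramDet, pullbackMetric_eq_of_isSmoothMap b hΨ p (g.e₁ p) (g.e₁ p),
    pullbackMetric_eq_of_isSmoothMap b hΨ p (g.e₂ p) (g.e₂ p),
    pullbackMetric_eq_of_isSmoothMap b hΨ p (g.e₁ p) (g.e₂ p)]
  have h4 : Real.sqrt 4 = 2 := by
    rw [show (4 : ℝ) = 2 ^ 2 by norm_num]; exact Real.sqrt_sq (by norm_num)
  rw [← h4, ← Real.sqrt_mul (by norm_num)]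
  congr 1
  rw [h4]
  ring

omit [IsManifold 𝓘(ℂ) ω M] in
/-- A map with a smooth local lift is smooth. -/
theorem contMDiffAt_affineLift {Ψ : M → ℙ ℂ V} {p : M} {F : M → V}
    (hF : ContMDiffAt 𝓘(ℝ, ℂ) 𝓘(ℝ, V) ∞ F p)
    (hFΨ : ∀ᶠ q in 𝓝 p, ∃ h : F q ≠ 0, Ψ q = Projectivization.mk ℂ (F q) h) :
    ContMDiffAt 𝓘(ℝ, ℂ) 𝓘(ℝ, V) ∞ (fun q => affineLift (Ψ p) (Ψ q)) p := by
  obtain ⟨h0, hp⟩ := hFΨ.self_of_nhds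
  have hne : ⟪(Ψ p).rep, F p⟫_ℂ ≠ 0 := by rw [hp]; exact inner_rep_ne_zero h0
  have h1 : ContDiffAt ℝ ∞ (fun v : V => ((‖(Ψ p).rep‖ : ℂ) ^ 2 / ⟪(Ψ p).rep, v⟫_ℂ) • v) (F p) := by
    have hin : ContDiffAt ℝ ∞ (fun v : V => ⟪(Ψ p).rep, v⟫_ℂ) (F p) :=
      ((innerSL ℂ (Ψ p).rep).restrictScalars ℝ).contDiff.contDiffAt
    simp only [div_eq_mul_inv]
    exact (contDiffAt_const.mul (hin.inv hne)).smul contDiffAt_id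
  have h2 := ContMDiffAt.comp p h1.contMDiffAt hF
  refine h2.congr_of_eventuallyEq (hFΨ.mono fun q hq => ?_)
  obtain ⟨hq0, hq⟩ := hq
  show affineLift (Ψ p) (Ψ q) = _
  rw [hq, affineLift_mk]
  rfl

/-- An immersion is unbranched. -/
theorem hasBranchForm_one {Ψ : M → ℙ ℂ V} {p : M} (hΨ : IsSmoothMap 𝓘(ℝ, ℂ) Ψ)
    (himm : IsImmersionAt Ψ p) : HasBranchForm Ψ p 1 := by
  set z₀ := chartAt ℂ p p with hz₀
  set f : ℂ → V := fun z => affineLift (Ψ p) (Ψ ((chartAt ℂ p).symm z)) with hf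
  have hfs : ContDiffAt ℝ ∞ f z₀ := contDiffAt_chart_of_contMDiffAt (hΨ p)
  have hfd : DifferentiableAt ℝ f z₀ := hfs.differentiableAt (by simp)
  have hdiff : ∀ X : ℂ, (diff Ψ p X : V) = fderiv ℝ f z₀ X := fun X =>
    diff_eq_fderiv ((hΨ p).mdifferentiableAt (by simp)) X
  have hlin : ∀ (x y : ℝ), fderiv ℝ f z₀ (x + y * Complex.I) =
      x • fderiv ℝ f z₀ 1 + y • fderiv ℝ f z₀ Complex.I := fun x y => by
    rw [← map_smul, ← map_smul, ← map_add]
    simp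
  have hR : (fun z => f z - f z₀ - (((z - z₀) ^ 1).re • fderiv ℝ f z₀ 1 +
      ((z - z₀) ^ 1).im • fderiv ℝ f z₀ Complex.I)) =
      fun z => f z - f z₀ - fderiv ℝ f z₀ (z - z₀) := by
    funext z
    rw [pow_one, ← hlin, Complex.re_add_im]
  -- For k = 1 the coordinate is the chart itself, a and b are the partial derivatives of the lift,
  -- and the remainder is that of the first-order Taylor expansion.
  refine ⟨fun z => z - z₀, fderiv ℝ f z₀ 1, fderiv ℝ f z₀ Complex.I, by fun_prop, sub_self _, ?_,
    ?_, ?_, ?_⟩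
  · rw [fderiv_sub_const, fderiv_fun_id]
    exact fun x y h => h
  · rw [LinearIndependent.pair_iff]
    intro s t hst
    rw [← hlin] at hst
    have h1 : (diff Ψ p (s + t * Complex.I : ℂ) : V) = diff Ψ p (0 : ℂ) := by
      rw [hdiff, hdiff, hst, map_zero]
    have h2 : (s + t * Complex.I : ℂ) = 0 := himm h1
    have h3 := congrArg Complex.re h2
    have h4 := congrArg Complex.im h2
    simp at h3 h4
    exact ⟨h3, h4⟩
  · dsimp only
    rw [hR]
    have := hfd.hasFDerivAt.isLittleO
    refine this.trans_isBigO (IsBigO.of_bound 1 (Filter.Eventually.of_forall fun z => ?_))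
    simp [hz₀]
  · dsimp only
    rw [hR]
    simp only [Nat.sub_self, pow_zero]
    rw [isLittleO_one_iff]
    have hc : Filter.Tendsto (fun z => fderiv ℝ f z - fderiv ℝ f z₀) (𝓝 z₀) (𝓝 0) := by
      have h1 : ContinuousAt (fderiv ℝ f) z₀ :=
        (hfs.fderiv_right (m := 0) (by norm_cast)).continuousAt
      have := h1.tendsto.sub_const (fderiv ℝ f z₀)
      rwa [sub_self] at this
    refine hc.congr' ?_
    have hev : ∀ᶠ z in 𝓝 z₀, DifferentiableAt ℝ f z :=
      ((hfs.of_le (m := 1) (by simp)).eventually (by simp)).mono fun z hz =>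
        hz.differentiableAt (by simp)
    filter_upwards [hev] with z hz
    have h1 := (hz.hasFDerivAt.sub_const (f z₀)).sub
      ((fderiv ℝ f z₀).hasFDerivAt.comp z ((hasFDerivAt_id z).sub_const z₀))
    exact h1.fderiv.symm

end ProjectiveMaps

/-! ### Frames of S, their changes, and the coefficient h in e ⊗ e = h dz -/

section SpinorCoordinates

variable {M : Type*} [TopologicalSpace M] [ChartedSpace ℂ M]
  {S : M → Type*} [∀ p, AddCommGroup (S p)] [∀ p, Module ℂ (S p)] [∀ p, TopologicalSpace (S p)]
  [TopologicalSpace (TotalSpace ℂ S)] [FiberBundle ℂ S] [VectorBundle ℂ ℂ S]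

variable (S) in
/-- The domain of the preferred trivialization at `x`. -/
def frameDomain (x : M) : Set M := (trivializationAt ℂ S x).baseSet

omit [ChartedSpace ℂ M] [∀ p, AddCommGroup (S p)] [∀ p, Module ℂ (S p)] [VectorBundle ℂ ℂ S] in
theorem isOpen_frameDomain (x : M) : IsOpen (frameDomain S x) :=
  (trivializationAt ℂ S x).open_baseSet

omit [ChartedSpace ℂ M] [∀ p, AddCommGroup (S p)] [∀ p, Module ℂ (S p)] [VectorBundle ℂ ℂ S] in
theorem mem_frameDomain (x : M) : x ∈ frameDomain S x := mem_baseSet_trivializationAt ℂ S x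

/-- The preferred trivialization at `x`, on the fibre at a point `q` of its domain. -/
def coordEquiv {x q : M} (hq : q ∈ frameDomain S x) : S q ≃ₗ[ℂ] ℂ :=
  (trivializationAt ℂ S x).linearEquivAt ℂ q hq

omit [ChartedSpace ℂ M] in
theorem coordEquiv_apply {x q : M} (hq : q ∈ frameDomain S x) (s : S q) :
    coordEquiv hq s = coord x s := rfl

omit [ChartedSpace ℂ M] in
theorem coordEquiv_symm_one {x q : M} (hq : q ∈ frameDomain S x) :
    (coordEquiv hq).symm 1 = frame S x q := by
  refine Eq.trans ?_ (Trivialization.symmL_apply (R := ℂ) (trivializationAt ℂ S x) hq 1).symm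
  exact Trivialization.linearEquivAt_symm_apply (trivializationAt ℂ S x) q hq 1

omit [ChartedSpace ℂ M] in
theorem coord_smul {x q : M} (hq : q ∈ frameDomain S x) (c : ℂ) (s : S q) :
    coord x (c • s) = c * coord x s := by
  rw [← coordEquiv_apply hq, map_smul, coordEquiv_apply, smul_eq_mul]

omit [ChartedSpace ℂ M] in
theorem coord_neg {x q : M} (hq : q ∈ frameDomain S x) (s : S q) :
    coord x (-s) = -coord x s := by
  rw [← coordEquiv_apply hq, map_neg, coordEquiv_apply]

omit [ChartedSpace ℂ M] in
theorem coord_frame {x q : M} (hq : q ∈ frameDomain S x) : coord x (frame S x q) = 1 := by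
  rw [← coordEquiv_apply hq, ← coordEquiv_symm_one hq, LinearEquiv.apply_symm_apply]

omit [ChartedSpace ℂ M] in
theorem coord_smul_frame {x q : M} (hq : q ∈ frameDomain S x) (s : S q) :
    coord x s • frame S x q = s := by
  rw [← coordEquiv_apply hq, ← coordEquiv_symm_one hq, ← map_smul, smul_eq_mul, mul_one,
    LinearEquiv.symm_apply_apply]

omit [ChartedSpace ℂ M] in
/-- The coordinate change between the preferred trivializations. -/
theorem coord_change {x y q : M} (hx : q ∈ frameDomain S x) (hy : q ∈ frameDomain S y)
    (s : S q) : coord y s = coord y (frame S x q) * coord x s := by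
  conv_lhs => rw [← coord_smul_frame hx s]
  rw [coord_smul hy, mul_comm]

omit [ChartedSpace ℂ M] in
theorem coord_frame_ne_zero {x y q : M} (hx : q ∈ frameDomain S x) (hy : q ∈ frameDomain S y) :
    coord y (frame S x q) ≠ 0 := by
  intro h
  have := coord_change hx hy (frame S y q)
  rw [coord_frame hy, h, zero_mul] at this
  exact one_ne_zero this

variable [IsManifold 𝓘(ℂ) ω M]

omit [IsManifold 𝓘(ℂ) ω M] in
theorem contMDiffAt_coord_frame [ContMDiffVectorBundle ω ℂ S 𝓘(ℂ)] {x y q : M}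
    (hx : q ∈ frameDomain S x) (hy : q ∈ frameDomain S y) :
    ContMDiffAt 𝓘(ℂ) 𝓘(ℂ) ω (fun p => coord y (frame S x p)) q := by
  have h : ContMDiffAt 𝓘(ℂ) 𝓘(ℂ) ω (fun p => ((trivializationAt ℂ S x).coordChangeL ℂ
      (trivializationAt ℂ S y) p : ℂ →L[ℂ] ℂ) 1) q :=
    (contMDiffAt_coordChangeL (n := ω) (IB := 𝓘(ℂ)) hx hy).clm_apply contMDiffAt_const
  refine h.congr_of_eventuallyEq ?_
  filter_upwards [(isOpen_frameDomain x).mem_nhds hx, (isOpen_frameDomain y).mem_nhds hy]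
    with p hpx hpy
  rw [← coordEquiv_symm_one hpx, ← coordEquiv_apply hpy]
  exact (congrFun (Trivialization.coe_coordChangeL (R := ℂ) (trivializationAt ℂ S x)
    (trivializationAt ℂ S y) ⟨hpx, hpy⟩) 1).symm

theorem coordField_eq {x q : M} (hq : q ∈ (chartAt ℂ x).source) :
    (coordField x q : ℂ) = chartFactor x (chartAt ℂ x q) := by
  have h := congrArg (fun T : ℂ →L[ℂ] ℂ => T 1)
    (TangentBundle.symmL_trivializationAt_eq_core (I := 𝓘(ℂ)) (𝕜 := ℂ) hq)
  refine h.trans ?_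
  rw [tangentBundleCore_coordChange_achart]
  have hs := (chartAt ℂ x).left_inv hq
  have hd := (hasDerivAt_transition ((chartAt ℂ x).map_source hq) hs).hasFDerivAt.fderiv
  have hd1 := congrArg (fun T : ℂ →L[ℂ] ℂ => T 1) hd
  simp only [extChartAt, mfld_simps, fderivWithin_univ]
  refine Eq.trans ?_ (hd1.trans ?_)
  · rfl
  · simp

omit [IsManifold 𝓘(ℂ) ω M] in
theorem tangentFunctional_apply {p : M} (f : TangentSpace 𝓘(ℂ) p →ₗ[ℂ] ℂ) (X : ℂ) :
    f X = X * f (show ℂ from 1) := by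
  have h := f.map_smul X (1 : ℂ)
  have e : (X • (1 : ℂ) : ℂ) = X := by simp
  exact (congrArg f e.symm).trans h

namespace SpinStructure

variable (σ : SpinStructure S)

/-- The coefficient of `e ⊗ e` with respect to `dz`, for the preferred frame `e` at `x`. -/
def frameSq (x q : M) : ℂ := σ.sq q (frame S x q) (frame S x q) (coordField x q)

theorem pair_smul {p : M} (a b : ℂ) (s t : S p) (X : RealTangent p) :
    σ.pair (a • s) (b • t) X = a * b * σ.pair s t X := by
  have h : ∀ Y : TangentSpace 𝓘(ℂ) p, σ.sq p (a • s) (b • t) Y = a * b * σ.sq p s t Y := fun Y => by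
    simp only [map_smul, LinearMap.smul_apply, smul_eq_mul]
    ring
  exact h X

theorem pair_frame (p : M) (X : ℂ) :
    σ.pair (frame S p p) (frame S p p) X = σ.frameSq p p * X := by
  have h : (coordField p p : ℂ) = (1 : ℂ) :=
    (coordField_eq (mem_chart_source ℂ p)).trans (chartFactor_self p)
  have h2 : σ.frameSq p p = σ.sq p (frame S p p) (frame S p p) (show ℂ from 1) :=
    congrArg (σ.sq p (frame S p p) (frame S p p)) h
  rw [h2, mul_comm]
  exact tangentFunctional_apply _ X

/-- The form e ⊗ e is quadratic in the frame and linear in the coordinate field, hence the square of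
the frame change and one power of the coordinate change. -/
theorem frameSq_change {x q : M} (hq : q ∈ (chartAt ℂ x).source) :
    σ.frameSq x q =
      coord q (frame S x q) ^ 2 * chartFactor x (chartAt ℂ x q) * σ.frameSq q q := by
  have h1 : σ.frameSq x q = σ.pair (frame S x q) (frame S x q) (chartFactor x (chartAt ℂ x q)) :=
    congrArg (σ.sq q (frame S x q) (frame S x q)) (coordField_eq hq)
  rw [h1]
  conv_lhs => rw [← coord_smul_frame (mem_frameDomain q) (frame S x q)]
  exact (σ.pair_smul _ _ _ _ _).trans (by rw [pair_frame]; ring)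

theorem frameSq_self_ne_zero (p : M) : σ.frameSq p p ≠ 0 := by
  intro h
  have hf : frame S p p ≠ 0 := fun h0 => by
    have := coord_frame (mem_frameDomain (S := S) p)
    rw [h0, ← coordEquiv_apply (mem_frameDomain p), map_zero] at this
    exact zero_ne_one this
  refine σ.sq_self_ne_zero p _ hf (LinearMap.ext fun X => ?_)
  exact (σ.pair_frame p X).trans (by rw [h]; exact zero_mul _)

end SpinStructure
end SpinorCoordinates

/-! ### The Dirac and energy-momentum equations at the centre of a chart -/

section SpinorEquations

variable {M : Type*} [TopologicalSpace M] [ChartedSpace ℂ M] [IsManifold 𝓘(ℂ) ω M]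
  {S : M → Type*} [∀ p, AddCommGroup (S p)] [∀ p, Module ℂ (S p)] [∀ p, TopologicalSpace (S p)]
  [TopologicalSpace (TotalSpace ℂ S)] [FiberBundle ℂ S] [VectorBundle ℂ ℂ S]

/-- The coordinate of a section, in the preferred trivialization and the preferred chart at `x`. -/
def localCoord (s : ∀ p, S p) (x : M) (z : ℂ) : ℂ := coord x (s ((chartAt ℂ x).symm z))

namespace SpinStructure

omit [IsManifold 𝓘(ℂ) ω M] [∀ p, AddCommGroup (S p)] [∀ p, Module ℂ (S p)]
  [VectorBundle ℂ ℂ S] in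
theorem dCoord_eq {s : ∀ p, S p} (hs : IsSmoothSection s) (p : M) (X : ℂ) :
    dCoord s p X = fderiv ℝ (localCoord s p) (chartAt ℂ p p) X :=
  mfderiv_eq_fderiv_chart ((hs p).mdifferentiableAt (by simp)) X

variable (σ : SpinStructure S) (g : HermitianMetric M)

theorem normSq_frame (p : M) :
    σ.normSq g (frame S p p) = ‖σ.frameSq p p‖ / √(g.conformalFactor p) := by
  have h : σ.pair (frame S p p) (frame S p p) (g.e₁ p) =
      σ.frameSq p p * ((√(g.conformalFactor p))⁻¹ : ℂ) :=
    (congrArg (σ.pair (frame S p p) (frame S p p)) (g.e₁_eq p)).trans (σ.pair_frame p _)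
  rw [normSq, h, norm_mul, norm_inv, Complex.norm_real, Real.norm_of_nonneg (Real.sqrt_nonneg _),
    div_eq_mul_inv]

/-- The length of e₁ cancels in the contraction, leaving |e|² = |h|/√(conformal factor). The 2
compensates the missing 1/2 in `dzbar`, and the conjugation comes from reading S̄ in coordinates of
S. -/
theorem coord_unbar_dbarG {s : ∀ p, S p} (hs : IsSmoothSection s) (p : M) :
    coord p (unbar (σ.dbarG g s p)) =
      starRingEnd ℂ (dzbar (localCoord s p) (chartAt ℂ p p)) * ‖σ.frameSq p p‖ /
        (2 * σ.frameSq p p * √(g.conformalFactor p)) := by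
  set r : ℝ := √(g.conformalFactor p) with hr
  have hr0 : (r : ℂ) ≠ 0 := by
    exact_mod_cast (Real.sqrt_pos.2 (g.conformalFactor_pos p)).ne'
  have hh := σ.frameSq_self_ne_zero p
  have hp := mem_frameDomain (S := S) p
  set D := fderiv ℝ (localCoord s p) (chartAt ℂ p p) with hD
  have hD1 : dCoord s p (g.e₁ p) = (r⁻¹ : ℂ) * D 1 := by
    refine (congrArg (dCoord s p) (g.e₁_eq p)).trans ((dCoord_eq hs p _).trans ?_)
    have e : ((r⁻¹ : ℂ) : ℂ) = (r⁻¹ : ℝ) • (1 : ℂ) := by simp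
    rw [← hr]
    exact (congrArg D e).trans (by rw [map_smul, Complex.real_smul, Complex.ofReal_inv])
  have hD2 : dCoord s p (J p (g.e₁ p)) = (r⁻¹ : ℂ) * D Complex.I := by
    refine (congrArg (dCoord s p) (g.e₂_eq p)).trans ((dCoord_eq hs p _).trans ?_)
    have e : Complex.I * ((r⁻¹ : ℂ) : ℂ) = (r⁻¹ : ℝ) • Complex.I := by
      rw [Complex.real_smul, Complex.ofReal_inv, mul_comm]
    rw [← hr, e, map_smul, Complex.real_smul, Complex.ofReal_inv]
  have hpair : σ.pair (frame S p p) (frame S p p) (g.e₁ p) = σ.frameSq p p * (r⁻¹ : ℂ) :=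
    (congrArg (σ.pair (frame S p p) (frame S p p)) (g.e₁_eq p)).trans (σ.pair_frame p _)
  have hβ : coord p (dbar s p (g.e₁ p)) = (r⁻¹ : ℂ) * dzbar (localCoord s p) (chartAt ℂ p p) / 2 := by
    rw [dbar, coord_smul hp, coord_frame hp, hD1, hD2, dzbar]
    ring
  have h : coord p (unbar (σ.dbarG g s p)) = starRingEnd ℂ
      (coord p (dbar s p (g.e₁ p)) / starRingEnd ℂ (σ.pair (frame S p p) (frame S p p) (g.e₁ p)) *
        (σ.normSq g (frame S p p) : ℂ)) * coord p (frame S p p) := coord_smul hp _ _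
  rw [h, hβ, hpair, coord_frame hp, normSq_frame, ← hr]
  simp only [map_mul, map_div₀, map_inv₀, Complex.conj_conj, Complex.conj_ofReal, map_ofNat,
    Complex.ofReal_div]
  field_simp

/-- The connection form θ enters only as f·kθ - k·fθ and cancels, and the norm of the frame in the
Hermitian product cancels the one in Clifford multiplication. What survives are ordinary derivatives
in the complex symplectic expression f dk - k df. -/
theorem hermSpinor_clifford_nabla (ψ : Spinor S) (p : M) (X Y : ℂ) :
    (σ.hermSpinor g (σ.clifford g (show RealTangent p from X)
      (σ.nabla g ψ p (show RealTangent p from Y))) (ψ.val p)).re =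
    (σ.frameSq p p * X * (coord p (ψ.plus p) *
        fderiv ℝ (localCoord (fun q => unbar (ψ.minus q)) p) (chartAt ℂ p p) Y -
      coord p (unbar (ψ.minus p)) * fderiv ℝ (localCoord ψ.plus p) (chartAt ℂ p p) Y)).re := by
  have hp := mem_frameDomain (S := S) p
  have hN : (σ.normSq g (frame S p p) : ℂ) ≠ 0 := by
    rw [normSq_frame]
    exact_mod_cast (div_pos (norm_pos_iff.2 (σ.frameSq_self_ne_zero p))
      (Real.sqrt_pos.2 (g.conformalFactor_pos p))).ne'
  set N : ℝ := σ.normSq g (frame S p p) with hNdef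
  set f := coord p (ψ.plus p)
  set k := coord p (unbar (ψ.minus p))
  set A := dCoord ψ.plus p (show RealTangent p from Y) + f * σ.chernForm g p (show RealTangent p from Y)
    with hA
  set B := dCoord (fun q => unbar (ψ.minus q)) p (show RealTangent p from Y) +
    k * σ.chernForm g p (show RealTangent p from Y) with hB
  have hriesz : ∀ a : ℂ, coord p (σ.riesz g (show RealTangent p from X) (a • frame S p p)) =
      starRingEnd ℂ (a * (σ.frameSq p p * X)) / N := fun a => by
    have e : σ.pair (frame S p p) (a • frame S p p) (show RealTangent p from X) =
        a * (σ.frameSq p p * X) := by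
      have e1 := σ.pair_smul 1 a (frame S p p) (frame S p p) (show RealTangent p from X)
      rw [one_smul, one_mul] at e1
      exact e1.trans (congrArg (a * ·) (σ.pair_frame p X))
    rw [riesz, coord_smul hp, coord_frame hp, mul_one, e]
  have h1 : σ.hermSpinor g (σ.clifford g (show RealTangent p from X)
      (σ.nabla g ψ p (show RealTangent p from Y))) (ψ.val p) =
      coord p (σ.riesz g (show RealTangent p from X) (B • frame S p p)) * starRingEnd ℂ f * N +
      starRingEnd ℂ (coord p (-σ.riesz g (show RealTangent p from X) (A • frame S p p)) *
        starRingEnd ℂ k * N) := rfl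
  rw [h1, coord_neg hp, hriesz, hriesz]
  have h2 : fderiv ℝ (localCoord (fun q => unbar (ψ.minus q)) p) (chartAt ℂ p p) Y =
      B - k * σ.chernForm g p (show RealTangent p from Y) := by
    rw [hB, add_sub_cancel_right]
    exact (dCoord_eq ψ.smooth_minus p Y).symm
  have h3 : fderiv ℝ (localCoord ψ.plus p) (chartAt ℂ p p) Y =
      A - f * σ.chernForm g p (show RealTangent p from Y) := by
    rw [hA, add_sub_cancel_right]
    exact (dCoord_eq ψ.smooth_plus p Y).symm
  rw [h2, h3]
  have h4 : starRingEnd ℂ (B * (σ.frameSq p p * X)) / N * starRingEnd ℂ f * N =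
      starRingEnd ℂ (B * (σ.frameSq p p * X) * f) := by
    rw [map_mul _ _ f]
    field_simp
  have h5 : starRingEnd ℂ (-(starRingEnd ℂ (A * (σ.frameSq p p * X)) / N) * starRingEnd ℂ k * N) =
      -(A * (σ.frameSq p p * X) * k) := by
    simp only [map_mul, map_neg, map_div₀, Complex.conj_conj, Complex.conj_ofReal]
    field_simp
  -- Under the real part, the first summand may be replaced by its conjugate, which has the same
  -- type as the second.
  rw [h4, h5, Complex.add_re, Complex.conj_re, ← Complex.add_re]
  congr 1
  ring

end SpinStructure

/-- The quaternionic structure `(f, k) ↦ (-k̄, f̄)` of `ℂ^{2m}`. -/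
def antiRot {m : ℕ} (v : Fin m × Fin 2 → ℂ) : Fin m × Fin 2 → ℂ :=
  fun i => ![-starRingEnd ℂ (v (i.1, 1)), starRingEnd ℂ (v (i.1, 0))] i.2

theorem sum_conj_mul_antiRot {m : ℕ} (v : Fin m × Fin 2 → ℂ) :
    ∑ a, starRingEnd ℂ (v a) * antiRot v a = 0 := by
  rw [Fintype.sum_prod_type]
  refine Finset.sum_eq_zero fun j _ => ?_
  simp [antiRot]
  ring

/-- This identifies the Hermitian product with jv as the complex symplectic form, the link between
the energy-momentum tensor and orthogonality to jF. -/
theorem sum_conj_antiRot_mul {m : ℕ} (v u : Fin m × Fin 2 → ℂ) :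
    ∑ a, starRingEnd ℂ (antiRot v a) * u a =
      ∑ j, (v (j, 0) * u (j, 1) - v (j, 1) * u (j, 0)) := by
  rw [Fintype.sum_prod_type]
  refine Finset.sum_congr rfl fun j _ => ?_
  simp [antiRot]
  ring

theorem sum_antisymm_antiRot {m : ℕ} (v : Fin m × Fin 2 → ℂ) :
    ∑ j, (v (j, 0) * antiRot v (j, 1) - v (j, 1) * antiRot v (j, 0)) = vecNormSq v := by
  rw [vecNormSq, Fintype.sum_prod_type, Complex.ofReal_sum]
  refine Finset.sum_congr rfl fun j _ => ?_
  simp [antiRot, Complex.mul_conj]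

theorem vecNormSq_antiRot {m : ℕ} (v : Fin m × Fin 2 → ℂ) :
    vecNormSq (antiRot v) = vecNormSq v := by
  rw [vecNormSq, vecNormSq, Fintype.sum_prod_type, Fintype.sum_prod_type]
  refine Finset.sum_congr rfl fun j _ => ?_
  simp [antiRot, Complex.normSq_neg, Complex.normSq_conj, add_comm]

variable {m : ℕ} (ψ : Fin m → Spinor S)

/-- The coordinates `(ψ₁₊, ψ̄₁₋, …)` at `q`, in the preferred trivialization at `x`. -/
def spinorCoord (x q : M) : Fin m × Fin 2 → ℂ :=
  fun i => ![coord x ((ψ i.1).plus q), coord x (unbar ((ψ i.1).minus q))] i.2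

/-- The coordinates `(ψ₁₊, ψ̄₁₋, …)`, in the preferred trivialization and chart at `x`. -/
def localSpinor (x : M) (z : ℂ) : Fin m × Fin 2 → ℂ := spinorCoord ψ x ((chartAt ℂ x).symm z)

omit [IsManifold 𝓘(ℂ) ω M] [∀ p, AddCommGroup (S p)] [∀ p, Module ℂ (S p)]
  [VectorBundle ℂ ℂ S] in
theorem localSpinor_self (x : M) : localSpinor ψ x (chartAt ℂ x x) = spinorCoord ψ x x :=
  congrArg (spinorCoord ψ x) ((chartAt ℂ x).left_inv (mem_chart_source ℂ x))

variable {ψ} (σ : SpinStructure S) (g : HermitianMetric M) {lam : ℝ}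

/-- The S component of the eigenvalue equation controls ∂̄ of the coordinate of ψ̄₋, and the S̄
component controls ∂̄ of that of ψ₊. The opposite signs in the Dirac operator produce the sign in
the quaternionic structure. -/
theorem dzbar_localSpinor_self
    (heigen : ∀ (j : Fin m) (p : M), σ.dirac g (ψ j) p = (lam : ℂ) • (ψ j).val p) (p : M)
    (a : Fin m × Fin 2) :
    dzbar (fun w => localSpinor ψ p w a) (chartAt ℂ p p) =
      lam * starRingEnd ℂ (σ.frameSq p p) * (√(g.conformalFactor p) / ‖σ.frameSq p p‖) *
        antiRot (spinorCoord ψ p p) a := by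
  obtain ⟨j, i⟩ := a
  have hp := mem_frameDomain (S := S) p
  set r : ℝ := √(g.conformalFactor p) with hr
  have hr0 : (r : ℂ) ≠ 0 := by
    exact_mod_cast (Real.sqrt_pos.2 (g.conformalFactor_pos p)).ne'
  have hh := σ.frameSq_self_ne_zero p
  have hn : ((‖σ.frameSq p p‖ : ℝ) : ℂ) ≠ 0 := by exact_mod_cast (norm_pos_iff.2 hh).ne'
  have h1 : coord p ((2 : ℂ) • σ.dG g (ψ j).minus p) = coord p ((lam : ℂ) • (ψ j).plus p) :=
    congrArg (fun s : S p × Conj (S p) => coord p s.1) (heigen j p)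
  -- On the S̄ component scalars act through conjugation.
  have h2 : coord p (starRingEnd ℂ 2 • (-unbar (σ.dbarG g (ψ j).plus p))) =
      coord p (starRingEnd ℂ (lam : ℂ) • unbar ((ψ j).minus p)) :=
    congrArg (fun s : S p × Conj (S p) => coord p (unbar s.2)) (heigen j p)
  rw [coord_smul hp, coord_smul hp, SpinStructure.dG,
    σ.coord_unbar_dbarG g (ψ j).smooth_minus] at h1
  rw [coord_smul hp, coord_smul hp, coord_neg hp,
    σ.coord_unbar_dbarG g (ψ j).smooth_plus] at h2
  have e1 := congrArg (starRingEnd ℂ) h1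
  have e2 := congrArg (starRingEnd ℂ) h2
  have hh' : starRingEnd ℂ (σ.frameSq p p) ≠ 0 := by simpa using hh
  simp only [map_mul, map_div₀, Complex.conj_conj, Complex.conj_ofReal, map_ofNat, map_neg,
    ← hr] at e1 e2
  fin_cases i
  · change dzbar (localCoord (ψ j).plus p) _ =
      _ * -starRingEnd ℂ (coord p (unbar ((ψ j).minus p)))
    field_simp at e2 ⊢
    linear_combination -e2
  · change dzbar (localCoord (fun q => unbar ((ψ j).minus q)) p) _ =
      _ * starRingEnd ℂ (coord p ((ψ j).plus p))
    field_simp at e1 ⊢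
    linear_combination e1

/-- The consequences of the equation for the energy-momentum tensor: its trace, and its trace free
part. -/
theorem energyMomentum_consequences (hlam : lam ≠ 0)
    (heigen : ∀ (j : Fin m) (p : M), σ.dirac g (ψ j) p = (lam : ℂ) • (ψ j).val p)
    (hcrit : ∀ (p : M) (X Y : RealTangent p),
      ∑ j, σ.energyMomentum g (ψ j) p X Y = lam / 2 * g.inner p X Y) (p : M) :
    ‖σ.frameSq p p‖ * vecNormSq (spinorCoord ψ p p) = √(g.conformalFactor p) ∧
    ∑ a, starRingEnd ℂ (antiRot (spinorCoord ψ p p) a) *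
      dz (fun w => localSpinor ψ p w a) (chartAt ℂ p p) = 0 := by
  set h := σ.frameSq p p with hh
  set F := spinorCoord ψ p p with hF
  set D : ℂ → Fin m × Fin 2 → ℂ := fun X a => fderiv ℝ (fun w => localSpinor ψ p w a)
    (chartAt ℂ p p) X with hD
  set Ω : ℂ → ℂ := fun X => ∑ j, (F (j, 0) * D X (j, 1) - F (j, 1) * D X (j, 0)) with hΩ
  -- The full tensor equation in coordinates: twice the sum of the Q's is the real part of the
  -- symmetrization of h X Ω(Y).
  have hQ : ∀ X Y : ℂ, (h * X * Ω Y + h * Y * Ω X).re =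
      lam * g.conformalFactor p * (X.re * Y.re + X.im * Y.im) := fun X Y => by
    have e1 : ∑ j, (1 / 2) * ((h * X * (F (j, 0) * D Y (j, 1) - F (j, 1) * D Y (j, 0))).re +
        (h * Y * (F (j, 0) * D X (j, 1) - F (j, 1) * D X (j, 0))).re) =
        lam / 2 * (g.conformalFactor p * (X.re * Y.re + X.im * Y.im)) := by
      refine Eq.trans ?_ ((hcrit p X Y).trans (congrArg (lam / 2 * ·) (g.inner_eq p X Y)))
      refine Finset.sum_congr rfl fun j _ => ?_
      have a1 := σ.hermSpinor_clifford_nabla g (ψ j) p X Y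
      have a2 := σ.hermSpinor_clifford_nabla g (ψ j) p Y X
      change _ = (1 / 2 : ℝ) * (σ.hermSpinor g (σ.clifford g (show RealTangent p from X)
        (σ.nabla g (ψ j) p (show RealTangent p from Y))) ((ψ j).val p) +
        σ.hermSpinor g (σ.clifford g (show RealTangent p from Y)
        (σ.nabla g (ψ j) p (show RealTangent p from X))) ((ψ j).val p)).re
      rw [Complex.add_re]
      exact congrArg ((1 / 2 : ℝ) * ·) (congrArg₂ (· + ·) a1.symm a2.symm)
    rw [← Finset.mul_sum, Finset.sum_add_distrib, ← Complex.re_sum, ← Complex.re_sum,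
      ← Finset.mul_sum, ← Finset.mul_sum, ← Complex.add_re] at e1
    linear_combination 2 * e1
  have h11 := hQ 1 1
  have hII := hQ Complex.I Complex.I
  have h1I := hQ 1 Complex.I
  have hr : 0 < √(g.conformalFactor p) := Real.sqrt_pos.2 (g.conformalFactor_pos p)
  have hr2 : √(g.conformalFactor p) ^ 2 = g.conformalFactor p :=
    Real.sq_sqrt (g.conformalFactor_pos p).le
  set r : ℝ := √(g.conformalFactor p)
  have hh0 : h ≠ 0 := σ.frameSq_self_ne_zero p
  have hn : 0 < ‖h‖ := norm_pos_iff.2 hh0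
  have hnc : ((‖h‖ : ℝ) : ℂ) ≠ 0 := by exact_mod_cast hn.ne'
  -- The (0,1) part of Ω is known from the Dirac equation, because Ω evaluated on jF is |F|².
  have hdb : Ω 1 + Complex.I * Ω Complex.I =
      lam * starRingEnd ℂ h * (r / ‖h‖) * vecNormSq F := by
    rw [← sum_antisymm_antiRot, Finset.mul_sum, hΩ]
    simp only [Finset.mul_sum, ← Finset.sum_add_distrib]
    refine Finset.sum_congr rfl fun j _ => ?_
    have a0 := dzbar_localSpinor_self σ g heigen p (j, 0)
    have a1 := dzbar_localSpinor_self σ g heigen p (j, 1)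
    simp only [dzbar, ← hF, ← hh] at a0 a1
    linear_combination F (j, 0) * a1 - F (j, 1) * a0
  have hd : ∑ a, starRingEnd ℂ (antiRot F a) * dz (fun w => localSpinor ψ p w a) (chartAt ℂ p p) =
      Ω 1 - Complex.I * Ω Complex.I := by
    rw [sum_conj_antiRot_mul, hΩ]
    simp only [Finset.mul_sum, ← Finset.sum_sub_distrib]
    refine Finset.sum_congr rfl fun j _ => ?_
    simp only [dz, hD]
    ring
  have hhdb : h * (Ω 1 + Complex.I * Ω Complex.I) = ((lam * ‖h‖ * r * vecNormSq F : ℝ) : ℂ) := by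
    have hc : h * starRingEnd ℂ h = (‖h‖ : ℂ) ^ 2 := Complex.mul_conj' h
    rw [hdb]
    push_cast
    field_simp
    linear_combination (lam * r * vecNormSq F : ℂ) * hc
  have hre := congrArg Complex.re hhdb
  rw [Complex.ofReal_re] at hre
  simp only [Complex.mul_re, Complex.mul_im, Complex.add_re, Complex.add_im, Complex.I_re,
    Complex.I_im, Complex.one_re, Complex.one_im, mul_zero, mul_one, zero_mul, add_zero,
    zero_add, zero_sub, one_mul] at h11 hII h1I hre
  -- The entries (1,1) and (i,i) add up to the trace, Re h(Ω(1) + iΩ(i)) = λ r² with r² the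
  -- conformal factor, which the Dirac equation evaluates as λ|h| r |F|². Their difference and the
  -- entry (1,i) are the real and imaginary parts of h(Ω(1) - iΩ(i)) = 0.
  constructor
  · have e : lam * r * (‖h‖ * vecNormSq F) = lam * r * r := by
      linear_combination (-1) * hre + (1 / 2) * h11 + (1 / 2) * hII - lam * hr2
    exact mul_left_cancel₀ (mul_ne_zero hlam hr.ne') e
  · rw [hd]
    refine (mul_eq_zero.1 (?_ : h * (Ω 1 - Complex.I * Ω Complex.I) = 0)).resolve_left hh0
    apply Complex.ext
    · simp only [Complex.mul_re, Complex.mul_im, Complex.sub_re, Complex.sub_im, Complex.I_re,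
        Complex.I_im, Complex.zero_re, zero_mul, one_mul]
      linear_combination (1 / 2) * h11 - (1 / 2) * hII
    · simp only [Complex.mul_re, Complex.mul_im, Complex.sub_re, Complex.sub_im, Complex.I_re,
        Complex.I_im, Complex.zero_im, zero_mul, one_mul]
      linear_combination -h1I
end SpinorEquations

/-! ### Wirtinger derivatives and holomorphic substitutions -/

section WirtingerHolomorphic

theorem dzbar_eq_zero {f : ℂ → ℂ} {z : ℂ} (hf : DifferentiableAt ℂ f z) : dzbar f z = 0 := by
  have h : ∀ v, fderiv ℝ f z v = v * deriv f z := fun v => by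
    have h1 := (hf.hasDerivAt.hasFDerivAt.restrictScalars ℝ).fderiv
    exact (congrArg (fun T : ℂ →L[ℝ] ℂ => T v) h1).trans (by simp)
  rw [dzbar, h, h]
  linear_combination deriv f z * Complex.I_sq

theorem dzbar_comp {f T : ℂ → ℂ} {z τ : ℂ} (hf : DifferentiableAt ℝ f (T z))
    (hT : HasDerivAt T τ z) :
    dzbar (fun w => f (T w)) z = starRingEnd ℂ τ * dzbar f (T z) := by
  have h : ∀ v, fderiv ℝ (fun w => f (T w)) z v = fderiv ℝ f (T z) (v * τ) := fun v => by
    have h1 := (hf.hasFDerivAt.comp z (hT.hasFDerivAt.restrictScalars ℝ)).fderiv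
    exact (congrArg (fun T : ℂ →L[ℝ] ℂ => T v) h1).trans (by simp)
  rw [dzbar, h, h, clm_complex_apply _ (1 * τ), clm_complex_apply _ (Complex.I * τ), dzbar]
  have e : starRingEnd ℂ τ = τ.re - τ.im * Complex.I := by
    apply Complex.ext <;> simp
  rw [e]
  simp only [one_mul, Complex.real_smul, Complex.mul_re, Complex.mul_im, Complex.I_re,
    Complex.I_im, zero_mul, zero_sub, zero_add, Complex.ofReal_neg]
  linear_combination (τ.im * fderiv ℝ f (T z) Complex.I) * Complex.I_sq

end WirtingerHolomorphic

/-! ### The equations throughout a chart -/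

section LocalEquations

variable {M : Type*} [TopologicalSpace M] [ChartedSpace ℂ M] [IsManifold 𝓘(ℂ) ω M]
  {S : M → Type*} [∀ p, AddCommGroup (S p)] [∀ p, Module ℂ (S p)] [∀ p, TopologicalSpace (S p)]
  [TopologicalSpace (TotalSpace ℂ S)] [FiberBundle ℂ S] [VectorBundle ℂ ℂ S]

variable (S) in
/-- The part of the preferred chart at `x` over which the preferred frame at `x` is defined. -/
def chartDomain (x : M) : Set ℂ :=
  (chartAt ℂ x).target ∩ (chartAt ℂ x).symm ⁻¹' frameDomain S x

omit [IsManifold 𝓘(ℂ) ω M] [∀ p, AddCommGroup (S p)] [∀ p, Module ℂ (S p)]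
  [VectorBundle ℂ ℂ S] in
theorem isOpen_chartDomain (x : M) : IsOpen (chartDomain S x) :=
  (chartAt ℂ x).isOpen_inter_preimage_symm (isOpen_frameDomain x)

omit [IsManifold 𝓘(ℂ) ω M] [∀ p, AddCommGroup (S p)] [∀ p, Module ℂ (S p)]
  [VectorBundle ℂ ℂ S] in
theorem mem_chartDomain (x : M) : chartAt ℂ x x ∈ chartDomain S x := by
  refine ⟨(chartAt ℂ x).map_source (mem_chart_source ℂ x), ?_⟩
  rw [Set.mem_preimage, (chartAt ℂ x).left_inv (mem_chart_source ℂ x)]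
  exact mem_frameDomain x

omit [∀ p, AddCommGroup (S p)] [∀ p, Module ℂ (S p)] [VectorBundle ℂ ℂ S] in
theorem contDiffAt_localSpinor_self {m : ℕ} (ψ : Fin m → Spinor S) (p : M)
    (a : Fin m × Fin 2) :
    ContDiffAt ℝ ∞ (fun w => localSpinor ψ p w a) (chartAt ℂ p p) := by
  obtain ⟨j, i⟩ := a
  fin_cases i
  · exact contDiffAt_chart_of_contMDiffAt ((ψ j).smooth_plus p)
  · exact contDiffAt_chart_of_contMDiffAt ((ψ j).smooth_minus p)

variable {m : ℕ} {ψ : Fin m → Spinor S}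

/-- The change of frame and of coordinate, for the coordinates of spinors. -/
theorem localSpinor_change [ContMDiffVectorBundle ω ℂ S 𝓘(ℂ)] (ψ : Fin m → Spinor S) {x q : M}
    {z : ℂ} (hz : z ∈ chartDomain S x) (hq : (chartAt ℂ x).symm z = q) :
    ∃ B : ℂ → ℂ, ContDiffAt ℂ ω B z ∧ B z = coord x (frame S q q) ∧
      ∀ᶠ w in 𝓝 z, localSpinor ψ x w = B w • localSpinor ψ q (transition x q w) := by
  refine ⟨fun w => coord x (frame S q ((chartAt ℂ x).symm w)), ?_,
    congrArg (fun p => coord x (frame S q p)) hq, ?_⟩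
  · have h1 : ContMDiffAt 𝓘(ℂ) 𝓘(ℂ) ω (chartAt ℂ x).symm z :=
      (contMDiffOn_chart_symm (n := ω) (I := 𝓘(ℂ))).contMDiffAt
        ((chartAt ℂ x).open_target.mem_nhds hz.1)
    have hqx : q ∈ frameDomain S x := hq ▸ hz.2
    exact (ContMDiffAt.comp_of_eq (contMDiffAt_coord_frame (mem_frameDomain q) hqx) h1
      hq).contDiffAt
  · have h1 : (chartAt ℂ x).target ∩ (chartAt ℂ x).symm ⁻¹'
        (frameDomain S q ∩ (chartAt ℂ q).source) ∈ 𝓝 z :=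
      ((chartAt ℂ x).isOpen_inter_preimage_symm
        ((isOpen_frameDomain q).inter (chartAt ℂ q).open_source)).mem_nhds
        ⟨hz.1, by rw [Set.mem_preimage, hq]; exact ⟨mem_frameDomain q, mem_chart_source ℂ q⟩⟩
    filter_upwards [h1, (isOpen_chartDomain x).mem_nhds hz] with w hw hwx
    have e : localSpinor ψ q (transition x q w) = spinorCoord ψ q ((chartAt ℂ x).symm w) := by
      rw [localSpinor, transition, (chartAt ℂ q).left_inv hw.2.2]
    rw [e]
    funext ⟨j, i⟩
    fin_cases i
    · exact coord_change hw.2.1 hwx.2 _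
    · exact coord_change hw.2.1 hwx.2 _

/-- Smoothness of a spinor is given at each point in the trivialization preferred at that very
point. Passing to the one at x multiplies by a holomorphic function and composes with a holomorphic
coordinate change. -/
theorem contDiffAt_localSpinor [ContMDiffVectorBundle ω ℂ S 𝓘(ℂ)] (ψ : Fin m → Spinor S) {x : M}
    {z : ℂ} (hz : z ∈ chartDomain S x) (a : Fin m × Fin 2) :
    ContDiffAt ℝ ∞ (fun w => localSpinor ψ x w a) z := by
  obtain ⟨B, hB, -, hev⟩ := localSpinor_change ψ hz rfl
  set q := (chartAt ℂ x).symm z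
  have hT : ContDiffAt ℝ ∞ (transition x q) z :=
    contDiffAt_transition_real hz.1 (mem_chart_source ℂ q)
  have h1 : ContDiffAt ℝ ∞ (fun w => B w * localSpinor ψ q (transition x q w) a) z :=
    ((hB.restrict_scalars ℝ).of_le (by simp)).mul
      (ContDiffAt.comp (g := fun w => localSpinor ψ q w a) z (contDiffAt_localSpinor_self ψ q a) hT)
  exact h1.congr_of_eventuallyEq (hev.mono fun w hw => congrFun hw a)

variable (σ : SpinStructure S) (g : HermitianMetric M) {lam : ℝ}

theorem vecNormSq_smul {ι : Type*} [Fintype ι] (c : ℂ) (v : ι → ℂ) :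
    vecNormSq (c • v) = Complex.normSq c * vecNormSq v := by
  simp [vecNormSq, Finset.mul_sum]

theorem antiRot_smul (c : ℂ) (v : Fin m × Fin 2 → ℂ) :
    antiRot (c • v) = starRingEnd ℂ c • antiRot v := by
  funext ⟨j, i⟩
  fin_cases i <;> simp [antiRot]

/-- The equations satisfied by the coordinates of a family of eigenspinors which solves the equation
for the energy-momentum tensor. -/
theorem dzbar_localSpinor [ContMDiffVectorBundle ω ℂ S 𝓘(ℂ)] (hlam : lam ≠ 0)
    (heigen : ∀ (j : Fin m) (p : M), σ.dirac g (ψ j) p = (lam : ℂ) • (ψ j).val p)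
    (hcrit : ∀ (p : M) (X Y : RealTangent p),
      ∑ j, σ.energyMomentum g (ψ j) p X Y = lam / 2 * g.inner p X Y) {x : M}
    {z : ℂ} (hz : z ∈ chartDomain S x) :
    localSpinor ψ x z ≠ 0 ∧ ∀ a, dzbar (fun w => localSpinor ψ x w a) z =
      lam * starRingEnd ℂ (σ.frameSq x ((chartAt ℂ x).symm z)) * vecNormSq (localSpinor ψ x z) *
        antiRot (localSpinor ψ x z) a := by
  obtain ⟨B, hB, hBz, hev⟩ := localSpinor_change ψ hz rfl
  set q := (chartAt ℂ x).symm z with hq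
  have hT := hasDerivAt_transition hz.1 hq.symm
  have hTz : transition x q z = chartAt ℂ q q := rfl
  have hB0 : B z ≠ 0 := by rw [hBz]; exact coord_frame_ne_zero (mem_frameDomain q) hz.2
  have hF : localSpinor ψ x z = B z • spinorCoord ψ q q := by
    rw [hev.self_of_nhds, hTz, localSpinor_self]
  obtain ⟨htr, -⟩ := energyMomentum_consequences σ g hlam heigen hcrit q
  have hr : 0 < √(g.conformalFactor q) := Real.sqrt_pos.2 (g.conformalFactor_pos q)
  have hn : ‖σ.frameSq q q‖ ≠ 0 := norm_ne_zero_iff.2 (σ.frameSq_self_ne_zero q)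
  have hF0 : spinorCoord ψ q q ≠ 0 := by
    intro h
    rw [h] at htr
    simp [vecNormSq] at htr
    exact hr.ne htr
  refine ⟨by rw [hF]; exact smul_ne_zero hB0 hF0, fun a => ?_⟩
  have hd : DifferentiableAt ℝ (fun w => localSpinor ψ q w a) (transition x q z) :=
    (contDiffAt_localSpinor_self ψ q a).differentiableAt (by simp)
  have hBd : DifferentiableAt ℂ B z := hB.differentiableAt (by simp)
  have hdT : DifferentiableAt ℝ (fun w => localSpinor ψ q (transition x q w) a) z :=
    DifferentiableAt.comp (g := fun w => localSpinor ψ q w a) z hd (hT.differentiableAt.restrictScalars ℝ)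
  have h1 : dzbar (fun w => localSpinor ψ x w a) z =
      dzbar (fun w => B w * localSpinor ψ q (transition x q w) a) z :=
    dzbar_congr (hev.mono fun w hw => congrFun hw a)
  rw [h1, dzbar_mul (hBd.restrictScalars ℝ) hdT, dzbar_eq_zero hBd, dzbar_comp hd hT, hTz,
    dzbar_localSpinor_self σ g heigen q a, hF, vecNormSq_smul, antiRot_smul]
  -- The trace identity replaces the only occurrence of the metric by |F|². This gives the equation
  -- an antiholomorphic coefficient λh̄, which harmonicity needs.
  have hratio : (√(g.conformalFactor q) / ‖σ.frameSq q q‖ : ℂ) = vecNormSq (spinorCoord ψ q q) := by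
    rw [← htr]
    push_cast
    have : ((‖σ.frameSq q q‖ : ℝ) : ℂ) ≠ 0 := by exact_mod_cast hn
    field_simp
  -- Transformation of h between the frame and coordinate at q and those at x. Its conjugate absorbs
  -- the factor from the chain rule for ∂̄ and the powers of B coming from F, |F|² and jF.
  have hfr : σ.frameSq q q * chartFactor x z = B z ^ 2 * σ.frameSq x q := by
    have hxs : q ∈ (chartAt ℂ x).source := (chartAt ℂ x).map_target hz.1
    rw [σ.frameSq_change hxs, hq, (chartAt ℂ x).right_inv hz.1, ← hq]
    have e : coord q (frame S x q) * B z = 1 := by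
      rw [hBz, mul_comm, ← coord_change (mem_frameDomain q) hz.2, coord_frame hz.2]
    linear_combination (-(coord q (frame S x q) * B z + 1) * (chartFactor x z * σ.frameSq q q)) * e
  have hfr' := congrArg (starRingEnd ℂ) hfr
  simp only [map_mul, map_pow] at hfr'
  have hBn : ((Complex.normSq (B z) : ℝ) : ℂ) = B z * starRingEnd ℂ (B z) := (Complex.mul_conj _).symm
  rw [hratio, Complex.ofReal_mul, hBn, Pi.smul_apply, smul_eq_mul]
  linear_combination (B z * lam * vecNormSq (spinorCoord ψ q q) * antiRot (spinorCoord ψ q q) a)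
    * hfr'

end LocalEquations

/-! ### Paths of projections -/

section ProjectionPaths

variable {ι : Type*} [Fintype ι]

omit [Fintype ι] in
theorem realCoords_injective : Function.Injective (realCoords (ι := ι)) := fun A B h => by
  ext a b
  have h0 : (A a b).re = (B a b).re := congrArg (fun v => v.ofLp (a, b, 0)) h
  have h1 : (A a b).im = (B a b).im := congrArg (fun v => v.ofLp (a, b, 1)) h
  exact Complex.ext h0 h1

/-- The velocity of a path of projections is tangent to the space of projections. -/
theorem exists_tangent_of_hasDerivAt {f : ℝ → Matrix ι ι ℂ} {v : EuclideanSpace ℝ (ι × ι × Fin 2)}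
    {t₀ : ℝ} (hd : HasDerivAt (fun t => realCoords (f t)) v t₀) (hf : ∀ t, f t * f t = f t) :
    ∃ ξ : Matrix ι ι ℂ, v = realCoords ξ ∧ ξ = ξ * f t₀ + f t₀ * ξ := by
  have hc : ∀ i, HasDerivAt (fun t => realCoords (f t) i) (v i) t₀ := fun i =>
    (EuclideanSpace.proj (𝕜 := ℝ) i).hasFDerivAt.comp_hasDerivAt t₀ hd
  have hentry : ∀ a b, HasDerivAt (fun t => f t a b)
      ((v (a, b, 0) : ℂ) + (v (a, b, 1) : ℂ) * Complex.I) t₀ := fun a b => by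
    have h0 : HasDerivAt (fun t => (f t a b).re) (v (a, b, 0)) t₀ := hc (a, b, 0)
    have h1 : HasDerivAt (fun t => (f t a b).im) (v (a, b, 1)) t₀ := hc (a, b, 1)
    have h := h0.ofReal_comp.add (h1.ofReal_comp.mul_const Complex.I)
    refine h.congr_of_eventuallyEq (Filter.Eventually.of_forall fun t => ?_)
    exact (Complex.re_add_im _).symm
  refine ⟨Matrix.of fun a b => (v (a, b, 0) : ℂ) + (v (a, b, 1) : ℂ) * Complex.I, ?_, ?_⟩
  · ext ⟨a, b, i⟩
    fin_cases i <;> simp [realCoords]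
  · ext a b
    -- Tangency is the derivative of f² = f, taken entry by entry.
    have h := HasDerivAt.fun_sum (u := Finset.univ)
      fun k _ => (hentry a k).fun_mul (hentry k b)
    have e : (fun t => ∑ k, f t a k * f t k b) = fun t => f t a b := by
      funext t
      exact (Matrix.mul_apply (M := f t) (N := f t)).symm.trans (by rw [hf t])
    rw [e] at h
    simp only [Matrix.add_apply, Matrix.mul_apply, Matrix.of_apply]
    rw [(hentry a b).unique h, Finset.sum_add_distrib]

end ProjectionPaths

/-! ### The map defined by the spinors, and its smoothness -/

section SpinorMap

variable {M : Type*} [TopologicalSpace M] [ChartedSpace ℂ M] [IsManifold 𝓘(ℂ) ω M]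
  {S : M → Type*} [∀ p, AddCommGroup (S p)] [∀ p, Module ℂ (S p)] [∀ p, TopologicalSpace (S p)]
  [TopologicalSpace (TotalSpace ℂ S)] [FiberBundle ℂ S] [VectorBundle ℂ ℂ S]

theorem SpinStructure.eventually_differentiableAt_frameSq (σ : SpinStructure S) (x : M) :
    ∀ᶠ z in 𝓝 (chartAt ℂ x x),
      DifferentiableAt ℂ (fun w => σ.frameSq x ((chartAt ℂ x).symm w)) z := by
  have hz : chartAt ℂ x x ∈ (chartAt ℂ x).target :=
    (chartAt ℂ x).map_source (mem_chart_source ℂ x)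
  have h1 : ContMDiffAt 𝓘(ℂ) 𝓘(ℂ) ω (chartAt ℂ x).symm (chartAt ℂ x x) :=
    (contMDiffOn_chart_symm (n := ω) (I := 𝓘(ℂ))).contMDiffAt
      ((chartAt ℂ x).open_target.mem_nhds hz)
  have h2 : ContDiffAt ℂ ω (fun w => σ.frameSq x ((chartAt ℂ x).symm w)) (chartAt ℂ x x) :=
    (ContMDiffAt.comp_of_eq (σ.holomorphic x) h1
      ((chartAt ℂ x).left_inv (mem_chart_source ℂ x))).contDiffAt
  exact (h2.eventually (by simp)).mono fun z hz => hz.differentiableAt (by simp)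

variable {m : ℕ} {ψ : Fin m → Spinor S}

omit [IsManifold 𝓘(ℂ) ω M] in
-- Two isomorphisms of the line S_q with ℂ differ by a scalar, so the homogeneous coordinates do not
-- depend on the one chosen.
theorem homCoord_eq {x q : M} (hq : q ∈ frameDomain S x) (ℓ : S q ≃ₗ[ℂ] ℂ) :
    homCoord ψ q ℓ = ℓ (frame S x q) • WithLp.toLp 2 (spinorCoord ψ x q) := by
  have h : ∀ s : S q, ℓ s = ℓ (frame S x q) * coord x s := fun s => by
    conv_lhs => rw [← coord_smul_frame hq s]
    rw [map_smul, smul_eq_mul, mul_comm]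
  ext ⟨j, i⟩
  fin_cases i
  · exact h _
  · exact h _

omit [IsManifold 𝓘(ℂ) ω M] in
theorem spinorCoord_change {x y q : M} (hx : q ∈ frameDomain S x) (hy : q ∈ frameDomain S y) :
    spinorCoord ψ y q = coord y (frame S x q) • spinorCoord ψ x q := by
  funext ⟨j, i⟩
  fin_cases i
  · exact coord_change hx hy _
  · exact coord_change hx hy _

/-- The map `[ψ₁₊ : ψ̄₁₋ : …]`. -/
def spinorMap (h0 : ∀ p, spinorCoord ψ p p ≠ 0) (p : M) :
    ℙ ℂ (EuclideanSpace ℂ (Fin m × Fin 2)) :=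
  Projectivization.mk ℂ (WithLp.toLp 2 (spinorCoord ψ p p))
    fun h => h0 p (congrArg WithLp.ofLp h)

omit [IsManifold 𝓘(ℂ) ω M] in
theorem spinorMap_eq (h0 : ∀ p, spinorCoord ψ p p ≠ 0) {x q : M} (hq : q ∈ frameDomain S x) :
    ∃ h : WithLp.toLp 2 (spinorCoord ψ x q) ≠ 0,
      spinorMap h0 q = Projectivization.mk ℂ (WithLp.toLp 2 (spinorCoord ψ x q)) h := by
  have hc : spinorCoord ψ x q ≠ 0 := by
    rw [spinorCoord_change (mem_frameDomain q) hq]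
    exact smul_ne_zero (coord_frame_ne_zero (mem_frameDomain q) hq) (h0 q)
  refine ⟨fun h => hc (congrArg WithLp.ofLp h), ?_⟩
  rw [spinorMap, Projectivization.mk_eq_mk_iff']
  exact ⟨coord q (frame S x q), by rw [spinorCoord_change hq (mem_frameDomain q)]; rfl⟩

omit [IsManifold 𝓘(ℂ) ω M] in
theorem isSpinorMap_spinorMap (h0 : ∀ p, spinorCoord ψ p p ≠ 0) :
    IsSpinorMap ψ (spinorMap h0) := by
  intro p ℓ
  have hp := mem_frameDomain (S := S) p
  have hc : ℓ (frame S p p) ≠ 0 := by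
    rw [Ne, LinearEquiv.map_eq_zero_iff]
    intro h
    have := coord_frame hp
    rw [h, ← coordEquiv_apply hp, map_zero] at this
    exact zero_ne_one this
  have h := homCoord_eq (ψ := ψ) hp ℓ
  have hne : homCoord ψ p ℓ ≠ 0 := by
    rw [h]
    exact smul_ne_zero hc fun h => h0 p (congrArg WithLp.ofLp h)
  refine ⟨hne, ?_⟩
  rw [spinorMap, Projectivization.mk_eq_mk_iff']
  refine ⟨(ℓ (frame S p p))⁻¹, ?_⟩
  rw [h, inv_smul_smul₀ hc]

omit [IsManifold 𝓘(ℂ) ω M] in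
theorem isSmoothMap_spinorMap (h0 : ∀ p, spinorCoord ψ p p ≠ 0) :
    IsSmoothMap 𝓘(ℝ, ℂ) (spinorMap h0) := by
  intro p
  refine contMDiffAt_affineLift (F := fun q => WithLp.toLp 2 (spinorCoord ψ p q)) ?_ ?_
  · have h : ContMDiffAt 𝓘(ℝ, ℂ) 𝓘(ℝ, Fin m × Fin 2 → ℂ) ∞ (spinorCoord ψ p) p := by
      refine contMDiffAt_pi_space.2 ?_
      rintro ⟨j, i⟩
      fin_cases i
      · exact (ψ j).smooth_plus p
      · exact (ψ j).smooth_minus p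
    have hL : ContDiff ℝ ∞ (fun v : Fin m × Fin 2 → ℂ => (WithLp.toLp 2 v :
        EuclideanSpace ℂ (Fin m × Fin 2))) :=
      ((PiLp.continuousLinearEquiv 2 ℝ (fun _ : Fin m × Fin 2 => ℂ)).symm).contDiff
    exact ContMDiffAt.comp p hL.contMDiff.contMDiffAt h
  · filter_upwards [(isOpen_frameDomain (S := S) p).mem_nhds (mem_frameDomain p)] with q hq
    exact spinorMap_eq h0 hq

omit [IsManifold 𝓘(ℂ) ω M] in
theorem projEmbed_spinorMap (h0 : ∀ p, spinorCoord ψ p p ≠ 0) {x : M} {z : ℂ}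
    (hz : z ∈ chartDomain S x) :
    projEmbed (EuclideanSpace.basisFun (Fin m × Fin 2) ℂ) (spinorMap h0 ((chartAt ℂ x).symm z)) =
      realCoords (lineProj (localSpinor ψ x z)) := by
  obtain ⟨h, e⟩ := spinorMap_eq h0 hz.2
  rw [e, projEmbed_mk]
  congr 2
  funext a
  simp [basisCoords, localSpinor, EuclideanSpace.inner_single_left]

end SpinorMap

/-! ### Conformality from orthogonality of ∂F and ∂̄F -/

section Conformality

variable {ι : Type*} [Fintype ι]

theorem sum_conj_mul_self (v : ι → ℂ) : ∑ a, starRingEnd ℂ (v a) * v a = vecNormSq v :=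
  (ofReal_vecNormSq v).symm

/-- If `∂F` and `∂̄F` are orthogonal, and `∂̄F` is orthogonal to `F`, then the line spanned by `F` is
a conformal map. -/
theorem inner_lineTangent_of_orthogonal {F d D : ι → ℂ} (hF : F ≠ 0)
    (hD : ∑ a, starRingEnd ℂ (F a) * D a = 0) (hDd : ∑ a, starRingEnd ℂ (D a) * d a = 0)
    {u : ℂ → ι → ℂ} (hu : ∀ X a, u X a = (X * d a + starRingEnd ℂ X * D a) / 2) (X Y : ℂ) :
    ⟪realCoords (lineTangent F (orthPart F (u X))), realCoords (lineTangent F (orthPart F (u Y)))⟫_ℝ =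
      (vecNormSq (orthPart F d) + vecNormSq D) / (2 * vecNormSq F) *
        (X.re * Y.re + X.im * Y.im) := by
  set w := orthPart F d with hw
  have hDF : ∑ a, starRingEnd ℂ (D a) * F a = 0 := by
    have := congrArg (starRingEnd ℂ) hD
    rw [map_sum, map_zero] at this
    rw [← this]
    exact Finset.sum_congr rfl fun k _ => by simp [mul_comm]
  -- Removing from d its component along F does not change its product with D, since D is orthogonal
  -- to F.
  have hDw : ∑ a, starRingEnd ℂ (D a) * w a = 0 := by
    have e : ∀ a, starRingEnd ℂ (D a) * w a = starRingEnd ℂ (D a) * d a -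
        (vecNormSq F : ℂ)⁻¹ * (∑ b, starRingEnd ℂ (F b) * d b) * (starRingEnd ℂ (D a) * F a) :=
      fun a => by rw [hw, orthPart]; ring
    simp only [e]
    rw [Finset.sum_sub_distrib, ← Finset.mul_sum, hDF, hDd, mul_zero, sub_zero]
  have hwD : ∑ a, starRingEnd ℂ (w a) * D a = 0 := by
    have := congrArg (starRingEnd ℂ) hDw
    rw [map_sum, map_zero] at this
    rw [← this]
    exact Finset.sum_congr rfl fun k _ => by simp [mul_comm]
  have ho : ∀ X a, orthPart F (u X) a = (X * w a + starRingEnd ℂ X * D a) / 2 := fun X a => by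
    have e : ∑ b, starRingEnd ℂ (F b) * u X b = X / 2 * ∑ b, starRingEnd ℂ (F b) * d b := by
      have e1 : ∀ b, starRingEnd ℂ (F b) * u X b = X / 2 * (starRingEnd ℂ (F b) * d b) +
          starRingEnd ℂ X / 2 * (starRingEnd ℂ (F b) * D b) := fun b => by rw [hu]; ring
      simp only [e1]
      rw [Finset.sum_add_distrib, ← Finset.mul_sum, ← Finset.mul_sum, hD, mul_zero, add_zero]
    rw [orthPart, e, hu, hw, orthPart]
    ring
  rw [inner_lineTangent hF (sum_conj_mul_orthPart hF _) (sum_conj_mul_orthPart hF _)]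
  -- The terms in XY and X̄Ȳ, which would spoil conformality, carry the products of w with D and
  -- vanish. Both X̄Y and XȲ have real part the Euclidean product of X and Y.
  have hs : ∑ a, starRingEnd ℂ (orthPart F (u X) a) * orthPart F (u Y) a =
      (starRingEnd ℂ X * Y * vecNormSq w + X * starRingEnd ℂ Y * vecNormSq D) / 4 := by
    have e : ∀ a, starRingEnd ℂ (orthPart F (u X) a) * orthPart F (u Y) a =
        starRingEnd ℂ X * Y / 4 * (starRingEnd ℂ (w a) * w a) +
        starRingEnd ℂ X * starRingEnd ℂ Y / 4 * (starRingEnd ℂ (w a) * D a) +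
        X * Y / 4 * (starRingEnd ℂ (D a) * w a) +
        X * starRingEnd ℂ Y / 4 * (starRingEnd ℂ (D a) * D a) := fun a => by
      rw [ho, ho]
      simp only [map_div₀, map_add, map_mul, Complex.conj_conj, map_ofNat]
      ring
    simp only [e]
    rw [Finset.sum_add_distrib, Finset.sum_add_distrib, Finset.sum_add_distrib, ← Finset.mul_sum,
      ← Finset.mul_sum, ← Finset.mul_sum, ← Finset.mul_sum, hDw, hwD, sum_conj_mul_self,
      sum_conj_mul_self]
    ring
  have hre : (∑ a, starRingEnd ℂ (orthPart F (u X) a) * orthPart F (u Y) a).re =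
      (vecNormSq w + vecNormSq D) / 4 * (X.re * Y.re + X.im * Y.im) := by
    rw [hs, show (4 : ℂ) = ((4 : ℝ) : ℂ) by norm_num, Complex.div_ofReal_re]
    simp
    ring
  rw [hre]
  ring

theorem fderiv_eq_dz_dzbar (f : ℂ → ℂ) (z X : ℂ) :
    fderiv ℝ f z X = (X * dz f z + starRingEnd ℂ X * dzbar f z) / 2 := by
  rw [clm_complex_apply, dz, dzbar]
  have e : starRingEnd ℂ X = X.re - X.im * Complex.I := by
    apply Complex.ext <;> simp
  rw [e]
  conv_rhs => rw [← Complex.re_add_im X]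
  simp only [Complex.real_smul, Complex.add_re, Complex.ofReal_re, Complex.mul_re, Complex.I_re,
    mul_zero, Complex.ofReal_im, Complex.I_im, mul_one, sub_self, add_zero, Complex.add_im,
    Complex.mul_im, zero_add]
  linear_combination (X.im * fderiv ℝ f z Complex.I) * Complex.I_sq

end Conformality

/-! ### The spinor map is conformal with harmonic projection -/

section SpinorMap

variable {M : Type*} [TopologicalSpace M] [ChartedSpace ℂ M] [IsManifold 𝓘(ℂ) ω M]
  {S : M → Type*} [∀ p, AddCommGroup (S p)] [∀ p, Module ℂ (S p)] [∀ p, TopologicalSpace (S p)]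
  [TopologicalSpace (TotalSpace ℂ S)] [FiberBundle ℂ S] [VectorBundle ℂ ℂ S]
  {m : ℕ} {ψ : Fin m → Spinor S} (σ : SpinStructure S) (g : HermitianMetric M) {lam : ℝ}

/-- Since ∂̄F is a multiple of jF, it is orthogonal to F always and to ∂F by the trace free
equation. The bound λ²/2 is the contribution of |∂̄F|² = λ² · (conformal factor) · |F|² alone; it
yields the immersion property and the uniform lower bound needed for the area. -/
theorem inner_realDiff_spinorMap (hlam : lam ≠ 0)
    (heigen : ∀ (j : Fin m) (p : M), σ.dirac g (ψ j) p = (lam : ℂ) • (ψ j).val p)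
    (hcrit : ∀ (p : M) (X Y : RealTangent p),
      ∑ j, σ.energyMomentum g (ψ j) p X Y = lam / 2 * g.inner p X Y)
    (h0 : ∀ p, spinorCoord ψ p p ≠ 0) (p : M) :
    ∃ c, lam ^ 2 / 2 ≤ c ∧ ∀ X Y : ℂ,
      ⟪realDiff (fun q => projEmbed (EuclideanSpace.basisFun (Fin m × Fin 2) ℂ) (spinorMap h0 q)) p X,
        realDiff (fun q => projEmbed (EuclideanSpace.basisFun (Fin m × Fin 2) ℂ) (spinorMap h0 q)) p
          Y⟫_ℝ = c * (g.conformalFactor p * (X.re * Y.re + X.im * Y.im)) := by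
  obtain ⟨htr, horth⟩ := energyMomentum_consequences σ g hlam heigen hcrit p
  set z := chartAt ℂ p p with hz
  set F := spinorCoord ψ p p with hF
  have hFz : localSpinor ψ p z = F := localSpinor_self ψ p
  have hconf := g.conformalFactor_pos p
  have hr : 0 < √(g.conformalFactor p) := Real.sqrt_pos.2 hconf
  have hr2 : √(g.conformalFactor p) ^ 2 = g.conformalFactor p := Real.sq_sqrt hconf.le
  have hn : 0 < ‖σ.frameSq p p‖ := norm_pos_iff.2 (σ.frameSq_self_ne_zero p)
  have hF0 : F ≠ 0 := h0 p
  have hN := vecNormSq_pos hF0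
  set κ : ℂ := lam * starRingEnd ℂ (σ.frameSq p p) * (√(g.conformalFactor p) / ‖σ.frameSq p p‖)
    with hκ
  set D : Fin m × Fin 2 → ℂ := fun a => dzbar (fun w => localSpinor ψ p w a) z with hD
  set d : Fin m × Fin 2 → ℂ := fun a => dz (fun w => localSpinor ψ p w a) z with hd
  have hDF : D = κ • antiRot F := funext fun a => dzbar_localSpinor_self σ g heigen p a
  have hDN : vecNormSq D = lam ^ 2 * g.conformalFactor p * vecNormSq F := by
    rw [hDF, vecNormSq_smul, vecNormSq_antiRot, hκ, Complex.normSq_mul, Complex.normSq_mul,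
      Complex.normSq_conj, ← Complex.ofReal_div, Complex.normSq_ofReal, Complex.normSq_ofReal,
      Complex.normSq_eq_norm_sq]
    field_simp
    rw [hr2]
  have h1 : ∑ a, starRingEnd ℂ (F a) * D a = 0 := by
    have e : ∀ a, starRingEnd ℂ (F a) * D a = κ * (starRingEnd ℂ (F a) * antiRot F a) :=
      fun a => by rw [hDF, Pi.smul_apply, smul_eq_mul]; ring
    simp only [e]
    rw [← Finset.mul_sum, sum_conj_mul_antiRot, mul_zero]
  have h2 : ∑ a, starRingEnd ℂ (D a) * d a = 0 := by
    have e : ∀ a, starRingEnd ℂ (D a) * d a =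
        starRingEnd ℂ κ * (starRingEnd ℂ (antiRot F a) * d a) :=
      fun a => by rw [hDF, Pi.smul_apply, smul_eq_mul, map_mul]; ring
    simp only [e]
    rw [← Finset.mul_sum, horth, mul_zero]
  have hdiff : ∀ X, realDiff (fun q => projEmbed (EuclideanSpace.basisFun (Fin m × Fin 2) ℂ)
      (spinorMap h0 q)) p X = realCoords (lineTangent F (orthPart F
        fun a => fderiv ℝ (fun w => localSpinor ψ p w a) z X)) := fun X => by
    have e := realDiff_projEmbed (EuclideanSpace.basisFun (Fin m × Fin 2) ℂ)
      ((contMDiff_projEmbed _ (isSmoothMap_spinorMap h0)).mdifferentiable (by simp) p)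
      (fun a => (contDiffAt_localSpinor_self ψ p a).differentiableAt (by simp))
      (by rw [← hz, hFz]; exact h0 p)
      (((isOpen_chartDomain (S := S) p).eventually_mem (mem_chartDomain p)).mono fun w hw =>
        projEmbed_spinorMap h0 hw) X
    rw [← hz, hFz] at e
    exact e
  refine ⟨(vecNormSq (orthPart F d) + vecNormSq D) / (2 * vecNormSq F) / g.conformalFactor p,
    ?_, fun X Y => ?_⟩
  · rw [hDN, div_div, div_le_div_iff₀ (by norm_num) (by positivity)]
    have hnn : 0 ≤ vecNormSq (orthPart F d) :=
      Finset.sum_nonneg fun a _ => Complex.normSq_nonneg _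
    nlinarith
  · rw [hdiff, hdiff, inner_lineTangent_of_orthogonal
      (u := fun X a => fderiv ℝ (fun w => localSpinor ψ p w a) z X) hF0 h1 h2
      (fun X a => fderiv_eq_dz_dzbar _ z X) X Y]
    field_simp

/-- The harmonic system applies with G = jF and c = λh̄. The neighbourhood is cut down to where the
frame is defined and h is holomorphic. -/
theorem inner_chartLaplacian_spinorMap [ContMDiffVectorBundle ω ℂ S 𝓘(ℂ)] (hlam : lam ≠ 0)
    (heigen : ∀ (j : Fin m) (p : M), σ.dirac g (ψ j) p = (lam : ℂ) • (ψ j).val p)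
    (hcrit : ∀ (p : M) (X Y : RealTangent p),
      ∑ j, σ.energyMomentum g (ψ j) p X Y = lam / 2 * g.inner p X Y)
    (h0 : ∀ p, spinorCoord ψ p p ≠ 0) (x : M) :
    ∃ N : Set M, IsOpen N ∧ x ∈ N ∧ N ⊆ (chartAt ℂ x).source ∧
      ∀ q ∈ N, chartAt ℂ x q ∈ chartDomain S x ∧ ∀ ξ : Matrix (Fin m × Fin 2) (Fin m × Fin 2) ℂ,
        ξ = ξ * lineProj (localSpinor ψ x (chartAt ℂ x q)) +
          lineProj (localSpinor ψ x (chartAt ℂ x q)) * ξ →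
        ⟪chartLaplacian (fun q => projEmbed (EuclideanSpace.basisFun (Fin m × Fin 2) ℂ)
          (spinorMap h0 q)) x (chartAt ℂ x q), realCoords ξ⟫_ℝ = 0 := by
  obtain ⟨V, hV, hVo, hxV⟩ := eventually_nhds_iff.1 (σ.eventually_differentiableAt_frameSq x)
  set U := chartDomain S x ∩ V with hU
  have hUo : IsOpen U := (isOpen_chartDomain x).inter hVo
  refine ⟨(chartAt ℂ x).source ∩ chartAt ℂ x ⁻¹' U, (chartAt ℂ x).isOpen_inter_preimage hUo,
    ⟨mem_chart_source ℂ x, mem_chartDomain x, hxV⟩, Set.inter_subset_left, ?_⟩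
  rintro q ⟨-, hq⟩
  refine ⟨hq.1, fun ξ hξ => ?_⟩
  set z := chartAt ℂ x q
  have hF : ∀ z ∈ U, ∀ a, ContDiffAt ℝ ∞ (fun w => localSpinor ψ x w a) z := fun z hz a =>
    contDiffAt_localSpinor ψ hz.1 a
  have heq := fun z (hz : z ∈ U) => dzbar_localSpinor σ g hlam heigen hcrit hz.1
  have hFd : ∀ z ∈ U, ∀ a, DifferentiableAt ℝ (fun w => localSpinor ψ x w a) z := fun z hz a =>
    (hF z hz a).differentiableAt (by simp)
  have hh : ∀ z ∈ U, DifferentiableAt ℝ (fun w => σ.frameSq x ((chartAt ℂ x).symm w)) z :=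
    fun z hz => (hV z hz.2).restrictScalars ℝ
  have hlap : chartLaplacian (fun q => projEmbed (EuclideanSpace.basisFun (Fin m × Fin 2) ℂ)
      (spinorMap h0 q)) x z =
      realCoords (Matrix.of fun a b => dz (dzbar fun w => lineProj (localSpinor ψ x w) a b) z) := by
    rw [← laplacian_realCoords fun a b => contDiffAt_lineProj (hF z hq) (heq z hq).1 a b]
    have hev : (fun w => projEmbed (EuclideanSpace.basisFun (Fin m × Fin 2) ℂ)
        (spinorMap h0 ((chartAt ℂ x).symm w))) =ᶠ[𝓝 z]
        fun w => realCoords (lineProj (localSpinor ψ x w)) :=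
      ((isOpen_chartDomain (S := S) x).eventually_mem hq.1).mono fun w hw => projEmbed_spinorMap h0 hw
    have hev2 : ∀ v, fderiv ℝ (fun w => fderiv ℝ (fun w => projEmbed (EuclideanSpace.basisFun
        (Fin m × Fin 2) ℂ) (spinorMap h0 ((chartAt ℂ x).symm w))) w v) z =
        fderiv ℝ (fun w => fderiv ℝ (fun w => realCoords (lineProj (localSpinor ψ x w))) w v) z :=
      fun v => Filter.EventuallyEq.fderiv_eq
        (hev.fderiv.mono fun w hw => congrArg (fun T : ℂ →L[ℝ] _ => T v) hw)
    rw [chartLaplacian, hev2, hev2]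
  rw [hlap]
  refine inner_laplacian_lineProj_eq_zero hUo hF (G := fun w => antiRot (localSpinor ψ x w))
    (c := fun w => lam * starRingEnd ℂ (σ.frameSq x ((chartAt ℂ x).symm w))) ?_ ?_
    (fun z hz => (heq z hz).1) (fun z _ => sum_conj_mul_antiRot _)
    (fun z hz a => (heq z hz).2 a) ?_ ?_ hq hξ
  · rintro z hz ⟨j, i⟩
    fin_cases i
    · exact (Complex.conjCLE.contDiff.contDiffAt.comp z (hF z hz (j, 1))).neg
    · exact Complex.conjCLE.contDiff.contDiffAt.comp z (hF z hz (j, 0))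
  · exact fun z hz => (Complex.conjCLE.differentiableAt.comp z (hh z hz)).const_mul (lam : ℂ)
  -- The equation for ∂G is the conjugate of the one for ∂̄F; the minus sign is j² = -1.
  · rintro z hz ⟨j, i⟩
    have hneg : ∀ f : ℂ → ℂ, dz (fun w => -f w) z = -dz f z := fun f => by
      simp only [dz, fderiv_fun_neg, neg_apply]
      ring
    fin_cases i
    · refine (hneg fun w => starRingEnd ℂ (localSpinor ψ x w (j, 1))).trans ?_
      rw [dz_conj (hFd z hz (j, 1)), (heq z hz).2 (j, 1)]
      simp [antiRot]
    · refine (dz_conj (hFd z hz (j, 0))).trans ?_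
      rw [(heq z hz).2 (j, 0)]
      simp [antiRot]
  · intro z hz
    have hc : DifferentiableAt ℝ (fun w => starRingEnd ℂ (σ.frameSq x ((chartAt ℂ x).symm w))) z :=
      Complex.conjCLE.differentiableAt.comp z (hh z hz)
    rw [dz_mul (differentiableAt_const _) hc, dz_conj (hh z hz), dzbar_eq_zero (hV z hz.2)]
    simp [dz]

end SpinorMap

/-! ### Orthonormality of e₁, e₂ -/

section OrthonormalFrame

variable {M : Type*} [TopologicalSpace M] [ChartedSpace ℂ M] [IsManifold 𝓘(ℂ) ω M]

theorem HermitianMetric.inner_frame (g : HermitianMetric M) (p : M) :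
    g.inner p (g.e₁ p) (g.e₁ p) = 1 ∧ g.inner p (g.e₂ p) (g.e₂ p) = 1 ∧
      g.inner p (g.e₁ p) (g.e₂ p) = 0 := by
  have hr : 0 < √(g.conformalFactor p) := Real.sqrt_pos.2 (g.conformalFactor_pos p)
  have hr2 : √(g.conformalFactor p) ^ 2 = g.conformalFactor p :=
    Real.sq_sqrt (g.conformalFactor_pos p).le
  refine ⟨(congrArg₂ (fun X Y => g.inner p X Y) (g.e₁_eq p) (g.e₁_eq p)).trans
      ((g.inner_eq p _ _).trans ?_),
    (congrArg₂ (fun X Y => g.inner p X Y) (g.e₂_eq p) (g.e₂_eq p)).trans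
      ((g.inner_eq p _ _).trans ?_),
    (congrArg₂ (fun X Y => g.inner p X Y) (g.e₁_eq p) (g.e₂_eq p)).trans
      ((g.inner_eq p _ _).trans ?_)⟩ <;>
  rw [← Complex.ofReal_inv] <;> simp
  all_goals
    field_simp
    exact hr2.symm

end OrthonormalFrame

/-! ### Vanishing of the first variation of the energy -/

section Criticality

variable {M : Type*} [TopologicalSpace M] [ChartedSpace ℂ M] [IsManifold 𝓘(ℂ) ω M]
  {S : M → Type*} [∀ p, AddCommGroup (S p)] [∀ p, Module ℂ (S p)] [∀ p, TopologicalSpace (S p)]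
  [TopologicalSpace (TotalSpace ℂ S)] [FiberBundle ℂ S] [VectorBundle ℂ ℂ S]
  {m : ℕ} {ψ : Fin m → Spinor S} (σ : SpinStructure S) (g : HermitianMetric M) {lam : ℝ}

/-- The trace identity equates |h||F|² with the square root of the conformal factor, which is
positive. -/
theorem spinorCoord_ne_zero (hlam : lam ≠ 0)
    (heigen : ∀ (j : Fin m) (p : M), σ.dirac g (ψ j) p = (lam : ℂ) • (ψ j).val p)
    (hcrit : ∀ (p : M) (X Y : RealTangent p),
      ∑ j, σ.energyMomentum g (ψ j) p X Y = lam / 2 * g.inner p X Y) (p : M) :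
    spinorCoord ψ p p ≠ 0 := by
  obtain ⟨htr, -⟩ := energyMomentum_consequences σ g hlam heigen hcrit p
  intro h
  rw [h] at htr
  simp only [vecNormSq, Pi.zero_apply, map_zero, Finset.sum_const_zero, mul_zero] at htr
  exact (Real.sqrt_pos.2 (g.conformalFactor_pos p)).ne htr

variable [T2Space M] [CompactSpace M] [MeasurableSpace M] [BorelSpace M]

/-- The energy is stationary at the map defined by the spinors. -/
theorem hasDerivAt_energy_spinorMap [ContMDiffVectorBundle ω ℂ S 𝓘(ℂ)] (hlam : lam ≠ 0)
    (heigen : ∀ (j : Fin m) (p : M), σ.dirac g (ψ j) p = (lam : ℂ) • (ψ j).val p)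
    (hcrit : ∀ (p : M) (X Y : RealTangent p),
      ∑ j, σ.energyMomentum g (ψ j) p X Y = lam / 2 * g.inner p X Y)
    (h0 : ∀ p, spinorCoord ψ p p ≠ 0)
    {Φ : ℝ → M → ℙ ℂ (EuclideanSpace ℂ (Fin m × Fin 2))} (hΦ : IsVariation (spinorMap h0) Φ) :
    HasDerivAt (fun t => ∫ q, gradPair g
      (fun p => projEmbed (EuclideanSpace.basisFun (Fin m × Fin 2) ℂ) (Φ t p))
      (fun p => projEmbed (EuclideanSpace.basisFun (Fin m × Fin 2) ℂ) (Φ t p)) q ∂g.area) 0 0 := by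
  set b := EuclideanSpace.basisFun (Fin m × Fin 2) ℂ
  set P : ℝ × M → EuclideanSpace ℝ ((Fin m × Fin 2) × (Fin m × Fin 2) × Fin 2) :=
    fun x => projEmbed b (Φ x.1 x.2) with hPdef
  have hP : ContMDiff (𝓘(ℝ, ℝ).prod 𝓘(ℝ, ℂ)) 𝓘(ℝ, _) ∞ P := contMDiff_projEmbed b hΦ.smooth
  have hP0 : (fun p => P (0, p)) = fun p => projEmbed b (spinorMap h0 p) := by
    funext p
    rw [hPdef]
    simp only [hΦ.zero]
  have h := hasDerivAt_integral_gradPair g hP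
  have hz : ∫ q, gradPair g (fun p => P (0, p)) (fun p => velocity P (0, p)) q ∂g.area = 0 := by
    refine integral_gradPair_eq_zero g (contMDiff_slice hP 0)
      (contMDiff_slice (contMDiff_velocity hP) 0) fun x => ?_
    obtain ⟨N, hNo, hxN, hNs, hN⟩ := inner_chartLaplacian_spinorMap σ g hlam heigen hcrit h0 x
    refine ⟨N, hNo, hxN, hNs, fun q hq => ?_⟩
    obtain ⟨hqU, hqN⟩ := hN q hq
    have hproj : ∀ t, lineProj (basisCoords b (Φ t q).rep) * lineProj (basisCoords b (Φ t q).rep) =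
        lineProj (basisCoords b (Φ t q).rep) := fun t =>
      lineProj_mul_self (basisCoords_ne_zero b (Φ t q).rep_nonzero)
    -- For fixed q the variation is a path of projections, so its velocity is tangent at the
    -- projection to Ψ(q), where the Laplacian is normal.
    obtain ⟨ξ, hv, hξ⟩ := exists_tangent_of_hasDerivAt
      (f := fun t => lineProj (basisCoords b (Φ t q).rep)) (hasDerivAt_velocity hP 0 q) hproj
    have hqs : (chartAt ℂ x).symm (chartAt ℂ x q) = q := (chartAt ℂ x).left_inv (hNs hq)
    have hline : lineProj (basisCoords b (Φ 0 q).rep) =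
        lineProj (localSpinor ψ x (chartAt ℂ x q)) := by
      have e := projEmbed_spinorMap h0 hqU
      rw [hqs, ← hΦ.zero] at e
      exact realCoords_injective e
    rw [hP0, hv]
    refine hqN ξ ?_
    rw [← hline]
    exact hξ
  have h2 : ∫ q, 2 * gradPair g (fun p => P (0, p)) (fun p => velocity P (0, p)) q ∂g.area = 0 := by
    rw [integral_const_mul, hz, mul_zero]
  rw [h2] at h
  exact h

end Criticality

end SpinSurface

end

/-! ### Proof of the theorem -/

theorem theorem4 {M : Type*} [TopologicalSpace M] [T2Space M] [CompactSpace M]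
    [MeasurableSpace M] [BorelSpace M] [ChartedSpace ℂ M] [IsManifold 𝓘(ℂ) ω M]
    (g : SpinSurface.HermitianMetric M)
    (S : M → Type*) [∀ p, AddCommGroup (S p)] [∀ p, Module ℂ (S p)]
    [∀ p, TopologicalSpace (S p)] [TopologicalSpace (TotalSpace ℂ S)] [FiberBundle ℂ S]
    [VectorBundle ℂ ℂ S] [ContMDiffVectorBundle ω ℂ S 𝓘(ℂ)]
    (σ : SpinSurface.SpinStructure S)
    (m : ℕ) (ψ : Fin m → SpinSurface.Spinor S) (lam : ℝ) (hlam : lam ≠ 0)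
    (heigen : ∀ (j : Fin m) (p : M), σ.dirac g (ψ j) p = (lam : ℂ) • (ψ j).val p)
    (hcrit : ∀ (p : M) (X Y : SpinSurface.RealTangent p),
      ∑ j, σ.energyMomentum g (ψ j) p X Y = lam / 2 * g.inner p X Y) :
    ∃ Ψ : M → ℙ ℂ (EuclideanSpace ℂ (Fin m × Fin 2)),
      SpinSurface.IsSpinorMap ψ Ψ ∧
      SpinSurface.IsHarmonic g Ψ ∧
      SpinSurface.IsWeaklyConformal g Ψ ∧
      SpinSurface.IsBranchedMinimalImmersion g Ψ := by
  have h0 := SpinSurface.spinorCoord_ne_zero σ g hlam heigen hcrit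
  set b := EuclideanSpace.basisFun (Fin m × Fin 2) ℂ
  have hs := SpinSurface.isSmoothMap_spinorMap h0
  have hl2 : 0 < lam ^ 2 / 2 := by positivity
  choose c hcl hc using SpinSurface.inner_realDiff_spinorMap σ g hlam heigen hcrit h0
  have hpull : ∀ (p : M) (X Y : SpinSurface.RealTangent p),
      SpinSurface.pullbackMetric (SpinSurface.spinorMap h0) p X Y = 2 * c p * g.inner p X Y :=
    fun p X Y => by
      refine (SpinSurface.pullbackMetric_eq_of_isSmoothMap b hs p X Y).trans ?_
      rw [mul_assoc]
      exact congrArg (2 * ·) ((hc p X Y).trans (congrArg (c p * ·) (g.inner_eq p X Y).symm))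
  -- The pullback metric is 2c g with 2c ≥ λ² > 0, so the differential has no kernel and there are
  -- no branch points.
  have himm : ∀ p, SpinSurface.IsImmersionAt (SpinSurface.spinorMap h0) p := fun p => by
    refine (injective_iff_map_eq_zero (SpinSurface.diff (SpinSurface.spinorMap h0) p)).2
      fun X hX => ?_
    by_contra hne
    have h1 := hpull p X X
    have h2 : SpinSurface.pullbackMetric (SpinSurface.spinorMap h0) p X X = 0 := by
      simp [SpinSurface.pullbackMetric, hX]
    have h3 : 0 < g.inner p X X := g.pos p X hne
    have h4 := hcl p
    rw [h2] at h1
    have : 0 < 2 * c p * g.inner p X X := by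
      have : 0 < c p := by linarith
      positivity
    linarith
  have hframe := g.inner_frame
  refine ⟨SpinSurface.spinorMap h0, SpinSurface.isSpinorMap_spinorMap h0, ⟨hs, fun Φ hΦ => ?_⟩,
    ⟨fun p => 2 * c p, fun p => ?_, hpull⟩, ⟨hs, fun p => ⟨1, le_rfl,
      SpinSurface.hasBranchForm_one hs (himm p)⟩, fun Φ _ hΦ _ _ _ => ?_⟩⟩
  · have h := SpinSurface.hasDerivAt_energy_spinorMap σ g hlam heigen hcrit h0 hΦ
    refine h.congr_of_eventuallyEq (Filter.Eventually.of_forall fun t => ?_)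
    have ht := SpinSurface.isSmoothMap_slice hΦ.smooth t
    simp only [SpinSurface.energy, SpinSurface.energyDensity_eq b g ht]
    rw [integral_const_mul]
    ring
  · have := hcl p
    linarith
  · have hE := SpinSurface.hasDerivAt_energy_spinorMap σ g hlam heigen hcrit h0 hΦ
    have hP := SpinSurface.contMDiff_projEmbed b hΦ.smooth
    have hP0 : (fun p => SpinSurface.projEmbed b (Φ 0 p)) =
        fun p => SpinSurface.projEmbed b (SpinSurface.spinorMap h0 p) := by rw [hΦ.zero]
    have hin : ∀ p (X Y : SpinSurface.RealTangent p),
        ⟪SpinSurface.realDiff (fun p => SpinSurface.projEmbed b (Φ 0 p)) p X,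
          SpinSurface.realDiff (fun p => SpinSurface.projEmbed b (Φ 0 p)) p Y⟫_ℝ =
        c p * g.inner p X Y := fun p X Y => by
      rw [hP0]
      exact (hc p X Y).trans (congrArg (c p * ·) (g.inner_eq p X Y).symm)
    have h := SpinSurface.hasDerivAt_integral_sqrt_gramDet g hP hl2
      (fun q => by
        refine le_of_le_of_eq ?_ (hin q (g.e₁ q) (g.e₁ q)).symm
        rw [(hframe q).1, mul_one]
        exact hcl q)
      (fun q => (hin q (g.e₁ q) (g.e₁ q)).trans (by
        rw [(hframe q).1, ← (hframe q).2.1]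
        exact (hin q (g.e₂ q) (g.e₂ q)).symm))
      (fun q => (hin q (g.e₁ q) (g.e₂ q)).trans (by rw [(hframe q).2.2, mul_zero])) hE
    -- The metric of projective space is twice that of the embedding, so on a surface its area is
    -- twice as large.
    have h2 := h.const_mul 2
    rw [mul_zero] at h2
    refine h2.congr_of_eventuallyEq (Filter.Eventually.of_forall fun t => ?_)
    have ht := SpinSurface.isSmoothMap_slice hΦ.smooth t
    simp only [SpinSurface.mapArea, SpinSurface.jacobian_eq b g ht]
    rw [integral_const_mul]
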